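/- **Setting.** Let $\mathbb H$ be a real separable Hilbert space with orthonormal basis $(\psi_j)_{j\ge1}$; write $[f]_j=\langle f,\psi_j\rangle$, $[f]_m=([f]_j)_{1\le j\le m}$, and, for an operator $K$, $[K]_m=(\langle K\psi_l,\psi_j\rangle)_{1\le j,l\le m}$. Put $\|f\|_w^2=\sum_{j\ge1}w_j[f]_j^2$ for a positive sequence $w$. Consider the functional linear model $Y=\langle\beta,X\rangle+\sigma\epsilon$, $\sigma>0$, where $X$ is a centred $\mathbb H$-valued random variable with $\mathbb E\|X\|^2<\infty$ and covariance operator $T f=\mathbb E[\langle f,X\rangle X]$, $\epsilon$ is centred with variance one, and $X$ and $\epsilon$ are uncorrelated ($\mathbb E[\epsilon X]=0$). Let $(Y_i,X_i)$, $i=1,\dots,n$, be an i.i.d. sample of $(Y,X)$. **Weights.** Let $\gamma$ and $\upsilon$ be strictly positive sequences with $\gamma_1=\upsilon_1=1$, $\gamma$ non-decreasing, $\upsilon$ non-increasing and $\sum_j\upsilon_j<\infty$. For $n\ge1$ let $k_n^*\in\arg\max_{m\ge1}\frac{\min\{\upsilon_m/\gamma_m,\,1/n\}}{\max\{\upsilon_m/\gamma_m,\,1/n\}}$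 (any maximiser), $\alpha_n^*=\max\{\upsilon_{k_n^*}/\gamma_{k_n^*},1/n\}$, and assume $$0<\kappa:=\inf_{n\ge1}\Bigl\{(\alpha_n^*)^{-1}\min\{\upsilon_{k_n^*}/\gamma_{k_n^*},1/n\}\Bigr\}\le1 .$$ Let $h=([h]_j)_{j\ge1}$ be a representer in $\mathcal F_{1/\gamma}$, i.e. $\|h\|_{1/\gamma}^2=\sum_j[h]_j^2/\gamma_j<\infty$ ($h$ need not belong to $\mathbb H$), put $\ell_h(\beta)=\sum_j[h]_j[\beta]_j$, and $$\delta_n^*=\max\Bigl\{\alpha_n^*\sum_{j\le k_n^*}\frac{[h]_j^2}{\upsilon_j},\ \sum_{j>k_n^*}\frac{[h]_j^2}{\gamma_j}\Bigr\}.$$ For $\rho>0$ let $\mathcal F_\gamma^\rho=\{f\in\mathbb H:\|f\|_\gamma^2\le\rho\}$. **Classes.** For $d\ge1$, $\mathcal N_\upsilon^d$ is the set of strictly positive nuclear operators $T$ on $\mathbb H$ with $\|f\|_{\upsilon^2}^2/d^2\le\|Tf\|^2\le d^2\|f\|_{\upsilon^2}^2$ for all $f\in\mathbb H$, where $\upsilon^2=(\upsilon_j^2)_j$.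 For $\eta\ge1$ and $r\in\mathbb N$, $\mathcal X_\eta^r$ is the set of centred $X$ with $\mathbb E\|X\|^2<\infty$ such that $\mathbb E\bigl|[X]_j/[T]_{j,j}^{1/2}\bigr|^r\le\eta$ for all $j$ and $\mathbb E\bigl|z^t[T]_m^{-1/2}[X]_m\bigr|^r\le\eta$ for all $m\ge1$ and all unit vectors $z\in\mathbb R^m$; $\mathcal E_\eta^r$ is the set of centred $\epsilon$ with variance one and $\mathbb E|\epsilon|^r\le\eta$. **Estimator.** Let $\widehat g=\frac1n\sum_iY_iX_i$ and $\widehat T=\frac1n\sum_i\langle\cdot,X_i\rangle X_i$. With dimension $m=k_n^*$ and threshold $\alpha=\max\bigl(8d^3/(\kappa\gamma_{k_n^*}),1\bigr)$, let $\widehat\ell_h=[h]_m^t[\widehat T]_m^{-1}[\widehat g]_m$ if $[\widehat T]_m$ is non-singular and $\|[\widehat T]_m^{-1}\|\le\alpha n$ (spectral norm), and $\widehat\ell_h=0$ otherwise. **Theorem (upper bound).** For every integer $k\ge3$ there is a constant $C>0$, depending only on $k$, with the following property. In the above setting assume that $T\in\mathcal N_\upsilon^d$, $X\in\mathcal X_\eta^{4k}$,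 $\epsilon\in\mathcal E_\eta^{4k}$, and that for some $D\ge1$ $$\sup_{m\ge1}\frac{\upsilon_m}{\gamma_m}m^L\le D,\qquad L=\max\Bigl(\frac{2+6/k}{1-2/k},3\Bigr).$$ Then, for every $n\ge1$, $$\sup_{\beta\in\mathcal F_\gamma^\rho}\mathbb E|\widehat\ell_h-\ell_h(\beta)|^2\le C_{\mathrm{const}}\,\delta_n^*,$$ $$C_{\mathrm{const}}=C\,\rho\,\eta\,d^{14}D^{k-1}\kappa^{-k-1}\bigl\{1+\rho\|h\|_{1/\gamma}^2+(\mathbb E\|X\|^2)^2\bigr\}\max\bigl(1,\ \mathbb E\|X\|^2+\sigma^2/\rho\bigr).$$ -/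

import Mathlib

open MeasureTheory ProbabilityTheory
open scoped InnerProductSpace Matrix

noncomputable section

namespace FunctionalLinearModel

/-! ### Weighted norms, ellipsoids and linear functionals

All sequences are indexed by the positive integers `ℕ+`, exactly as in `(γ_j)_{j ≥ 1}`. -/

/-- The squared weighted norm `∑_{j ≥ 1} w_j c_j²` of a coefficient sequence `c`. -/
def weightedNormSq (w c : ℕ+ → ℝ) : ℝ := ∑' j, w j * c j ^ 2

/-- `c` is the coefficient sequence of an element of `ℱ_w`, the completion of the Hilbert space with
respect to the weighted norm. Through coefficients this completion is the space of all real
sequences `c` with `∑_j w_j c_j² < ∞` (they need not be coefficients of elements of `ℍ`). -/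
def MemWeighted (w c : ℕ+ → ℝ) : Prop := Summable fun j => w j * c j ^ 2

section Hilbert

variable {H : Type*} [NormedAddCommGroup H] [InnerProductSpace ℝ H]

/-- The coefficients `[f]_j = ⟨f, ψ_j⟩`. -/
def coef (ψ : HilbertBasis ℕ+ ℝ H) (f : H) (j : ℕ+) : ℝ := ⟪ψ j, f⟫_ℝ

/-- The ellipsoid `ℱ_γ^ρ = {f : ‖f‖_γ² ≤ ρ}`. For weights `γ ≥ 1` the space `ℱ_γ` is a subspace
of `ℍ`. -/
def ellipsoid (ψ : HilbertBasis ℕ+ ℝ H) (γ : ℕ+ → ℝ) (ρ : ℝ) : Set H :=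
  {f | MemWeighted γ (coef ψ f) ∧ weightedNormSq γ (coef ψ f) ≤ ρ}

/-- The value `ℓ_h(β) = ∑_j [h]_j [β]_j` of the linear functional whose representer has the
coefficient sequence `h`. -/
def linFunctional (ψ : HilbertBasis ℕ+ ℝ H) (h : ℕ+ → ℝ) (β : H) : ℝ := ∑' j, h j * coef ψ β j

/-- `[f]_m = ([f]_j)_{1 ≤ j ≤ m}`. -/
def coefVec (ψ : HilbertBasis ℕ+ ℝ H) (m : ℕ+) (f : H) : Finset.Iic m → ℝ := fun j => coef ψ f j

/-- `[K]_m`, the matrix with entries `⟨K ψ_l, ψ_j⟩`, `1 ≤ j, l ≤ m`. -/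
def opMatrix (ψ : HilbertBasis ℕ+ ℝ H) (m : ℕ+) (K : H →L[ℝ] H) :
    Matrix (Finset.Iic m) (Finset.Iic m) ℝ := Matrix.of fun j l => ⟪ψ j, K (ψ l)⟫_ℝ

/-- The spectral norm of a matrix: its operator norm for the Euclidean norm. -/
def specNorm {m : ℕ+} (A : Matrix (Finset.Iic m) (Finset.Iic m) ℝ) : ℝ :=
  ‖Matrix.toEuclideanCLM (n := Finset.Iic m) (𝕜 := ℝ) A‖

/-- The inverse square root of a symmetric positive definite matrix (functional calculus). -/
def invSqrt {m : ℕ+} (A : Matrix (Finset.Iic m) (Finset.Iic m) ℝ) :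
    Matrix (Finset.Iic m) (Finset.Iic m) ℝ := cfc (fun x : ℝ => (√x)⁻¹) A

/-! ### Conditions on the weights and on the covariance operator -/

/-- Nuclear operators: `T f = ∑_i ⟨f, a_i⟩ b_i` with `∑_i ‖a_i‖ ‖b_i‖ < ∞`. -/
def IsNuclear (T : H →L[ℝ] H) : Prop :=
  ∃ a b : ℕ → H, (Summable fun i => ‖a i‖ * ‖b i‖) ∧
    ∀ f, HasSum (fun i => ⟪a i, f⟫_ℝ • b i) (T f)

/-- The class `𝒩_υ^d`: strictly positive nuclear operators satisfying the link condition
`‖f‖²_{υ²} / d² ≤ ‖T f‖² ≤ d² ‖f‖²_{υ²}` for all `f`. -/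
structure LinkClass (ψ : HilbertBasis ℕ+ ℝ H) (υ : ℕ+ → ℝ) (d : ℝ) (T : H →L[ℝ] H) : Prop where
  symm : ∀ f g, ⟪T f, g⟫_ℝ = ⟪f, T g⟫_ℝ
  pos : ∀ f, f ≠ 0 → 0 < ⟪T f, f⟫_ℝ
  nuclear : IsNuclear T
  lower : ∀ f, weightedNormSq (fun j => υ j ^ 2) (coef ψ f) / d ^ 2 ≤ ‖T f‖ ^ 2
  upper : ∀ f, ‖T f‖ ^ 2 ≤ d ^ 2 * weightedNormSq (fun j => υ j ^ 2) (coef ψ f)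

end Hilbert

/-- The minimal regularity conditions on the weights `γ` and `υ`. -/
structure WeightCondition (γ υ : ℕ+ → ℝ) : Prop where
  γ_pos : ∀ j, 0 < γ j
  υ_pos : ∀ j, 0 < υ j
  γ_one : γ 1 = 1
  υ_one : υ 1 = 1
  γ_mono : Monotone γ
  υ_anti : Antitone υ
  υ_summable : Summable υ

/-- `min{υ_m/γ_m, 1/n} / max{υ_m/γ_m, 1/n}`. -/
def balance (γ υ : ℕ+ → ℝ) (n m : ℕ+) : ℝ :=
  min (υ m / γ m) (n : ℝ)⁻¹ / max (υ m / γ m) (n : ℝ)⁻¹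

/-- `kstar n` is, for every `n`, a maximiser of `balance γ υ n` over `ℕ+`. (Maximisers need not be
unique, so `kstar` is any selection of them.) -/
def IsDimensionChoice (γ υ : ℕ+ → ℝ) (kstar : ℕ+ → ℕ+) : Prop :=
  ∀ n m, balance γ υ n m ≤ balance γ υ n (kstar n)

/-- `α*_n = max{υ_{k*}/γ_{k*}, 1/n}`. -/
def aStar (γ υ : ℕ+ → ℝ) (kstar : ℕ+ → ℕ+) (n : ℕ+) : ℝ :=
  max (υ (kstar n) / γ (kstar n)) (n : ℝ)⁻¹

/-- `δ*_n = max{α*_n ∑_{j ≤ k*} [h]_j²/υ_j, ∑_{j > k*} [h]_j²/γ_j}`. -/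
def deltaStar (γ υ h : ℕ+ → ℝ) (kstar : ℕ+ → ℕ+) (n : ℕ+) : ℝ :=
  max (aStar γ υ kstar n * ∑ j ∈ Finset.Iic (kstar n), h j ^ 2 / υ j)
    (∑' j : Set.Ioi (kstar n), h j ^ 2 / γ j)

/-- `κ = inf_{n ≥ 1} (α*_n)⁻¹ min{υ_{k*}/γ_{k*}, 1/n}`. -/
def kappa (γ υ : ℕ+ → ℝ) (kstar : ℕ+ → ℕ+) : ℝ :=
  ⨅ n : ℕ+, (aStar γ υ kstar n)⁻¹ * min (υ (kstar n) / γ (kstar n)) (n : ℝ)⁻¹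

/-! ### Moment classes, samples and the estimator -/

section Probability

variable {Ω : Type*} [MeasurableSpace Ω]

/-- `𝔼|Z|^r ≤ η`, with the moment finite. -/
def MomentLE (μ : Measure Ω) (Z : Ω → ℝ) (r : ℕ) (η : ℝ) : Prop :=
  Integrable (fun ω => |Z ω| ^ r) μ ∧ ∫ ω, |Z ω| ^ r ∂μ ≤ η

/-- The class `ℰ_η^r`: centred error terms with variance one and `r`-th absolute moment at most
`η`. -/
structure ErrorClass (μ : Measure Ω) (r : ℕ) (η : ℝ) (ε : Ω → ℝ) : Prop where
  memLp : MemLp ε 2 μ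
  centred : ∫ ω, ε ω ∂μ = 0
  variance_one : ∫ ω, ε ω ^ 2 ∂μ = 1
  moment : MomentLE μ ε r η

variable {H : Type*} [NormedAddCommGroup H] [InnerProductSpace ℝ H]

section Cov

variable [CompleteSpace H] [MeasurableSpace H] [BorelSpace H]

/-- The covariance operator `T_cov f = 𝔼[⟨f, X⟩ X]` of a (centred) random function `X`. -/
def covOp (μ : Measure Ω) (X : Ω → H) : H →L[ℝ] H := covarianceOperator (μ.map X)

/-- The class `𝒳_η^r`: centred random functions with finite second moment for which the `r`-th
absolute moments of `[X]_j / [T_cov]_{j,j}^{1/2}` and of `∑_{j ≤ m} z_j ([T_cov]_m^{-1/2} [X]_m)_j`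
are at most `η`, for all `j`, `m` and all unit vectors `z` of `ℝ^m`. -/
structure RegressorClass (ψ : HilbertBasis ℕ+ ℝ H) (μ : Measure Ω) (r : ℕ) (η : ℝ)
    (X : Ω → H) : Prop where
  memLp : MemLp X 2 μ
  centred : ∫ ω, X ω ∂μ = 0
  moment_coef : ∀ j : ℕ+,
    MomentLE μ (fun ω => coef ψ (X ω) j / √⟪ψ j, covOp μ X (ψ j)⟫_ℝ) r η
  moment_std : ∀ (m : ℕ+) (z : Finset.Iic m → ℝ), z ⬝ᵥ z = 1 →
    MomentLE μ (fun ω => z ⬝ᵥ (invSqrt (opMatrix ψ m (covOp μ X)) *ᵥ coefVec ψ m (X ω))) r η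

/-- `(X_i, ε_i)`, `i = 1, …, n`, are independent copies of `(X, ε)`. -/
structure IsSample (μ : Measure Ω) (X : Ω → H) (ε : Ω → ℝ) {n : ℕ}
    (Xs : Fin n → Ω → H) (εs : Fin n → Ω → ℝ) : Prop where
  indep : iIndepFun (fun i ω => (Xs i ω, εs i ω)) μ
  ident : ∀ i, IdentDistrib (fun ω => (Xs i ω, εs i ω)) (fun ω => (X ω, ε ω)) μ μ

end Cov

/-- `ĝ = n⁻¹ ∑_i Y_i X_i`. -/
def gHat {n : ℕ} (Y : Fin n → ℝ) (X : Fin n → H) : H := (n : ℝ)⁻¹ • ∑ i, Y i • X i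

/-- The empirical covariance operator `n⁻¹ ∑_i ⟨·, X_i⟩ X_i`. -/
def covHat {n : ℕ} (X : Fin n → H) : H →L[ℝ] H :=
  (n : ℝ)⁻¹ • ∑ i, InnerProductSpace.rankOne ℝ (X i) (X i)

open Classical in
/-- The thresholded Galerkin plug-in estimator with dimension `m` and threshold `α`, computed from
the data `(Y_i, X_i)`, `i = 1, …, n`. -/
def estimator (ψ : HilbertBasis ℕ+ ℝ H) (h : ℕ+ → ℝ) (m : ℕ+) (α : ℝ) {n : ℕ}
    (Y : Fin n → ℝ) (X : Fin n → H) : ℝ :=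
  if IsUnit (opMatrix ψ m (covHat X)) ∧ specNorm (opMatrix ψ m (covHat X))⁻¹ ≤ α * n then
    (fun j : Finset.Iic m => h j) ⬝ᵥ ((opMatrix ψ m (covHat X))⁻¹ *ᵥ coefVec ψ m (gHat Y X))
  else 0

end Probability

/-- The exponent `L = max((2 + 6/k)/(1 - 2/k), 3)`. -/
def expL (k : ℕ) : ℝ := max ((2 + 6 / (k : ℝ)) / (1 - 2 / (k : ℝ))) 3

/-- The threshold `α = max(8 d³/(κ γ_{k*}), 1)`. -/
def threshold (γ υ : ℕ+ → ℝ) (kstar : ℕ+ → ℕ+) (d : ℝ) (n : ℕ+) : ℝ :=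
  max (8 * d ^ 3 / (kappa γ υ kstar * γ (kstar n))) 1

end FunctionalLinearModel

end

open FunctionalLinearModel

/-!
The error of the estimator is compared with the Galerkin approximation `β_m` of the slope, the
element of the span of the first `m = k*_n` basis elements with coefficients `[T]_m⁻¹ [T β]_m`.
Let `R = [T]_m^{-1/2}`, let `Ξ = R [T̂]_m R - 1` be the deviation of the whitened empirical
covariance (`covDev`), let `u_i = ⟨β - β_m, X_i⟩ + σ ε_i` be the residuals of the approximation,
and let `W = R n⁻¹ ∑ u_i [X_i]_m` be their whitened cross moment with the regressors (`crossDev`).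
The residuals are uncorrelated with `[X]_m`, by Galerkin orthogonality, so that both `Ξ` and `W`
are averages of independent centred variables.

* Deterministic part. The link condition compares `T²` with a squared diagonal operator. By the
  Löwner–Heinz inequality (`inner_le_inner_of_norm_le`) the comparison passes to `T` itself. It
  gives the bias bound `bias_sq_le`, and the bound `whitened_representer_sq_le` of
  `c = ‖R [h]_m‖²` by `d ∑_{j ≤ m} [h]_j² / υ_j`.

* Pathwise bound (`sq_estimator_sub_le`). If `‖Ξ‖² ≤ 1/4` in Frobenius norm, the threshold is
  inactive, and up to the bias the error is `⟨R [h]_m, (1 + Ξ)⁻¹ W⟩`, whose square is bounded by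
  multiples of `⟨R [h]_m, W⟩²` and `c ‖Ξ‖² ‖W‖²`. If `‖Ξ‖² > 1/4`, the threshold and the normal
  equations bound the squared error by a multiple of `c d α n V + ℓ_h(β)²`, with `V = n⁻¹ ∑ u_i²`.

* Moments. The moment assumptions on the projections of `X` extend to all linear functionals by
  Fatou's lemma (`RegressorClass.moment_inner`). Even moments of averages of independent centred
  variables have the order `n^{-p}` (`integral_average_pow_le`). Therefore `⟨R [h]_m, W⟩²`
  contributes the main term of order `c / n`, and `c ‖Ξ‖² ‖W‖²` contributes `c m³ / n²`. On the
  exceptional event `V` is truncated at the level `√n`; below that level the expected contribution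
  is controlled by `𝔼 ‖Ξ‖^{2k} ≲ m^{2k} / n^k`, and above it by the moment of order `2 k` of `V`.

* Rates. At the balancing dimension `υ_m / γ_m ≥ κ / n` (`kappa_div_le`), so that the growth
  condition gives `m^L ≤ (D / κ) n`. The exponent `L` is large enough for `m³ / n` and
  `m^{2k} n^{5/2} / n^k` to be bounded by powers of `D / κ` (`dimension_pow_le`,
  `dimension_pow_mul_sqrt_le`), and every term is then a multiple of `δ*_n` (`risk_terms_le`). All
  estimates are uniform over the ellipsoid.
-/

namespace FunctionalLinearModel

/-! ### Moments of averages of independent variables -/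

/-- Binomial expansion of an even power to first order in `v`. All further terms are absorbed into
the two extreme ones. -/
theorem even_pow_add_le (p : ℕ) (s v : ℝ) :
    (s + v) ^ (2 * p + 2) ≤ s ^ (2 * p + 2) + (2 * p + 2) * s ^ (2 * p + 1) * v
      + 4 ^ (p + 1) * (s ^ (2 * p) * v ^ 2 + v ^ (2 * p + 2)) := by
  have key : ∀ i ∈ Finset.range (2 * p + 1),
      v ^ (i + 2) * s ^ (2 * p - i) * ((2 * p + 2).choose (i + 2) : ℝ)
        ≤ ((2 * p + 2).choose (i + 2) : ℝ) * (s ^ (2 * p) * v ^ 2 + v ^ (2 * p + 2)) := by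
    intro i hi
    have hi' : i ≤ 2 * p := by simpa [Nat.lt_succ_iff] using hi
    have h1 : v ^ i * s ^ (2 * p - i) ≤ s ^ (2 * p) + v ^ (2 * p) := by
      have hs : s ^ (2 * p) = |s| ^ (2 * p) := by rw [(even_two_mul p).pow_abs]
      have hv : v ^ (2 * p) = |v| ^ (2 * p) := by rw [(even_two_mul p).pow_abs]
      have h2 : v ^ i * s ^ (2 * p - i) ≤ |v| ^ i * |s| ^ (2 * p - i) := by
        rw [← abs_pow, ← abs_pow, ← abs_mul]; exact le_abs_self _
      refine h2.trans ?_
      rw [hs, hv]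
      rcases le_total |s| |v| with h | h
      · calc |v| ^ i * |s| ^ (2 * p - i) ≤ |v| ^ i * |v| ^ (2 * p - i) := by gcongr
          _ = |v| ^ (2 * p) := by rw [← pow_add]; congr 1; omega
          _ ≤ _ := le_add_of_nonneg_left (by positivity)
      · calc |v| ^ i * |s| ^ (2 * p - i) ≤ |s| ^ i * |s| ^ (2 * p - i) := by gcongr
          _ = |s| ^ (2 * p) := by rw [← pow_add]; congr 1; omega
          _ ≤ _ := le_add_of_nonneg_right (by positivity)
    have h3 : 0 ≤ ((2 * p + 2).choose (i + 2) : ℝ) * v ^ 2 := by positivity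
    calc _ = ((2 * p + 2).choose (i + 2) : ℝ) * v ^ 2 * (v ^ i * s ^ (2 * p - i)) := by ring
      _ ≤ ((2 * p + 2).choose (i + 2) : ℝ) * v ^ 2 * (s ^ (2 * p) + v ^ (2 * p)) := by gcongr
      _ = _ := by ring
  have hsum : ∑ i ∈ Finset.range (2 * p + 1), ((2 * p + 2).choose (i + 2) : ℝ) ≤ 4 ^ (p + 1) := by
    have h := Nat.sum_range_choose (2 * p + 2)
    rw [Finset.sum_range_succ', Finset.sum_range_succ'] at h
    have h4 : (4 : ℝ) ^ (p + 1) = ((2 ^ (2 * p + 2) : ℕ) : ℝ) := by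
      push_cast
      rw [show (4 : ℝ) = 2 ^ 2 by norm_num, ← pow_mul]; congr 1
    rw [h4, ← h]
    push_cast
    have : (0 : ℝ) ≤ ((2 * p + 2).choose (0 + 1) : ℝ) + ((2 * p + 2).choose 0 : ℝ) := by positivity
    linarith
  have hnn : 0 ≤ s ^ (2 * p) * v ^ 2 + v ^ (2 * p + 2) := by
    have h1 : 0 ≤ s ^ (2 * p) := (even_two_mul p).pow_nonneg s
    have h2 : 0 ≤ v ^ (2 * p + 2) := by
      rw [show 2 * p + 2 = 2 * (p + 1) by ring]; exact (even_two_mul _).pow_nonneg v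
    positivity
  rw [add_comm s v, add_pow, Finset.sum_range_succ', Finset.sum_range_succ']
  have e : ∀ i, 2 * p + 2 - (i + 1 + 1) = 2 * p - i := fun i => by omega
  have := Finset.sum_le_sum key
  rw [← Finset.sum_mul] at this
  have h5 := this.trans (mul_le_mul_of_nonneg_right hsum hnn)
  simp only [e, show ∀ i : ℕ, i + 1 + 1 = i + 2 from fun i => rfl, zero_add, pow_one, pow_zero,
    Nat.choose_one_right, Nat.choose_zero_right, show 2 * p + 2 - 1 = 2 * p + 1 from rfl,
    Nat.sub_zero]
  push_cast
  linarith

/-- A Young inequality with a free parameter, avoiding fractional exponents. -/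
theorem pow_mul_le_div_add {a b N : ℝ} (ha : 0 ≤ a) (hb : 0 ≤ b) (hN : 0 < N) (p : ℕ) :
    a ^ p * b ≤ a ^ (p + 1) / N + N ^ p * b ^ (p + 1) := by
  rcases le_total (N * b) a with h | h
  · have : a ^ p * b ≤ a ^ (p + 1) / N := by
      rw [le_div_iff₀ hN, pow_succ]
      calc a ^ p * b * N = a ^ p * (N * b) := by ring
        _ ≤ _ := by gcongr
    have h2 : 0 ≤ N ^ p * b ^ (p + 1) := by positivity
    linarith
  · have : a ^ p * b ≤ N ^ p * b ^ (p + 1) := by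
      calc a ^ p * b ≤ (N * b) ^ p * b := by gcongr
        _ = _ := by rw [mul_pow]; ring
    have h2 : 0 ≤ a ^ (p + 1) / N := by positivity
    linarith

/-- First order expansion of an even power with leading factor `1 + O(1 / N)`. In the application
`N` is the number of summands, and `n` such factors multiply to a constant. -/
theorem even_pow_add_le_of_pos (p : ℕ) (s v : ℝ) {N : ℝ} (hN : 0 < N) :
    (s + v) ^ (2 * p + 2) ≤ (1 + 4 ^ (p + 1) / N) * s ^ (2 * p + 2)
      + (2 * p + 2) * (s ^ (2 * p + 1) * v) + 4 ^ (p + 1) * (N ^ p + 1) * v ^ (2 * p + 2) := by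
  have h1 := even_pow_add_le p s v
  have h2 := pow_mul_le_div_add (sq_nonneg s) (sq_nonneg v) hN p
  rw [← pow_mul, ← pow_mul, ← pow_mul] at h2
  have h3 : (0 : ℝ) < 4 ^ (p + 1) := by positivity
  have h4 := mul_le_mul_of_nonneg_left h2 h3.le
  rw [show 2 * (p + 1) = 2 * p + 2 by ring] at h4
  have : (1 + 4 ^ (p + 1) / N) * s ^ (2 * p + 2) =
    s ^ (2 * p + 2) + 4 ^ (p + 1) * (s ^ (2 * p + 2) / N) := by field_simp
  rw [this]
  linarith

section Moments

variable {Ω : Type*} [MeasurableSpace Ω] {μ : Measure Ω}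

theorem integrable_pow_of_memLp [IsFiniteMeasure μ] {f : Ω → ℝ} {p q : ℕ}
    (hf : MemLp f (q : ENNReal) μ) (hpq : p ≤ q) : Integrable (fun ω => f ω ^ p) μ := by
  have h : MemLp f (p : ENNReal) μ := hf.mono_exponent (by exact_mod_cast hpq)
  have h2 := h.integrable_norm_pow'
  refine h2.mono' (hf.aestronglyMeasurable.pow p) (.of_forall fun ω => ?_)
  simp

/-- The constant of the moment inequality for sums of independent centred variables. -/
noncomputable def momentConst (p : ℕ) : ℝ := 2 * 4 ^ (p + 1) * Real.exp (4 ^ (p + 1))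

theorem momentConst_pos (p : ℕ) : 0 < momentConst p := by unfold momentConst; positivity

/-- Even moments of a partial sum of independent centred variables, by induction on the summands;
`N` is a free parameter. -/
theorem integral_sum_pow_le [IsProbabilityMeasure μ] {ι : Type*} [DecidableEq ι]
    {V : ι → Ω → ℝ} (hV : iIndepFun V μ) (p : ℕ) {B : ℝ}
    (hL : ∀ i, MemLp (V i) ((2 * p + 2 : ℕ) : ENNReal) μ) (h0 : ∀ i, ∫ ω, V i ω ∂μ = 0)
    (hB : ∀ i, ∫ ω, V i ω ^ (2 * p + 2) ∂μ ≤ B) {N : ℝ} (hN : 0 < N) (hB0 : 0 ≤ B)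
    (s : Finset ι) :
    ∫ ω, (∑ i ∈ s, V i ω) ^ (2 * p + 2) ∂μ
      ≤ (1 + 4 ^ (p + 1) / N) ^ s.card * s.card * (4 ^ (p + 1) * (N ^ p + 1) * B) := by
  induction s using Finset.induction_on with
  | empty => simp
  | insert a s ha ih =>
    have hS : MemLp (fun ω => ∑ i ∈ s, V i ω) ((2 * p + 2 : ℕ) : ENNReal) μ :=
      memLp_finsetSum s fun i _ => hL i
    have hind : IndepFun (fun ω => ∑ i ∈ s, V i ω) (V a) μ := by
      have := hV.indepFun_finsetSum_of_notMem₀ (fun i => (hL i).aestronglyMeasurable.aemeasurable)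
        ha
      convert this using 1
      ext ω; simp
    have hind2 : IndepFun (fun ω => (∑ i ∈ s, V i ω) ^ (2 * p + 1)) (V a) μ :=
      hind.comp (φ := fun x => x ^ (2 * p + 1)) (ψ := id) (by fun_prop) measurable_id
    have hi1 := integrable_pow_of_memLp hS (le_refl _)
    have hi2 := integrable_pow_of_memLp hS (Nat.le_succ (2 * p + 1))
    have hi3 := integrable_pow_of_memLp (hL a) (le_refl _)
    have hia : Integrable (V a) μ := (hL a).integrable (by norm_cast; omega)
    have hi4 : Integrable (fun ω => (∑ i ∈ s, V i ω) ^ (2 * p + 1) * V a ω) μ :=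
      hind2.integrable_mul hi2 hia
    -- The first order term vanishes because `V a` is centred and independent of the partial sum.
    have hz : ∫ ω, (∑ i ∈ s, V i ω) ^ (2 * p + 1) * V a ω ∂μ = 0 := by
      rw [hind2.integral_fun_mul_eq_mul_integral hi2.aestronglyMeasurable
        hia.aestronglyMeasurable, h0, mul_zero]
    have hstep : ∫ ω, (∑ i ∈ insert a s, V i ω) ^ (2 * p + 2) ∂μ
        ≤ (1 + 4 ^ (p + 1) / N) * ∫ ω, (∑ i ∈ s, V i ω) ^ (2 * p + 2) ∂μ
          + 4 ^ (p + 1) * (N ^ p + 1) * ∫ ω, V a ω ^ (2 * p + 2) ∂μ := by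
      have hle : ∫ ω, (∑ i ∈ insert a s, V i ω) ^ (2 * p + 2) ∂μ ≤
          ∫ ω, ((1 + 4 ^ (p + 1) / N) * (∑ i ∈ s, V i ω) ^ (2 * p + 2)
      + (2 * p + 2) * ((∑ i ∈ s, V i ω) ^ (2 * p + 1) * V a ω)
        + 4 ^ (p + 1) * (N ^ p + 1) * V a ω ^ (2 * p + 2)) ∂μ := by
        refine integral_mono (integrable_pow_of_memLp
          (memLp_finsetSum (insert a s) fun i _ => hL i) le_rfl)
          (((hi1.const_mul _).add (hi4.const_mul _)).add (hi3.const_mul _)) fun ω => ?_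
        simp only [Finset.sum_insert ha]
        rw [add_comm (V a ω)]
        exact even_pow_add_le_of_pos p _ _ hN
      have hi5 : Integrable (fun ω => (1 + 4 ^ (p + 1) / N) * (∑ i ∈ s, V i ω) ^ (2 * p + 2)
          + (2 * p + 2) * ((∑ i ∈ s, V i ω) ^ (2 * p + 1) * V a ω)) μ :=
        (hi1.const_mul _).add (hi4.const_mul _)
      rw [integral_add hi5 (hi3.const_mul _), integral_add (hi1.const_mul _) (hi4.const_mul _),
        integral_const_mul, integral_const_mul, integral_const_mul, hz] at hle
      linarith
    set c : ℝ := 1 + 4 ^ (p + 1) / N with hc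
    set K : ℝ := 4 ^ (p + 1) * (N ^ p + 1) with hK
    have hc1 : 1 ≤ c := by rw [hc]; have : 0 < 4 ^ (p + 1) / N := by positivity
                           linarith
    have hK0 : 0 ≤ K := by positivity
    rw [Finset.card_insert_of_notMem ha]
    push_cast
    calc _ ≤ _ := hstep
      _ ≤ c * (c ^ s.card * s.card * (K * B)) + K * B := by gcongr; exact hB a
      _ ≤ c * (c ^ s.card * s.card * (K * B)) + c ^ (s.card + 1) * (K * B) := by
        have : K * B ≤ c ^ (s.card + 1) * (K * B) :=
          le_mul_of_one_le_left (by positivity) (one_le_pow₀ hc1)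
        linarith
      _ = _ := by ring

/-- Even moments of an average of independent centred variables are of the order
`n ^ (-p)`, with a bound linear in the moment of the summands. The proof is a discrete Gronwall
argument: adding one summand multiplies the moment by at most `1 + O(1/n)`, since the first order
term of the binomial expansion vanishes by independence. -/
theorem integral_average_pow_le [IsProbabilityMeasure μ] {n : ℕ} (hn : 0 < n)
    {V : Fin n → Ω → ℝ} (hV : iIndepFun V μ) (p : ℕ) {B : ℝ}
    (hL : ∀ i, MemLp (V i) ((2 * p + 2 : ℕ) : ENNReal) μ) (h0 : ∀ i, ∫ ω, V i ω ∂μ = 0)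
    (hB : ∀ i, ∫ ω, V i ω ^ (2 * p + 2) ∂μ ≤ B) :
    ∫ ω, ((n : ℝ)⁻¹ * ∑ i, V i ω) ^ (2 * p + 2) ∂μ ≤ momentConst p * B / n ^ (p + 1) := by
  have hn' : (0 : ℝ) < n := by exact_mod_cast hn
  have hn1 : (1 : ℝ) ≤ n := by exact_mod_cast hn
  have hB0 : 0 ≤ B := by
    refine le_trans (integral_nonneg fun ω => ?_) (hB ⟨0, hn⟩)
    rw [show 2 * p + 2 = 2 * (p + 1) by ring]; exact (even_two_mul _).pow_nonneg _
  have h := integral_sum_pow_le hV p hL h0 hB hn' hB0 Finset.univ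
  simp only [Finset.card_univ, Fintype.card_fin] at h
  have hexp : (1 + 4 ^ (p + 1) / (n : ℝ)) ^ n ≤ Real.exp (4 ^ (p + 1)) := by
    calc (1 + 4 ^ (p + 1) / (n : ℝ)) ^ n ≤ Real.exp (4 ^ (p + 1) / (n : ℝ)) ^ n := by
          gcongr; rw [add_comm]; exact Real.add_one_le_exp _
      _ = _ := by rw [← Real.exp_nat_mul]; congr 1; field_simp
  simp only [mul_pow, integral_const_mul]
  calc _ ≤ ((n : ℝ)⁻¹) ^ (2 * p + 2) * ((1 + 4 ^ (p + 1) / (n : ℝ)) ^ n * n *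
            (4 ^ (p + 1) * ((n : ℝ) ^ p + 1) * B)) := by gcongr
    _ ≤ ((n : ℝ)⁻¹) ^ (2 * p + 2) * (Real.exp (4 ^ (p + 1)) * n *
            (4 ^ (p + 1) * ((n : ℝ) ^ p + (n : ℝ) ^ p) * B)) := by
          gcongr; exact one_le_pow₀ hn1
    _ = _ := by
      unfold momentConst
      rw [inv_pow]
      field_simp
      ring

end Moments

/-! ### The Löwner–Heinz inequality and the link condition -/

section Operators

variable {H : Type*} [NormedAddCommGroup H] [InnerProductSpace ℝ H]

/-- The Cauchy–Schwarz inequality for the quadratic form of a nonnegative operator. -/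
theorem inner_sq_le_of_nonneg {A : H →L[ℝ] H} (hs : ∀ f g, ⟪A f, g⟫_ℝ = ⟪f, A g⟫_ℝ)
    (hp : ∀ f, 0 ≤ ⟪A f, f⟫_ℝ) (f g : H) :
    ⟪A f, g⟫_ℝ ^ 2 ≤ ⟪A f, f⟫_ℝ * ⟪A g, g⟫_ℝ := by
  have h : ∀ t : ℝ, 0 ≤ ⟪A g, g⟫_ℝ * (t * t) + (2 * ⟪A f, g⟫_ℝ) * t + ⟪A f, f⟫_ℝ := by
    intro t
    have h1 := hp (f + t • g)
    have h2 : ⟪A g, f⟫_ℝ = ⟪A f, g⟫_ℝ := by rw [hs, real_inner_comm]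
    simp only [map_add, map_smul, inner_add_left, inner_add_right, real_inner_smul_left,
      real_inner_smul_right, h2] at h1
    linarith
  have := discrim_le_zero h
  unfold discrim at this
  linarith

/-- The Löwner–Heinz inequality for the square root, `T² ≤ S²` implies `T ≤ S`, for operators on a
real Hilbert space. If the supremum `c` of the quadratic form of `T - S` on the unit sphere were
positive, then on approximate eigenvectors `T f ≈ S f + c f`, hence
`‖T f‖² ≳ ‖S f‖² + c²`. -/
theorem inner_le_inner_of_norm_le {T S : H →L[ℝ] H} (hT : ∀ f g, ⟪T f, g⟫_ℝ = ⟪f, T g⟫_ℝ)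
    (hS : ∀ f g, ⟪S f, g⟫_ℝ = ⟪f, S g⟫_ℝ) (hSp : ∀ f, 0 ≤ ⟪S f, f⟫_ℝ)
    (hTS : ∀ f, ‖T f‖ ≤ ‖S f‖) (f : H) : ⟪T f, f⟫_ℝ ≤ ⟪S f, f⟫_ℝ := by
  by_contra! hf
  set B : H →L[ℝ] H := T - S with hB
  set E : Set ℝ := (fun g : H => ⟪B g, g⟫_ℝ) '' {g | ‖g‖ = 1} with hE
  have hbdd : BddAbove E := by
    refine ⟨‖B‖, ?_⟩
    rintro _ ⟨g, hg, rfl⟩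
    have hg' : ‖g‖ = 1 := hg
    calc ⟪B g, g⟫_ℝ ≤ ‖B g‖ * ‖g‖ := real_inner_le_norm _ _
      _ ≤ ‖B‖ * ‖g‖ * ‖g‖ := by gcongr; exact B.le_opNorm g
      _ = ‖B‖ := by rw [hg']; ring
  have hBf : 0 < ⟪B f, f⟫_ℝ := by
    simp only [hB, _root_.sub_apply, inner_sub_left]; linarith
  have hf0 : f ≠ 0 := by rintro rfl; simp at hBf
  have hnf : 0 < ‖f‖ := norm_pos_iff.mpr hf0
  have hscale : ∀ g : H, g ≠ 0 → ⟪B g, g⟫_ℝ / ‖g‖ ^ 2 ∈ E := by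
    intro g hg
    refine ⟨‖g‖⁻¹ • g, norm_smul_inv_norm hg, ?_⟩
    have : ‖g‖ ≠ 0 := norm_ne_zero_iff.mpr hg
    simp only [map_smul, real_inner_smul_left, real_inner_smul_right]
    field_simp
  have hne : E.Nonempty := ⟨_, hscale f hf0⟩
  set c := sSup E with hc
  have hc0 : 0 < c := lt_of_lt_of_le (by positivity) (le_csSup hbdd (hscale f hf0))
  -- `A` is nonnegative and its form is small at near maximisers of the form of `B`.
  set A : H →L[ℝ] H := c • ContinuousLinearMap.id ℝ H - B with hA
  have hAapp : ∀ g, A g = c • g - B g := fun g => by simp [hA]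
  have hAs : ∀ f g, ⟪A f, g⟫_ℝ = ⟪f, A g⟫_ℝ := by
    intro f g
    simp only [hAapp, hB, _root_.sub_apply, inner_sub_left, inner_sub_right, hT, hS,
      real_inner_smul_left, real_inner_smul_right]
  have hAp : ∀ g, 0 ≤ ⟪A g, g⟫_ℝ := by
    intro g
    rcases eq_or_ne g 0 with rfl | hg
    · simp
    have h1 := le_csSup hbdd (hscale g hg)
    have h2 : 0 < ‖g‖ ^ 2 := by have := norm_pos_iff.mpr hg; positivity
    rw [div_le_iff₀ h2] at h1
    rw [hAapp, inner_sub_left, real_inner_smul_left, real_inner_self_eq_norm_sq]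
    linarith
  have hAn : ∀ g, ‖A g‖ ^ 2 ≤ ‖A‖ * ⟪A g, g⟫_ℝ := by
    intro g
    have h1 := inner_sq_le_of_nonneg hAs hAp g (A g)
    rw [real_inner_self_eq_norm_sq] at h1
    have h2 : ⟪A (A g), A g⟫_ℝ ≤ ‖A‖ * ‖A g‖ ^ 2 :=
      calc ⟪A (A g), A g⟫_ℝ ≤ ‖A (A g)‖ * ‖A g‖ := real_inner_le_norm _ _
        _ ≤ ‖A‖ * ‖A g‖ * ‖A g‖ := by gcongr; exact A.le_opNorm _
        _ = _ := by ring
    rcases eq_or_ne (‖A g‖) 0 with h0 | h0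
    · rw [h0]; have := mul_nonneg (norm_nonneg A) (hAp g); simpa using this
    have h3 : 0 < ‖A g‖ ^ 2 := by positivity
    have h4 := h1.trans (mul_le_mul_of_nonneg_left h2 (hAp g))
    nlinarith
  -- A unit vector `g` with `‖A g‖ ≤ δ` satisfies `S g + c g = T g + A g`; compare norms.
  have hsmall : ∀ δ : ℝ, 0 < δ → c ^ 2 ≤ 2 * ‖S‖ * δ + δ ^ 2 := by
    intro δ hδ
    have he : 0 < δ ^ 2 / (‖A‖ + 1) := by positivity
    obtain ⟨_, ⟨g, hg, rfl⟩, hlt⟩ := exists_lt_of_lt_csSup hne (sub_lt_self c he)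
    have hg' : ‖g‖ = 1 := hg
    have hAg : ⟪A g, g⟫_ℝ ≤ δ ^ 2 / (‖A‖ + 1) := by
      rw [hAapp, inner_sub_left, real_inner_smul_left, real_inner_self_eq_norm_sq, hg']
      linarith
    have h1 : ‖A g‖ ^ 2 ≤ δ ^ 2 := by
      refine (hAn g).trans ((mul_le_mul_of_nonneg_left hAg (norm_nonneg A)).trans ?_)
      rw [mul_div_assoc', div_le_iff₀ (by positivity)]
      nlinarith [norm_nonneg A, sq_nonneg δ]
    have h2 : ‖A g‖ ≤ δ := abs_le_of_sq_le_sq' h1 hδ.le |>.2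
    have h3 : S g + c • g = T g + A g := by
      rw [hAapp, hB, _root_.sub_apply]; abel
    have h4 : ‖S g + c • g‖ ≤ ‖S g‖ + δ := by
      rw [h3]; exact (norm_add_le _ _).trans (add_le_add (hTS g) h2)
    have h5 : ‖S g‖ ^ 2 + c ^ 2 ≤ ‖S g + c • g‖ ^ 2 := by
      rw [norm_add_sq_real, norm_smul, real_inner_smul_right, hg']
      have := mul_nonneg hc0.le (hSp g)
      rw [Real.norm_eq_abs, abs_of_pos hc0]
      linarith
    have h6 : ‖S g‖ ≤ ‖S‖ := by have := S.le_opNorm g; rwa [hg', mul_one] at this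
    have h7 : ‖S g + c • g‖ ^ 2 ≤ (‖S g‖ + δ) ^ 2 := by gcongr
    nlinarith
  have hlim : Filter.Tendsto (fun δ : ℝ => 2 * ‖S‖ * δ + δ ^ 2) (nhdsWithin 0 (Set.Ioi 0))
      (nhds 0) := by
    have : Continuous (fun δ : ℝ => 2 * ‖S‖ * δ + δ ^ 2) := by fun_prop
    have h := this.tendsto 0
    simp only [mul_zero, ne_eq, OfNat.ofNat_ne_zero, not_false_eq_true, zero_pow, add_zero] at h
    exact h.mono_left nhdsWithin_le_nhds
  have : c ^ 2 ≤ 0 := ge_of_tendsto hlim (by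
    filter_upwards [self_mem_nhdsWithin] with δ hδ using hsmall δ hδ)
  have : 0 < c ^ 2 := by positivity
  linarith

section Diagonal

variable (ψ : HilbertBasis ℕ+ ℝ H) {υ : ℕ+ → ℝ} {d : ℝ} {T : H →L[ℝ] H}

theorem hasSum_coef_mul_coef (f g : H) :
    HasSum (fun j => coef ψ f j * coef ψ g j) ⟪f, g⟫_ℝ := by
  have := ψ.hasSum_inner_mul_inner f g
  convert! this using 2 with j
  simp [coef, real_inner_comm]

theorem coef_basis (i j : ℕ+) : coef ψ (ψ i) j = if i = j then 1 else 0 := by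
  have := orthonormal_iff_ite.mp ψ.orthonormal j i
  simp only [coef, this, eq_comm]

theorem LinkClass.nonneg (h : LinkClass ψ υ d T) (f : H) : 0 ≤ ⟪T f, f⟫_ℝ := by
  rcases eq_or_ne f 0 with rfl | hf
  · simp
  · exact (h.pos f hf).le

variable [CompleteSpace H]

/-- The diagonal operator `f ↦ ∑_j υ_j ⟨ψ_j, f⟩ ψ_j`, for a summable sequence `υ`. -/
noncomputable def diagOp (υ : ℕ+ → ℝ) : H →L[ℝ] H :=
  ∑' j, υ j • InnerProductSpace.rankOne ℝ (ψ j) (ψ j)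

theorem inner_diagOp (hυ : Summable υ) (f g : H) :
    HasSum (fun j => υ j * coef ψ f j * coef ψ g j) ⟪diagOp ψ υ f, g⟫_ℝ := by
  have h1 : Summable fun j => υ j • InnerProductSpace.rankOne ℝ (ψ j) (ψ j) := by
    refine Summable.of_norm ?_
    simp only [norm_smul, InnerProductSpace.norm_rankOne, ψ.orthonormal.1, mul_one]
    exact hυ.norm
  have h2 := h1.hasSum
  have h3 := ((innerSL ℝ g).comp (ContinuousLinearMap.apply ℝ H f)).hasSum h2
  simp only [ContinuousLinearMap.comp_apply, ContinuousLinearMap.apply_apply,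
    innerSL_apply_apply] at h3
  have h4 : ⟪diagOp ψ υ f, g⟫_ℝ = ⟪g, diagOp ψ υ f⟫_ℝ := real_inner_comm _ _
  rw [h4]
  convert! h3 using 2 with j
  simp [coef, real_inner_smul_right, real_inner_comm]
  ring

theorem coef_diagOp (hυ : Summable υ) (f : H) (i : ℕ+) :
    coef ψ (diagOp ψ υ f) i = υ i * coef ψ f i := by
  have h1 := inner_diagOp ψ hυ f (ψ i)
  have h2 : HasSum (fun j => υ j * coef ψ f j * coef ψ (ψ i) j) (υ i * coef ψ f i) := by
    have := hasSum_ite_eq i (υ i * coef ψ f i)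
    convert! this using 2 with j
    rw [coef_basis]
    by_cases h : j = i
    · subst h; simp
    · simp [h, Ne.symm h]
  have h3 := h1.unique h2
  rw [← h3]
  simp [coef, real_inner_comm]

theorem norm_diagOp_sq (hυ : Summable υ) (f : H) :
    ‖diagOp ψ υ f‖ ^ 2 = weightedNormSq (fun j => υ j ^ 2) (coef ψ f) := by
  rw [← real_inner_self_eq_norm_sq, ← (hasSum_coef_mul_coef ψ _ _).tsum_eq]
  unfold weightedNormSq
  congr 1
  ext j
  rw [coef_diagOp ψ hυ]; ring

theorem summable_weighted_of_summable (hυ : Summable υ) (f : H) :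
    Summable fun j => υ j * coef ψ f j ^ 2 := by
  have := (inner_diagOp ψ hυ f f).summable
  convert! this using 2 with j
  ring

theorem inner_diagOp_self (hυ : Summable υ) (f : H) :
    ⟪diagOp ψ υ f, f⟫_ℝ = weightedNormSq υ (coef ψ f) := by
  rw [← (inner_diagOp ψ hυ f f).tsum_eq]
  unfold weightedNormSq
  congr 1
  ext j
  ring

theorem inner_diagOp_symm (hυ : Summable υ) (f g : H) :
    ⟪diagOp ψ υ f, g⟫_ℝ = ⟪f, diagOp ψ υ g⟫_ℝ := by
  rw [real_inner_comm (diagOp ψ υ g) f, ← (inner_diagOp ψ hυ f g).tsum_eq,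
    ← (inner_diagOp ψ hυ g f).tsum_eq]
  congr 1
  ext j
  ring

/-- The link condition, which compares `T²` with the squared diagonal operator, passes to the
quadratic form of `T` by the Löwner–Heinz inequality. -/
theorem LinkClass.inner_le (h : LinkClass ψ υ d T) (hυ : Summable υ) (hυ0 : ∀ j, 0 ≤ υ j)
    (hd : 0 ≤ d) (f : H) : ⟪T f, f⟫_ℝ ≤ d * weightedNormSq υ (coef ψ f) := by
  have hsm : ∀ f g : H, ⟪(d • diagOp ψ υ) f, g⟫_ℝ = d * ⟪diagOp ψ υ f, g⟫_ℝ := fun f g => by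
    simp [real_inner_smul_left]
  have := inner_le_inner_of_norm_le (S := d • diagOp ψ υ) h.symm
    (fun f g => by
      rw [hsm, inner_diagOp_symm ψ hυ]; simp [real_inner_smul_right])
    (fun f => by
      rw [hsm, inner_diagOp_self ψ hυ]
      exact mul_nonneg hd (tsum_nonneg fun j => mul_nonneg (hυ0 j) (sq_nonneg _)))
    (fun f => by
      refine abs_le_of_sq_le_sq' ?_ (norm_nonneg _) |>.2
      refine (h.upper f).trans_eq ?_
      rw [_root_.smul_apply, norm_smul, mul_pow, norm_diagOp_sq ψ hυ, Real.norm_eq_abs,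
        sq_abs]) f
  rwa [hsm, inner_diagOp_self ψ hυ] at this

/-- The lower counterpart of `LinkClass.inner_le`, again by the Löwner–Heinz inequality. -/
theorem LinkClass.le_inner (h : LinkClass ψ υ d T) (hυ : Summable υ)
    (hd : 0 < d) (f : H) : weightedNormSq υ (coef ψ f) ≤ d * ⟪T f, f⟫_ℝ := by
  have hsm : ∀ f g : H, ⟪(d⁻¹ • diagOp ψ υ) f, g⟫_ℝ = d⁻¹ * ⟪diagOp ψ υ f, g⟫_ℝ := fun f g => by
    simp [real_inner_smul_left]
  have := inner_le_inner_of_norm_le (T := d⁻¹ • diagOp ψ υ) (S := T)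
    (fun f g => by
      rw [hsm, inner_diagOp_symm ψ hυ]; simp [real_inner_smul_right])
    h.symm (h.nonneg ψ)
    (fun f => by
      refine abs_le_of_sq_le_sq' ?_ (norm_nonneg _) |>.2
      refine le_of_eq_of_le ?_ (h.lower f)
      rw [_root_.smul_apply, norm_smul, mul_pow, norm_diagOp_sq ψ hυ, Real.norm_eq_abs,
        sq_abs, inv_pow]
      ring) f
  rw [hsm, inner_diagOp_self ψ hυ, inv_mul_le_iff₀ hd] at this
  exact this

theorem LinkClass.inner_le_norm_sq (h : LinkClass ψ υ d T) (hυ : Summable υ) (hυ0 : ∀ j, 0 ≤ υ j)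
    (hυ1 : ∀ j, υ j ≤ 1) (hd : 0 ≤ d) (f : H) : ⟪T f, f⟫_ℝ ≤ d * ‖f‖ ^ 2 := by
  refine (h.inner_le ψ hυ hυ0 hd f).trans ?_
  gcongr
  rw [← real_inner_self_eq_norm_sq, ← (hasSum_coef_mul_coef ψ f f).tsum_eq]
  refine (summable_weighted_of_summable ψ hυ f).tsum_le_tsum (fun j => ?_)
    (hasSum_coef_mul_coef ψ f f).summable
  rw [← sq]
  exact mul_le_of_le_one_left (sq_nonneg _) (hυ1 j)

end Diagonal

end Operators

/-! ### Finite sections and moments of linear functionals of the regressor -/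

section Galerkin

variable {H : Type*} [NormedAddCommGroup H] [InnerProductSpace ℝ H]
  (ψ : HilbertBasis ℕ+ ℝ H) (m : ℕ+)

/-- The element `∑_{j ≤ m} a_j ψ_j` with prescribed first `m` coefficients. -/
noncomputable def synth (a : Finset.Iic m → ℝ) : H := ∑ j, a j • ψ j

theorem inner_synth_left (a : Finset.Iic m → ℝ) (x : H) :
    ⟪synth ψ m a, x⟫_ℝ = a ⬝ᵥ coefVec ψ m x := by
  simp [synth, sum_inner, real_inner_smul_left, dotProduct, coefVec, coef]

theorem inner_map_synth (K : H →L[ℝ] H) (a b : Finset.Iic m → ℝ) :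
    ⟪K (synth ψ m a), synth ψ m b⟫_ℝ = b ⬝ᵥ (opMatrix ψ m K *ᵥ a) := by
  rw [real_inner_comm, inner_synth_left]
  congr 1
  ext j
  simp [coefVec, coef, synth, Matrix.mulVec, opMatrix, dotProduct, inner_sum, real_inner_smul_right,
    mul_comm]

theorem coef_synth (a : Finset.Iic m → ℝ) (j : ℕ+) :
    coef ψ (synth ψ m a) j = if h : j ≤ m then a ⟨j, Finset.mem_Iic.mpr h⟩ else 0 := by
  simp only [coef, synth, inner_sum, real_inner_smul_right]
  have h1 : ∀ i : Finset.Iic m, ⟪ψ j, ψ i⟫_ℝ = if j = (i : ℕ+) then 1 else 0 :=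
    fun i => orthonormal_iff_ite.mp ψ.orthonormal j i
  simp only [h1, mul_ite, mul_one, mul_zero]
  split_ifs with h
  · rw [Finset.sum_eq_single ⟨j, Finset.mem_Iic.mpr h⟩]
    · simp
    · rintro ⟨i, hi⟩ _ hne
      rw [if_neg]
      rintro rfl
      exact hne rfl
    · simp
  · refine Finset.sum_eq_zero fun i _ => if_neg ?_
    rintro rfl
    exact h (Finset.mem_Iic.mp i.2)

theorem coefVec_synth (a : Finset.Iic m → ℝ) : coefVec ψ m (synth ψ m a) = a := by
  ext j
  simp [coefVec, coef_synth, Finset.mem_Iic.mp j.2]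

theorem synth_eq_zero_iff (a : Finset.Iic m → ℝ) : synth ψ m a = 0 ↔ a = 0 := by
  constructor
  · intro h
    rw [← coefVec_synth ψ m a, h]
    ext j; simp [coefVec, coef]
  · rintro rfl; simp [synth]

theorem norm_synth_sq (a : Finset.Iic m → ℝ) : ‖synth ψ m a‖ ^ 2 = a ⬝ᵥ a := by
  rw [← real_inner_self_eq_norm_sq, inner_synth_left, coefVec_synth]

theorem posDef_opMatrix {T : H →L[ℝ] H} (hs : ∀ f g, ⟪T f, g⟫_ℝ = ⟪f, T g⟫_ℝ)
    (hp : ∀ f, f ≠ 0 → 0 < ⟪T f, f⟫_ℝ) : (opMatrix ψ m T).PosDef := by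
  refine Matrix.PosDef.of_dotProduct_mulVec_pos ?_ fun a ha => ?_
  · ext j l
    simp only [opMatrix, Matrix.conjTranspose_apply, Matrix.of_apply, star_trivial]
    rw [← hs, real_inner_comm]
  · rw [star_trivial, ← inner_map_synth]
    exact hp _ ((synth_eq_zero_iff ψ m a).not.mpr ha)

theorem tendsto_synth_coefVec (g : H) :
    Filter.Tendsto (fun m => synth ψ m (coefVec ψ m g)) Filter.atTop (nhds g) := by
  have h1 := ψ.hasSum_repr g
  have h2 : Filter.Tendsto (fun m : ℕ+ => Finset.Iic m) Filter.atTop Filter.atTop :=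
    Filter.tendsto_atTop_finset_of_monotone (fun a b hab => Finset.Iic_subset_Iic.mpr hab)
      fun x => ⟨x, by simp⟩
  have h3 := h1.comp h2
  refine h3.congr fun m => ?_
  simp only [Function.comp_apply, synth, coefVec, coef, ψ.repr_apply_apply]
  exact (Finset.sum_coe_sort (Finset.Iic m) fun j => ⟪ψ j, g⟫_ℝ • ψ j).symm

end Galerkin

theorem mulVec_dotProduct_of_transpose_eq {ι : Type*} [Fintype ι] {A : Matrix ι ι ℝ} (hA : Aᵀ = A)
    (x y : ι → ℝ) : (A *ᵥ x) ⬝ᵥ y = x ⬝ᵥ (A *ᵥ y) := by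
  rw [Matrix.dotProduct_mulVec, ← Matrix.mulVec_transpose, hA]

section InvSqrt

variable {m : ℕ+} {A : Matrix (Finset.Iic m) (Finset.Iic m) ℝ}

theorem transpose_invSqrt (A : Matrix (Finset.Iic m) (Finset.Iic m) ℝ) :
    (invSqrt A)ᵀ = invSqrt A := by
  have h : IsSelfAdjoint (invSqrt A) := cfc_predicate _ _
  have := h.star_eq
  rwa [Matrix.star_eq_conjTranspose, Matrix.conjTranspose_eq_transpose_of_trivial] at this

theorem invSqrt_mul_mul_invSqrt (hA : A.PosDef) : invSqrt A * A * invSqrt A = 1 := by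
  have hsa : IsSelfAdjoint A := hA.isHermitian
  have hfin : (spectrum ℝ A).Finite := Matrix.finite_real_spectrum
  have hc : ∀ f : ℝ → ℝ, ContinuousOn f (spectrum ℝ A) := fun f => hfin.continuousOn f
  have hpos : ∀ x ∈ spectrum ℝ A, 0 < x := by
    intro x hx
    rw [hA.isHermitian.spectrum_real_eq_range_eigenvalues] at hx
    obtain ⟨i, rfl⟩ := hx
    exact hA.eigenvalues_pos i
  unfold invSqrt
  conv_lhs => enter [1, 2]; rw [← cfc_id ℝ A hsa]
  rw [← cfc_mul _ _ A (hc _) (hc _), ← cfc_mul _ _ A (hc _) (hc _)]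
  rw [← cfc_one ℝ A hsa]
  refine cfc_congr fun x hx => ?_
  have h0 := hpos x hx
  have h1 : √x ≠ 0 := (Real.sqrt_pos.mpr h0).ne'
  simp only [id, Pi.one_apply]
  field_simp
  exact (Real.sq_sqrt h0.le).symm

end InvSqrt

section Moments

variable {Ω : Type*} [MeasurableSpace Ω] {μ : Measure Ω}

theorem memLp_of_integrable_pow {f : Ω → ℝ} {q : ℕ} (hq : q ≠ 0) (hf : AEStronglyMeasurable f μ)
    (h : Integrable (fun ω => |f ω| ^ q) μ) : MemLp f (q : ENNReal) μ := by
  rw [← integrable_norm_rpow_iff hf (by exact_mod_cast hq) (by simp)]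
  simpa using h

theorem integrable_and_integral_le_of_lintegral_le {f : Ω → ℝ} {B : ℝ} (hB : 0 ≤ B)
    (hf : AEStronglyMeasurable f μ) (h0 : ∀ ω, 0 ≤ f ω)
    (h : ∫⁻ ω, ENNReal.ofReal (f ω) ∂μ ≤ ENNReal.ofReal B) :
    Integrable f μ ∧ ∫ ω, f ω ∂μ ≤ B := by
  have hi : Integrable f μ := by
    refine ⟨hf, ?_⟩
    rw [hasFiniteIntegral_iff_ofReal (.of_forall h0)]
    exact h.trans_lt ENNReal.ofReal_lt_top
  refine ⟨hi, ?_⟩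
  rw [integral_eq_lintegral_of_nonneg_ae (.of_forall h0) hf]
  exact ENNReal.toReal_le_of_le_ofReal hB h

variable {H : Type*} [NormedAddCommGroup H] [InnerProductSpace ℝ H] {X : Ω → H}

theorem secondCountableTopology_of_hilbertBasis (ψ : HilbertBasis ℕ+ ℝ H) :
    SecondCountableTopology H := by
  have h1 : TopologicalSpace.IsSeparable (Set.range ψ) := (Set.countable_range ψ).isSeparable
  have h2 := (h1.span (R := ℝ)).closure
  have h3 : (closure (Submodule.span ℝ (Set.range ψ) : Set H)) = Set.univ := by
    rw [← Submodule.topologicalClosure_coe, ψ.dense_span, Submodule.top_coe]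
  rw [h3] at h2
  have : TopologicalSpace.SeparableSpace H := TopologicalSpace.isSeparable_univ_iff.mp h2
  exact UniformSpace.secondCountable_of_separable H

theorem aestronglyMeasurable_inner_of_memLp (hX : MemLp X 2 μ) (g : H) :
    AEStronglyMeasurable (fun ω => ⟪g, X ω⟫_ℝ) μ :=
  (continuous_const.inner continuous_id).comp_aestronglyMeasurable hX.aestronglyMeasurable

variable [CompleteSpace H] [MeasurableSpace H] [BorelSpace H] {ψ : HilbertBasis ℕ+ ℝ H}

theorem covOp_inner (ψ : HilbertBasis ℕ+ ℝ H) (hX : MemLp X 2 μ) (f g : H) :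
    ⟪covOp μ X f, g⟫_ℝ = ∫ ω, ⟪f, X ω⟫_ℝ * ⟪g, X ω⟫_ℝ ∂μ := by
  -- Strong measurability of the identity of `H` rests on separability.
  have := secondCountableTopology_of_hilbertBasis ψ
  have hm : AEMeasurable X μ := hX.aestronglyMeasurable.aemeasurable
  have h1 : MemLp id 2 (μ.map X) :=
    (memLp_map_measure_iff aestronglyMeasurable_id hm).mpr (by simpa using hX)
  unfold covOp
  rw [covarianceOperator_inner h1, integral_map hm]
  have h2 : Continuous fun z : H => ⟪f, z⟫_ℝ * ⟪g, z⟫_ℝ := by fun_prop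
  exact h2.measurable.aestronglyMeasurable

variable {p : ℕ} {η : ℝ}

/-- For `f` in the span of the first `m` basis elements, `⟨f, X⟩` is `⟨T f, f⟩^{1/2}` times
`zᵗ [T]_m^{-1/2} [X]_m` for a unit vector `z`, so the moment condition applies. -/
theorem RegressorClass.lintegral_inner_synth_le (hX : RegressorClass ψ μ (2 * p) η X) (hp : p ≠ 0)
    (hs : ∀ f g, ⟪covOp μ X f, g⟫_ℝ = ⟪f, covOp μ X g⟫_ℝ)
    (hpos : ∀ f, f ≠ 0 → 0 < ⟪covOp μ X f, f⟫_ℝ) (m : ℕ+) (a : Finset.Iic m → ℝ) :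
    ∫⁻ ω, ENNReal.ofReal (⟪synth ψ m a, X ω⟫_ℝ ^ (2 * p)) ∂μ
      ≤ ENNReal.ofReal (η * ⟪covOp μ X (synth ψ m a), synth ψ m a⟫_ℝ ^ p) := by
  rcases eq_or_ne a 0 with rfl | ha
  · simp [synth, hp]
  set A := opMatrix ψ m (covOp μ X) with hA
  have hAp : A.PosDef := posDef_opMatrix ψ m hs hpos
  set R := invSqrt A with hR
  have hRR : R * A * R = 1 := invSqrt_mul_mul_invSqrt hAp
  have hRt : Rᵀ = R := transpose_invSqrt A
  have hRR' : R * (A * R) = 1 := by rw [← Matrix.mul_assoc]; exact hRR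
  -- The vector `b = R⁻¹ a`, written without an inverse.
  set b := (A * R) *ᵥ a with hb
  have hRb : R *ᵥ b = a := by rw [hb, Matrix.mulVec_mulVec, hRR', Matrix.one_mulVec]
  have hbb : b ⬝ᵥ b = ⟪covOp μ X (synth ψ m a), synth ψ m a⟫_ℝ := by
    have h : a ⬝ᵥ (A *ᵥ a) = (R *ᵥ b) ⬝ᵥ (A *ᵥ (R *ᵥ b)) := by rw [hRb]
    rw [inner_map_synth, ← hA, h, mulVec_dotProduct_of_transpose_eq hRt,
      Matrix.mulVec_mulVec, Matrix.mulVec_mulVec, hRR, Matrix.one_mulVec]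
  have hpos' : 0 < b ⬝ᵥ b := by
    rw [hbb]; exact hpos _ ((synth_eq_zero_iff ψ m a).not.mpr ha)
  set s := √(b ⬝ᵥ b) with hs'
  have hs0 : 0 < s := Real.sqrt_pos.mpr hpos'
  have hss : s ^ 2 = b ⬝ᵥ b := Real.sq_sqrt hpos'.le
  have hz : (s⁻¹ • b) ⬝ᵥ (s⁻¹ • b) = 1 := by
    rw [smul_dotProduct, dotProduct_smul, ← hss]
    simp only [smul_eq_mul]
    field_simp
  obtain ⟨hi, hle⟩ := hX.moment_std m (s⁻¹ • b) hz
  have hkey : ∀ ω, ⟪synth ψ m a, X ω⟫_ℝ ^ (2 * p)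
      = (b ⬝ᵥ b) ^ p * |(s⁻¹ • b) ⬝ᵥ (R *ᵥ coefVec ψ m (X ω))| ^ (2 * p) := by
    intro ω
    have h1 : ⟪synth ψ m a, X ω⟫_ℝ = s * ((s⁻¹ • b) ⬝ᵥ (R *ᵥ coefVec ψ m (X ω))) := by
      rw [inner_synth_left, smul_dotProduct, smul_eq_mul, ← mul_assoc, mul_inv_cancel₀ hs0.ne',
        one_mul]
      rw [← mulVec_dotProduct_of_transpose_eq hRt, hRb]
    rw [h1, mul_pow, pow_mul s, hss, (even_two_mul p).pow_abs]
  simp_rw [hkey]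
  rw [← ofReal_integral_eq_lintegral_ofReal (hi.const_mul _)
    (.of_forall fun ω => by positivity), integral_const_mul]
  refine ENNReal.ofReal_le_ofReal ?_
  rw [mul_comm, hbb]
  have : 0 ≤ ⟪covOp μ X (synth ψ m a), synth ψ m a⟫_ℝ ^ p := by rw [← hbb]; positivity
  exact mul_le_mul_of_nonneg_right hle this

/-- The moment condition on standardised projections of `X`, extended to all linear functionals of
`X` by Fatou's lemma. -/
theorem RegressorClass.moment_inner (hX : RegressorClass ψ μ (2 * p) η X) (hp : p ≠ 0)
    (hη : 0 ≤ η) (hs : ∀ f g, ⟪covOp μ X f, g⟫_ℝ = ⟪f, covOp μ X g⟫_ℝ)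
    (hpos : ∀ f, f ≠ 0 → 0 < ⟪covOp μ X f, f⟫_ℝ) (g : H) :
    MemLp (fun ω => ⟪g, X ω⟫_ℝ) ((2 * p : ℕ) : ENNReal) μ ∧
      ∫ ω, ⟪g, X ω⟫_ℝ ^ (2 * p) ∂μ ≤ η * ⟪covOp μ X g, g⟫_ℝ ^ p := by
  have hmeas := fun g : H => aestronglyMeasurable_inner_of_memLp hX.memLp g
  have hlim := tendsto_synth_coefVec ψ g
  have h1 : ∫⁻ ω, ENNReal.ofReal (⟪g, X ω⟫_ℝ ^ (2 * p)) ∂μ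
      ≤ ENNReal.ofReal (η * ⟪covOp μ X g, g⟫_ℝ ^ p) := by
    have hpt : ∀ ω, Filter.liminf (fun m => ENNReal.ofReal
        (⟪synth ψ m (coefVec ψ m g), X ω⟫_ℝ ^ (2 * p))) Filter.atTop
          = ENNReal.ofReal (⟪g, X ω⟫_ℝ ^ (2 * p)) := by
      intro ω
      refine Filter.Tendsto.liminf_eq ?_
      exact ENNReal.tendsto_ofReal ((hlim.inner tendsto_const_nhds).pow _)
    have hrhs : Filter.liminf (fun m => ENNReal.ofReal (η *
        ⟪covOp μ X (synth ψ m (coefVec ψ m g)), synth ψ m (coefVec ψ m g)⟫_ℝ ^ p)) Filter.atTop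
          = ENNReal.ofReal (η * ⟪covOp μ X g, g⟫_ℝ ^ p) := by
      refine Filter.Tendsto.liminf_eq ?_
      refine ENNReal.tendsto_ofReal (Filter.Tendsto.const_mul _ (Filter.Tendsto.pow ?_ _))
      exact (((covOp μ X).continuous.tendsto g).comp hlim).inner hlim
    rw [← hrhs]
    simp_rw [← hpt]
    refine (lintegral_liminf_le' fun m => ?_).trans ?_
    · exact ((hmeas _).aemeasurable.pow_const _).ennreal_ofReal
    · exact Filter.liminf_le_liminf (.of_forall fun m =>
        hX.lintegral_inner_synth_le hp hs hpos m _)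
  have hnn : 0 ≤ ⟪covOp μ X g, g⟫_ℝ := by
    rcases eq_or_ne g 0 with rfl | hg
    · simp
    · exact (hpos g hg).le
  obtain ⟨hi, hle⟩ := integrable_and_integral_le_of_lintegral_le (mul_nonneg hη (pow_nonneg hnn p))
    (f := fun ω => ⟪g, X ω⟫_ℝ ^ (2 * p)) ((hmeas g).pow (2 * p))
    (fun ω => (even_two_mul p).pow_nonneg _) h1
  refine ⟨memLp_of_integrable_pow (by omega) (hmeas g) ?_, hle⟩
  simpa only [(even_two_mul p).pow_abs] using hi

end Moments

/-! ### Perturbation of positive definite linear systems -/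

section SpectralNorm

variable {m : ℕ+}

theorem norm_toLp_sq {ι : Type*} [Fintype ι] (x : ι → ℝ) : ‖WithLp.toLp 2 x‖ ^ 2 = x ⬝ᵥ x := by
  rw [EuclideanSpace.real_norm_sq_eq]
  simp [dotProduct, sq]

theorem specNorm_le {B : Matrix (Finset.Iic m) (Finset.Iic m) ℝ} {c : ℝ} (hc : 0 ≤ c)
    (h : ∀ x, (B *ᵥ x) ⬝ᵥ (B *ᵥ x) ≤ c ^ 2 * (x ⬝ᵥ x)) : specNorm B ≤ c := by
  refine ContinuousLinearMap.opNorm_le_bound _ hc fun x => ?_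
  refine abs_le_of_sq_le_sq' ?_ (by positivity) |>.2
  have h1 := h (WithLp.ofLp x)
  rw [← norm_toLp_sq, ← norm_toLp_sq, ← mul_pow] at h1
  exact h1

theorem mulVec_dotProduct_self_le_of_specNorm_le {B : Matrix (Finset.Iic m) (Finset.Iic m) ℝ}
    {c : ℝ} (h : specNorm B ≤ c) (x : Finset.Iic m → ℝ) :
    (B *ᵥ x) ⬝ᵥ (B *ᵥ x) ≤ c ^ 2 * (x ⬝ᵥ x) := by
  rw [← norm_toLp_sq, ← norm_toLp_sq, ← mul_pow]
  have h1 := ContinuousLinearMap.le_of_opNorm_le _ h (WithLp.toLp 2 x)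
  have h2 : ‖WithLp.toLp 2 (B *ᵥ x)‖ ≤ c * ‖WithLp.toLp 2 x‖ := h1
  gcongr

end SpectralNorm

section Perturbation

variable {ι : Type*} [Fintype ι]

theorem dotProduct_sq_le (x y : ι → ℝ) : (x ⬝ᵥ y) ^ 2 ≤ (x ⬝ᵥ x) * (y ⬝ᵥ y) := by
  have := Finset.sum_mul_sq_le_sq_mul_sq Finset.univ x y
  simpa [dotProduct, sq] using this

theorem dotProduct_self_nonneg (x : ι → ℝ) : 0 ≤ x ⬝ᵥ x :=
  Finset.sum_nonneg fun i _ => mul_self_nonneg (x i)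

/-- The squared Frobenius norm of a matrix. -/
def frobSq (A : Matrix ι ι ℝ) : ℝ := ∑ j, ∑ l, A j l ^ 2

theorem frobSq_nonneg (A : Matrix ι ι ℝ) : 0 ≤ frobSq A :=
  Finset.sum_nonneg fun _ _ => Finset.sum_nonneg fun _ _ => sq_nonneg _

theorem mulVec_dotProduct_self_le (A : Matrix ι ι ℝ) (x : ι → ℝ) :
    (A *ᵥ x) ⬝ᵥ (A *ᵥ x) ≤ frobSq A * (x ⬝ᵥ x) := by
  unfold frobSq
  rw [Finset.sum_mul]
  refine Finset.sum_le_sum fun j _ => ?_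
  have h := dotProduct_sq_le (A j) x
  rw [← sq]
  refine h.trans_eq ?_
  congr 1
  exact Finset.sum_congr rfl fun l _ => (sq _).symm

variable [DecidableEq ι]

/-- A matrix at Frobenius distance at most `1/2` from the identity has a form bounded below by
`1/2`. -/
theorem half_le_of_frobSq_le {G : Matrix ι ι ℝ} (hG : frobSq (G - 1) ≤ 1 / 4) (x : ι → ℝ) :
    x ⬝ᵥ x / 2 ≤ x ⬝ᵥ (G *ᵥ x) := by
  have h1 := dotProduct_sq_le x ((G - 1) *ᵥ x)
  have h2 := mulVec_dotProduct_self_le (G - 1) x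
  have h0 := dotProduct_self_nonneg x
  have h3 : (x ⬝ᵥ ((G - 1) *ᵥ x)) ^ 2 ≤ (x ⬝ᵥ x / 2) ^ 2 := by
    calc _ ≤ _ := h1
      _ ≤ (x ⬝ᵥ x) * (1 / 4 * (x ⬝ᵥ x)) := by
        gcongr; exact h2.trans (by gcongr)
      _ = _ := by ring
  have h4 := (abs_le_of_sq_le_sq' h3 (by positivity)).1
  rw [Matrix.sub_mulVec, Matrix.one_mulVec, dotProduct_sub] at h4
  linarith

/-- `A` is whitened by the symmetric matrix `R` (in the application `R = A^{-1/2}`), and `Ahat` is a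
symmetric perturbation of `A`. No closeness of `Ahat` to `A` is included. -/
structure Whitening (A R Ahat : Matrix ι ι ℝ) : Prop where
  symm : Rᵀ = R
  whiten : R * A * R = 1
  symm_hat : Ahatᵀ = Ahat

variable {A R Ahat : Matrix ι ι ℝ} (hw : Whitening A R Ahat)
include hw

theorem Whitening.mulVec_whiten (y : ι → ℝ) : R *ᵥ ((A * R) *ᵥ y) = y := by
  rw [Matrix.mulVec_mulVec, ← Matrix.mul_assoc, hw.whiten, Matrix.one_mulVec]

theorem Whitening.dotProduct_whiten (x : ι → ℝ) :
    (R *ᵥ x) ⬝ᵥ (A *ᵥ (R *ᵥ x)) = x ⬝ᵥ x := by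
  rw [mulVec_dotProduct_of_transpose_eq hw.symm, Matrix.mulVec_mulVec, Matrix.mulVec_mulVec,
    hw.whiten, Matrix.one_mulVec]

/-- If the whitened perturbation is close to the identity, the form of `Ahat` is at least half the
form of `A`. -/
theorem Whitening.half_le (hF : frobSq (R * Ahat * R - 1) ≤ 1 / 4) (y : ι → ℝ) :
    y ⬝ᵥ (A *ᵥ y) / 2 ≤ y ⬝ᵥ (Ahat *ᵥ y) := by
  rw [← hw.mulVec_whiten y]
  generalize (A * R) *ᵥ y = x
  rw [hw.dotProduct_whiten, mulVec_dotProduct_of_transpose_eq hw.symm, Matrix.mulVec_mulVec,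
    Matrix.mulVec_mulVec]
  exact half_le_of_frobSq_le hF x

theorem Whitening.isUnit (hA : ∀ y, y ≠ 0 → 0 < y ⬝ᵥ (A *ᵥ y))
    (hF : frobSq (R * Ahat * R - 1) ≤ 1 / 4) : IsUnit Ahat := by
  refine Matrix.PosDef.isUnit (Matrix.PosDef.of_dotProduct_mulVec_pos ?_ fun y hy => ?_)
  · rw [Matrix.IsHermitian, Matrix.conjTranspose_eq_transpose_of_trivial, hw.symm_hat]
  · rw [star_trivial]
    have := hw.half_le hF y
    have := hA y hy
    linarith

/-- The error of the solution of a linear system, when the perturbation is small: expanding the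
inverse to first order, `v ⬝ᵥ W` is the leading term. -/
theorem Whitening.sq_dotProduct_le (hF : frobSq (R * Ahat * R - 1) ≤ 1 / 4) {h y w : ι → ℝ}
    (hy : Ahat *ᵥ y = w) :
    (h ⬝ᵥ y) ^ 2 ≤ 2 * ((R *ᵥ h) ⬝ᵥ (R *ᵥ w)) ^ 2
      + 8 * ((R *ᵥ h) ⬝ᵥ (R *ᵥ h))
        * (frobSq (R * Ahat * R - 1) * ((R *ᵥ w) ⬝ᵥ (R *ᵥ w))) := by
  set x := (A * R) *ᵥ y with hx
  have hRx : R *ᵥ x = y := hw.mulVec_whiten y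
  set v := R *ᵥ h with hv
  set W := R *ᵥ w with hW
  set Ξ := R * Ahat * R - 1 with hΞ
  have hGx : (R * Ahat * R) *ᵥ x = W := by
    rw [← Matrix.mulVec_mulVec, hRx, ← Matrix.mulVec_mulVec, hy]
  have hvx : h ⬝ᵥ y = v ⬝ᵥ x := by rw [hv, mulVec_dotProduct_of_transpose_eq hw.symm, hRx]
  have hxW : x = W - Ξ *ᵥ x := by
    rw [hΞ, Matrix.sub_mulVec, hGx, Matrix.one_mulVec]; abel
  have hxx : x ⬝ᵥ x ≤ 4 * (W ⬝ᵥ W) := by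
    have h1 := half_le_of_frobSq_le hF x
    rw [hGx] at h1
    have h2 := dotProduct_sq_le x W
    have h0 := dotProduct_self_nonneg x
    rcases h0.eq_or_lt with h | h
    · rw [← h]; have := dotProduct_self_nonneg W; positivity
    · have h3 : (x ⬝ᵥ x / 2) ^ 2 ≤ (x ⬝ᵥ x) * (W ⬝ᵥ W) := by
        refine le_trans ?_ h2
        gcongr
      nlinarith
  have h1 : (v ⬝ᵥ (Ξ *ᵥ x)) ^ 2 ≤ (v ⬝ᵥ v) * (frobSq Ξ * (4 * (W ⬝ᵥ W))) := by
    refine (dotProduct_sq_le _ _).trans ?_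
    have hv0 := dotProduct_self_nonneg v
    gcongr
    refine (mulVec_dotProduct_self_le Ξ x).trans ?_
    have := frobSq_nonneg Ξ
    gcongr
  have h2 : h ⬝ᵥ y = v ⬝ᵥ W - v ⬝ᵥ (Ξ *ᵥ x) := by
    rw [hvx, ← dotProduct_sub, ← hxW]
  rw [h2]
  nlinarith [sq_nonneg (v ⬝ᵥ W + v ⬝ᵥ (Ξ *ᵥ x))]

/-- A bound that uses only the size `c` of the inverse of `Ahat` and not its distance to `A`. It
serves on the event where the whitened perturbation is far from the identity. -/
theorem Whitening.sq_dotProduct_le_of_inverse_bound {a c : ℝ} (ha : 0 ≤ a) (hc : 0 ≤ c)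
    (hA : ∀ y, y ⬝ᵥ (A *ᵥ y) ≤ a * (y ⬝ᵥ y)) (hu : IsUnit Ahat)
    (hpsd : ∀ y, 0 ≤ y ⬝ᵥ (Ahat *ᵥ y))
    (hinv : ∀ x, (Ahat⁻¹ *ᵥ x) ⬝ᵥ (Ahat⁻¹ *ᵥ x) ≤ c ^ 2 * (x ⬝ᵥ x)) (h y : ι → ℝ) :
    (h ⬝ᵥ y) ^ 2 ≤ ((R *ᵥ h) ⬝ᵥ (R *ᵥ h)) * (a * (c * (y ⬝ᵥ (Ahat *ᵥ y)))) := by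
  have hdet : IsUnit Ahat.det := (Matrix.isUnit_iff_isUnit_det _).mp hu
  have hyy : y ⬝ᵥ y ≤ c * (y ⬝ᵥ (Ahat *ᵥ y)) := by
    set z := Ahat⁻¹ *ᵥ y with hz
    have hAz : Ahat *ᵥ z = y := by
      rw [hz, Matrix.mulVec_mulVec, Matrix.mul_nonsing_inv _ hdet, Matrix.one_mulVec]
    have hzy : z ⬝ᵥ y ≤ c * (y ⬝ᵥ y) := by
      have h0 := dotProduct_self_nonneg y
      refine abs_le_of_sq_le_sq' ?_ (by positivity) |>.2
      calc (z ⬝ᵥ y) ^ 2 ≤ _ := dotProduct_sq_le _ _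
        _ ≤ (c ^ 2 * (y ⬝ᵥ y)) * (y ⬝ᵥ y) := by gcongr; exact hinv y
        _ = _ := by ring
    -- Cauchy–Schwarz for the form of `Ahat`, in discriminant form
    have hcs : (y ⬝ᵥ y) ^ 2 ≤ (z ⬝ᵥ y) * (y ⬝ᵥ (Ahat *ᵥ y)) := by
      have hq : ∀ t : ℝ, 0 ≤ (y ⬝ᵥ (Ahat *ᵥ y)) * (t * t) + 2 * (y ⬝ᵥ y) * t + z ⬝ᵥ y := by
        intro t
        have h1 := hpsd (z + t • y)
        have h2 : z ⬝ᵥ (Ahat *ᵥ y) = y ⬝ᵥ y := by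
          rw [← mulVec_dotProduct_of_transpose_eq hw.symm_hat, hAz]
        simp only [Matrix.mulVec_add, Matrix.mulVec_smul, hAz, add_dotProduct, dotProduct_add,
          smul_dotProduct, dotProduct_smul, smul_eq_mul, h2] at h1
        linarith
      have := discrim_le_zero hq
      unfold discrim at this
      nlinarith
    have h0 := dotProduct_self_nonneg y
    rcases h0.eq_or_lt with h | h
    · rw [← h]; exact mul_nonneg hc (hpsd y)
    · have h3 : (y ⬝ᵥ y) ^ 2 ≤ (c * (y ⬝ᵥ y)) * (y ⬝ᵥ (Ahat *ᵥ y)) :=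
        hcs.trans (mul_le_mul_of_nonneg_right hzy (hpsd y))
      nlinarith
  set x := (A * R) *ᵥ y with hx
  have hRx : R *ᵥ x = y := hw.mulVec_whiten y
  have hvx : h ⬝ᵥ y = (R *ᵥ h) ⬝ᵥ x := by rw [mulVec_dotProduct_of_transpose_eq hw.symm, hRx]
  rw [hvx]
  refine (dotProduct_sq_le _ _).trans ?_
  have := dotProduct_self_nonneg (R *ᵥ h)
  gcongr
  rw [← hw.dotProduct_whiten, hRx]
  refine (hA y).trans ?_
  gcongr

end Perturbation

section

variable {m : ℕ+} {A R Ahat : Matrix (Finset.Iic m) (Finset.Iic m) ℝ}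

theorem Whitening.specNorm_inv_le (hw : Whitening A R Ahat) {c : ℝ} (hc : 0 < c)
    (hA : ∀ y, c * (y ⬝ᵥ y) ≤ y ⬝ᵥ (A *ᵥ y))
    (hu : IsUnit Ahat) (hF : frobSq (R * Ahat * R - 1) ≤ 1 / 4) : specNorm Ahat⁻¹ ≤ 2 / c := by
  have hdet : IsUnit Ahat.det := (Matrix.isUnit_iff_isUnit_det _).mp hu
  refine specNorm_le (by positivity) fun y => ?_
  set x := Ahat⁻¹ *ᵥ y with hx
  have hAx : Ahat *ᵥ x = y := by
    rw [hx, Matrix.mulVec_mulVec, Matrix.mul_nonsing_inv _ hdet, Matrix.one_mulVec]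
  have h1 := hw.half_le hF x
  rw [hAx] at h1
  have h2 := hA x
  have h3 := dotProduct_sq_le x y
  have h0 := dotProduct_self_nonneg x
  rcases h0.eq_or_lt with h | h
  · rw [← h]; have := dotProduct_self_nonneg y; positivity
  · have h4 : (c * (x ⬝ᵥ x) / 2) ^ 2 ≤ (x ⬝ᵥ x) * (y ⬝ᵥ y) := by
      refine le_trans ?_ h3
      have : c * (x ⬝ᵥ x) / 2 ≤ x ⬝ᵥ y := by linarith
      gcongr
    have h5 : (c / 2) ^ 2 * (x ⬝ᵥ x) ≤ y ⬝ᵥ y := by nlinarith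
    have h6 : (2 / c) ^ 2 * ((c / 2) ^ 2 * (x ⬝ᵥ x)) = x ⬝ᵥ x := by field_simp
    rw [← h6]
    gcongr

end

/-! ### Bias of the Galerkin approximation -/

section Series

theorem summable_mul_and_sq_tsum_mul_le {ι : Type*} {f g : ι → ℝ} (hf : Summable fun i => f i ^ 2)
    (hg : Summable fun i => g i ^ 2) :
    Summable (fun i => f i * g i) ∧
      (∑' i, f i * g i) ^ 2 ≤ (∑' i, f i ^ 2) * ∑' i, g i ^ 2 := by
  have hfg : Summable fun i => f i * g i := by
    refine Summable.of_norm_bounded (hf.add hg) fun i => ?_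
    rw [Real.norm_eq_abs, abs_le]
    constructor <;> nlinarith [sq_nonneg (f i + g i), sq_nonneg (f i - g i), sq_nonneg (f i),
      sq_nonneg (g i)]
  refine ⟨hfg, ?_⟩
  have h : ∀ t : ℝ, 0 ≤ (∑' i, g i ^ 2) * (t * t) + (2 * ∑' i, f i * g i) * t + ∑' i, f i ^ 2 := by
    intro t
    have h1 : ∑' i, (f i + t * g i) ^ 2
        = (∑' i, g i ^ 2) * (t * t) + (2 * ∑' i, f i * g i) * t + ∑' i, f i ^ 2 := by
      rw [← tsum_mul_right, ← tsum_mul_left, ← tsum_mul_right,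
        ← (hg.mul_right _).tsum_add ((hfg.mul_left 2).mul_right t),
        ← ((hg.mul_right _).add ((hfg.mul_left 2).mul_right t)).tsum_add hf]
      exact tsum_congr fun i => by ring
    rw [← h1]
    exact tsum_nonneg fun i => sq_nonneg _
  have := discrim_le_zero h
  unfold discrim at this
  linarith

theorem summable_mul_and_sq_tsum_mul_le_of_weight {ι : Type*} {γ h b : ι → ℝ} (hγ : ∀ i, 0 < γ i)
    (hh : Summable fun i => h i ^ 2 / γ i) (hb : Summable fun i => γ i * b i ^ 2) :
    Summable (fun i => h i * b i) ∧
      (∑' i, h i * b i) ^ 2 ≤ (∑' i, h i ^ 2 / γ i) * ∑' i, γ i * b i ^ 2 := by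
  have e1 : ∀ i, (h i / √(γ i)) ^ 2 = h i ^ 2 / γ i := fun i => by
    rw [div_pow, Real.sq_sqrt (hγ i).le]
  have e2 : ∀ i, (√(γ i) * b i) ^ 2 = γ i * b i ^ 2 := fun i => by
    rw [mul_pow, Real.sq_sqrt (hγ i).le]
  have e3 : ∀ i, h i / √(γ i) * (√(γ i) * b i) = h i * b i := fun i => by
    have := (Real.sqrt_pos.mpr (hγ i)).ne'
    field_simp
  have := summable_mul_and_sq_tsum_mul_le (f := fun i => h i / √(γ i)) (g := fun i => √(γ i) * b i)
    (by simpa only [e1] using hh) (by simpa only [e2] using hb)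
  simpa only [e1, e2, e3] using this

theorem tsum_eq_sum_Iic_add_tsum_Ioi {f : ℕ+ → ℝ} (hf : Summable f) (m : ℕ+) :
    ∑' j, f j = ∑ j ∈ Finset.Iic m, f j + ∑' j : Set.Ioi m, f j := by
  rw [← hf.tsum_subtype_add_tsum_subtype_compl (Set.Iic m), Set.compl_Iic]
  congr 1
  rw [← Finset.coe_Iic, Finset.tsum_subtype']

end Series

section Bias

variable {H : Type*} [NormedAddCommGroup H] [InnerProductSpace ℝ H]
  {ψ : HilbertBasis ℕ+ ℝ H} {γ υ h : ℕ+ → ℝ} {d ρ : ℝ} {T : H →L[ℝ] H} {β : H}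

theorem WeightCondition.one_le_γ (hw : WeightCondition γ υ) (j : ℕ+) : 1 ≤ γ j := by
  rw [← hw.γ_one]; exact hw.γ_mono (one_le)

theorem WeightCondition.υ_le_one (hw : WeightCondition γ υ) (j : ℕ+) : υ j ≤ 1 := by
  rw [← hw.υ_one]; exact hw.υ_anti (one_le)

theorem summable_sq_div_of_memWeighted (hh : MemWeighted (fun j => (γ j)⁻¹) h) :
    Summable fun j => h j ^ 2 / γ j := by
  unfold MemWeighted at hh
  simpa only [div_eq_inv_mul] using hh

/-- Every value of the functional is controlled by the two sums that make up the rate. -/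
theorem linFunctional_sq_le (hw : WeightCondition γ υ) (hh : MemWeighted (fun j => (γ j)⁻¹) h)
    (hβ : β ∈ ellipsoid ψ γ ρ) (m : ℕ+) :
    linFunctional ψ h β ^ 2
      ≤ ρ * (∑ j ∈ Finset.Iic m, h j ^ 2 / υ j + ∑' j : Set.Ioi m, h j ^ 2 / γ j) := by
  have h1 := summable_sq_div_of_memWeighted hh
  obtain ⟨hb, hbρ⟩ := hβ
  have h2 := (summable_mul_and_sq_tsum_mul_le_of_weight hw.γ_pos h1 hb).2
  have h3 : ∑' j, h j ^ 2 / γ j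
      ≤ ∑ j ∈ Finset.Iic m, h j ^ 2 / υ j + ∑' j : Set.Ioi m, h j ^ 2 / γ j := by
    rw [tsum_eq_sum_Iic_add_tsum_Ioi h1 m]
    gcongr with j hj
    · exact hw.υ_pos j
    · exact (hw.υ_le_one j).trans (hw.one_le_γ j)
  have h4 : 0 ≤ ∑' j, h j ^ 2 / γ j :=
    tsum_nonneg fun j => div_nonneg (sq_nonneg _) (hw.γ_pos j).le
  have hρ : 0 ≤ ρ := le_trans (tsum_nonneg fun j => mul_nonneg (hw.γ_pos j).le (sq_nonneg _)) hbρ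
  calc _ ≤ _ := h2
    _ ≤ (∑' j, h j ^ 2 / γ j) * ρ := by gcongr; exact hbρ
    _ ≤ _ := by rw [mul_comm]; gcongr

theorem norm_sq_le_of_mem_ellipsoid (hw : WeightCondition γ υ) (hβ : β ∈ ellipsoid ψ γ ρ) :
    ‖β‖ ^ 2 ≤ ρ := by
  obtain ⟨hb, hbρ⟩ := hβ
  refine le_trans ?_ hbρ
  rw [← real_inner_self_eq_norm_sq, ← (hasSum_coef_mul_coef ψ β β).tsum_eq]
  refine (hasSum_coef_mul_coef ψ β β).summable.tsum_le_tsum (fun j => ?_) hb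
  rw [← sq]
  exact le_mul_of_one_le_left (sq_nonneg _) (hw.one_le_γ j)

/-- The Cauchy–Schwarz inequality in the first `m` coordinates with weights `υ`. -/
theorem sum_dotProduct_sq_le (hw : WeightCondition γ υ) (m : ℕ+) (a : Finset.Iic m → ℝ) :
    ((fun j : Finset.Iic m => h j) ⬝ᵥ a) ^ 2
      ≤ (∑ j ∈ Finset.Iic m, h j ^ 2 / υ j) * weightedNormSq υ (coef ψ (synth ψ m a)) := by
  have h1 : weightedNormSq υ (coef ψ (synth ψ m a)) = ∑ j : Finset.Iic m, υ j * a j ^ 2 := by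
    unfold weightedNormSq
    rw [tsum_eq_sum (s := Finset.Iic m), ← Finset.sum_coe_sort]
    · refine Finset.sum_congr rfl fun j _ => ?_
      rw [coef_synth, dif_pos (Finset.mem_Iic.mp j.2)]
    · intro j hj
      rw [coef_synth, dif_neg (by simpa using hj)]
      ring
  rw [h1, ← Finset.sum_coe_sort]
  have e1 : ∀ j : Finset.Iic m, (h j / √(υ j)) ^ 2 = h j ^ 2 / υ j := fun i => by
    rw [div_pow, Real.sq_sqrt (hw.υ_pos i).le]
  have e2 : ∀ j : Finset.Iic m, (√(υ j) * a j) ^ 2 = υ j * a j ^ 2 := fun i => by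
    rw [mul_pow, Real.sq_sqrt (hw.υ_pos i).le]
  have e3 : ∀ j : Finset.Iic m, h j / √(υ j) * (√(υ j) * a j) = h j * a j := fun i => by
    have := (Real.sqrt_pos.mpr (hw.υ_pos i)).ne'
    field_simp
  have := Finset.sum_mul_sq_le_sq_mul_sq Finset.univ (fun j : Finset.Iic m => h j / √(υ j))
    (fun j => √(υ j) * a j)
  simp only [e1, e2, e3] at this
  exact this

/-- The Galerkin coefficients `[T]_m⁻¹ [T β]_m` of `β`. -/
noncomputable def galerkin (ψ : HilbertBasis ℕ+ ℝ H) (T : H →L[ℝ] H) (m : ℕ+) (β : H) :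
    Finset.Iic m → ℝ := (opMatrix ψ m T)⁻¹ *ᵥ coefVec ψ m (T β)

/-- Galerkin orthogonality: the approximation error is orthogonal, for the form of `T`, to the span
of the first `m` basis elements. -/
theorem inner_galerkin_error_synth (hT : LinkClass ψ υ d T) (m : ℕ+) (a : Finset.Iic m → ℝ) :
    ⟪T (β - synth ψ m (galerkin ψ T m β)), synth ψ m a⟫_ℝ = 0 := by
  have hA := posDef_opMatrix ψ m hT.symm hT.pos
  have hdet := (Matrix.isUnit_iff_isUnit_det _).mp hA.isUnit
  rw [map_sub, inner_sub_left, inner_map_synth, galerkin, Matrix.mulVec_mulVec,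
    Matrix.mul_nonsing_inv _ hdet, Matrix.one_mulVec, real_inner_comm, inner_synth_left, sub_self]

/-- Pythagoras' identity of the Galerkin projection for the form of `T`. -/
theorem inner_galerkin_pythagoras (hT : LinkClass ψ υ d T) (m : ℕ+) (a : Finset.Iic m → ℝ) :
    ⟪T (β - synth ψ m (galerkin ψ T m β)), β - synth ψ m (galerkin ψ T m β)⟫_ℝ
      + ⟪T (synth ψ m (galerkin ψ T m β - a)), synth ψ m (galerkin ψ T m β - a)⟫_ℝ
      = ⟪T (β - synth ψ m a), β - synth ψ m a⟫_ℝ := by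
  have h0 := inner_galerkin_error_synth (β := β) hT m (galerkin ψ T m β - a)
  set f := β - synth ψ m (galerkin ψ T m β) with hf
  set s := synth ψ m (galerkin ψ T m β - a) with hs
  have h1 : β - synth ψ m a = f + s := by
    rw [hf, hs]
    simp only [synth, Pi.sub_apply, sub_smul, Finset.sum_sub_distrib]
    abel
  have h2 : ⟪T s, f⟫_ℝ = 0 := by rw [hT.symm, real_inner_comm, h0]
  rw [h1, map_add, inner_add_left, inner_add_right, inner_add_right, h0, h2]
  ring

theorem inner_galerkin_error_le (hT : LinkClass ψ υ d T) (m : ℕ+) :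
    ⟪T (β - synth ψ m (galerkin ψ T m β)), β - synth ψ m (galerkin ψ T m β)⟫_ℝ ≤ ⟪T β, β⟫_ℝ := by
  have h := inner_galerkin_pythagoras (β := β) hT m 0
  have h1 := hT.nonneg ψ (synth ψ m (galerkin ψ T m β - 0))
  have h2 : synth ψ m (0 : Finset.Iic m → ℝ) = 0 := (synth_eq_zero_iff ψ m 0).mpr rfl
  rw [h2, sub_zero β] at h
  linarith

variable [CompleteSpace H]

/-- The truncation error of an element of the ellipsoid, measured in the form of `T`. -/
theorem inner_tail_le (hw : WeightCondition γ υ) (hT : LinkClass ψ υ d T) (hd : 1 ≤ d)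
    (hβ : β ∈ ellipsoid ψ γ ρ) (m : ℕ+) :
    ⟪T (β - synth ψ m (coefVec ψ m β)), β - synth ψ m (coefVec ψ m β)⟫_ℝ
      ≤ d * (υ m / γ m * ρ) := by
  refine (hT.inner_le ψ hw.υ_summable (fun j => (hw.υ_pos j).le) (by linarith) _).trans ?_
  obtain ⟨hb, hbρ⟩ := hβ
  gcongr
  have hq : 0 ≤ υ m / γ m := div_nonneg (hw.υ_pos m).le (hw.γ_pos m).le
  refine le_trans ?_ (mul_le_mul_of_nonneg_left hbρ hq)
  unfold weightedNormSq
  rw [← tsum_mul_left]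
  refine (summable_weighted_of_summable ψ hw.υ_summable _).tsum_le_tsum (fun j => ?_)
    (hb.mul_left _)
  have hc : coef ψ (β - synth ψ m (coefVec ψ m β)) j = if j ≤ m then 0 else coef ψ β j := by
    have : coef ψ (β - synth ψ m (coefVec ψ m β)) j
        = coef ψ β j - coef ψ (synth ψ m (coefVec ψ m β)) j := by simp [coef, inner_sub_right]
    rw [this, coef_synth]
    split_ifs <;> simp [coefVec]
  rw [hc]
  split_ifs with hj
  · have := hw.γ_pos j
    have : 0 ≤ υ m / γ m * (γ j * coef ψ β j ^ 2) := by positivity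
    simpa using this
  · push Not at hj
    rw [← mul_assoc]
    gcongr
    have h1 := hw.υ_anti hj.le
    have h2 := hw.γ_mono hj.le
    have h3 := hw.γ_pos m
    have h4 := hw.υ_pos m
    calc υ j ≤ υ m := h1
      _ = υ m / γ m * γ m := by field_simp
      _ ≤ υ m / γ m * γ j := by gcongr

/-- The squared bias of the Galerkin approximation. -/
theorem bias_sq_le (hw : WeightCondition γ υ) (hT : LinkClass ψ υ d T) (hd : 1 ≤ d)
    (hh : MemWeighted (fun j => (γ j)⁻¹) h) (hβ : β ∈ ellipsoid ψ γ ρ) (m : ℕ+) :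
    ((fun j : Finset.Iic m => h j) ⬝ᵥ galerkin ψ T m β - linFunctional ψ h β) ^ 2
      ≤ 2 * ρ * (d ^ 2 * (υ m / γ m * ∑ j ∈ Finset.Iic m, h j ^ 2 / υ j)
        + ∑' j : Set.Ioi m, h j ^ 2 / γ j) := by
  set q := ∑ j ∈ Finset.Iic m, h j ^ 2 / υ j with hq
  set t := ∑' j : Set.Ioi m, h j ^ 2 / γ j with ht
  have h1 := summable_sq_div_of_memWeighted hh
  have hsum := (summable_mul_and_sq_tsum_mul_le_of_weight hw.γ_pos h1 hβ.1).1
  have htail : (∑' j : Set.Ioi m, h j * coef ψ β j) ^ 2 ≤ t * ρ := by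
    refine (summable_mul_and_sq_tsum_mul_le_of_weight (ι := Set.Ioi m) (γ := fun j => γ j)
      (h := fun j => h j) (b := fun j => coef ψ β j) (fun i => hw.γ_pos i)
      (h1.subtype _) (hβ.1.subtype _)).2.trans ?_
    have ht0 : 0 ≤ t := tsum_nonneg fun j => div_nonneg (sq_nonneg _) (hw.γ_pos j).le
    gcongr
    refine le_trans ?_ hβ.2
    have hs : Summable fun j => γ j * coef ψ β j ^ 2 := hβ.1
    exact hs.tsum_subtype_le _ _ (fun j => mul_nonneg (hw.γ_pos j).le (sq_nonneg _))
  have hsplit : (fun j : Finset.Iic m => h j) ⬝ᵥ galerkin ψ T m β - linFunctional ψ h β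
      = (fun j : Finset.Iic m => h j) ⬝ᵥ (galerkin ψ T m β - coefVec ψ m β)
        - ∑' j : Set.Ioi m, h j * coef ψ β j := by
    unfold linFunctional
    rw [tsum_eq_sum_Iic_add_tsum_Ioi hsum m, dotProduct_sub, ← Finset.sum_coe_sort]
    simp only [dotProduct, coefVec]
    ring
  have hhead : ((fun j : Finset.Iic m => h j) ⬝ᵥ (galerkin ψ T m β - coefVec ψ m β)) ^ 2
      ≤ q * (d * (d * (υ m / γ m * ρ))) := by
    refine (sum_dotProduct_sq_le (ψ := ψ) hw m _).trans ?_
    have hq0 : 0 ≤ q := Finset.sum_nonneg fun j _ => div_nonneg (sq_nonneg _) (hw.υ_pos j).le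
    gcongr
    refine (hT.le_inner ψ hw.υ_summable (by linarith) _).trans ?_
    gcongr
    have h3 := inner_galerkin_pythagoras (β := β) hT m (coefVec ψ m β)
    have h4 := hT.nonneg ψ (β - synth ψ m (galerkin ψ T m β))
    have h5 := inner_tail_le hw hT hd hβ m
    linarith
  rw [hsplit]
  nlinarith [sq_nonneg ((fun j : Finset.Iic m => h j) ⬝ᵥ (galerkin ψ T m β - coefVec ψ m β)
        + ∑' j : Set.Ioi m, h j * coef ψ β j)]

/-- The squared norm of `[T]_m^{-1/2} [h]_m`, which is the variance factor of the estimator. -/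
theorem whitened_representer_sq_le (hw : WeightCondition γ υ) (hT : LinkClass ψ υ d T) (hd : 1 ≤ d)
    (m : ℕ+) :
    (invSqrt (opMatrix ψ m T) *ᵥ fun j => h j) ⬝ᵥ (invSqrt (opMatrix ψ m T) *ᵥ fun j => h j)
      ≤ d * ∑ j ∈ Finset.Iic m, h j ^ 2 / υ j := by
  have hA := posDef_opMatrix ψ m hT.symm hT.pos
  set A := opMatrix ψ m T with hAdef
  set R := invSqrt A with hR
  set q := ∑ j ∈ Finset.Iic m, h j ^ 2 / υ j with hq
  have hq0 : 0 ≤ q := Finset.sum_nonneg fun j _ => div_nonneg (sq_nonneg _) (hw.υ_pos j).le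
  set v := R *ᵥ fun j : Finset.Iic m => h j with hv
  have h1 : (fun j : Finset.Iic m => h j) ⬝ᵥ (R *ᵥ v) = v ⬝ᵥ v := by
    rw [← mulVec_dotProduct_of_transpose_eq (transpose_invSqrt A)]
  have h2 := sum_dotProduct_sq_le (ψ := ψ) (h := h) hw m (R *ᵥ v)
  have h3 := hT.le_inner ψ hw.υ_summable (by linarith) (synth ψ m (R *ᵥ v))
  have hW : Whitening A R A := ⟨transpose_invSqrt A, invSqrt_mul_mul_invSqrt hA, by
    rw [← Matrix.conjTranspose_eq_transpose_of_trivial, hA.isHermitian.eq]⟩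
  rw [inner_map_synth, ← hAdef, hW.dotProduct_whiten] at h3
  rw [h1] at h2
  have h4 := h2.trans (mul_le_mul_of_nonneg_left h3 hq0)
  rcases (dotProduct_self_nonneg v).eq_or_lt with h | h
  · rw [← h]; positivity
  · nlinarith

end Bias

/-! ### The empirical equations and a pathwise error bound -/

section Empirical

variable {H : Type*} [NormedAddCommGroup H] [InnerProductSpace ℝ H]
  (ψ : HilbertBasis ℕ+ ℝ H) (m : ℕ+) {n : ℕ}

theorem inner_covHat (x : Fin n → H) (f g : H) :
    ⟪g, covHat x f⟫_ℝ = (n : ℝ)⁻¹ * ∑ i, ⟪x i, f⟫_ℝ * ⟪g, x i⟫_ℝ := by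
  simp [covHat, real_inner_smul_right, inner_sum]

theorem transpose_opMatrix_covHat (x : Fin n → H) :
    (opMatrix ψ m (covHat x))ᵀ = opMatrix ψ m (covHat x) := by
  ext j l
  simp only [opMatrix, Matrix.transpose_apply, Matrix.of_apply, inner_covHat]
  congr 1
  refine Finset.sum_congr rfl fun i _ => ?_
  rw [mul_comm, real_inner_comm (x i) (ψ l), real_inner_comm (x i) (ψ j)]

theorem dotProduct_opMatrix_covHat (x : Fin n → H) (y : Finset.Iic m → ℝ) :
    y ⬝ᵥ (opMatrix ψ m (covHat x) *ᵥ y) = (n : ℝ)⁻¹ * ∑ i, ⟪synth ψ m y, x i⟫_ℝ ^ 2 := by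
  rw [← inner_map_synth, real_inner_comm, inner_covHat]
  congr 1
  refine Finset.sum_congr rfl fun i _ => ?_
  rw [real_inner_comm, sq]

/-- The whitened coordinate directions: `⟨whitened_j, X⟩` is the `j`-th coordinate of
`[T]_m^{-1/2} [X]_m`. -/
noncomputable def whitened (T : H →L[ℝ] H) (j : Finset.Iic m) : H :=
  synth ψ m (invSqrt (opMatrix ψ m T) *ᵥ Pi.single j 1)

theorem inner_whitened (T : H →L[ℝ] H) (j : Finset.Iic m) (x : H) :
    ⟪whitened ψ m T j, x⟫_ℝ = (invSqrt (opMatrix ψ m T) *ᵥ coefVec ψ m x) j := by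
  rw [whitened, inner_synth_left, mulVec_dotProduct_of_transpose_eq (transpose_invSqrt _),
    single_one_dotProduct]

theorem inner_map_whitened {T : H →L[ℝ] H} (hs : ∀ f g, ⟪T f, g⟫_ℝ = ⟪f, T g⟫_ℝ)
    (hp : ∀ f, f ≠ 0 → 0 < ⟪T f, f⟫_ℝ) (j l : Finset.Iic m) :
    ⟪T (whitened ψ m T j), whitened ψ m T l⟫_ℝ
      = (1 : Matrix (Finset.Iic m) (Finset.Iic m) ℝ) j l := by
  have hA := posDef_opMatrix ψ m hs hp
  rw [whitened, whitened, inner_map_synth, mulVec_dotProduct_of_transpose_eq (transpose_invSqrt _),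
    Matrix.mulVec_mulVec, Matrix.mulVec_mulVec, invSqrt_mul_mul_invSqrt hA, Matrix.one_mulVec,
    single_one_dotProduct, Matrix.one_apply, Pi.single_apply]
  simp [eq_comm]

/-- Deviation of the whitened empirical covariance matrix from the identity. -/
noncomputable def covDev (T : H →L[ℝ] H) (x : Fin n → H) : Matrix (Finset.Iic m) (Finset.Iic m) ℝ :=
  Matrix.of fun j l => (n : ℝ)⁻¹ * ∑ i, (⟪whitened ψ m T j, x i⟫_ℝ * ⟪whitened ψ m T l, x i⟫_ℝ
    - (1 : Matrix (Finset.Iic m) (Finset.Iic m) ℝ) j l)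

/-- The whitened empirical cross moment of the residuals `u` and the regressors. -/
noncomputable def crossDev (T : H →L[ℝ] H) (u : Fin n → ℝ) (x : Fin n → H) : Finset.Iic m → ℝ :=
  fun j => (n : ℝ)⁻¹ * ∑ i, u i * ⟪whitened ψ m T j, x i⟫_ℝ

/-- `covDev` is `R [T̂]_m R - 1` with `R = [T]_m^{-1/2}`. -/
theorem covDev_eq (hn : 0 < n) (T : H →L[ℝ] H) (x : Fin n → H) :
    covDev ψ m T x = invSqrt (opMatrix ψ m T) * opMatrix ψ m (covHat x)
      * invSqrt (opMatrix ψ m T) - 1 := by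
  set R := invSqrt (opMatrix ψ m T) with hR
  have hn' : (n : ℝ) ≠ 0 := by exact_mod_cast hn.ne'
  ext j l
  have h1 : (R * opMatrix ψ m (covHat x) * R) j l
      = ⟪whitened ψ m T j, covHat x (whitened ψ m T l)⟫_ℝ := by
    rw [whitened, whitened, real_inner_comm, inner_map_synth, ← hR,
      mulVec_dotProduct_of_transpose_eq (transpose_invSqrt _), single_one_dotProduct,
      Matrix.mulVec_mulVec, Matrix.mulVec_mulVec, Matrix.mulVec_single_one, Matrix.col_apply]
  rw [Matrix.sub_apply, h1, inner_covHat]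
  simp only [covDev, Matrix.of_apply, Finset.sum_sub_distrib, Finset.sum_const, Finset.card_univ,
    Fintype.card_fin, nsmul_eq_mul, mul_sub]
  rw [← mul_assoc (n : ℝ)⁻¹ (n : ℝ), inv_mul_cancel₀ hn', one_mul]
  congr 2
  refine Finset.sum_congr rfl fun i _ => ?_
  rw [real_inner_comm (x i) (whitened ψ m T l), mul_comm]

/-- The empirical cross moment `n⁻¹ ∑_i u_i [x_i]_m`. -/
noncomputable def crossVec (u : Fin n → ℝ) (x : Fin n → H) : Finset.Iic m → ℝ :=
  fun j => (n : ℝ)⁻¹ * ∑ i, u i * coef ψ (x i) j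

theorem crossVec_eq (u : Fin n → ℝ) (x : Fin n → H) :
    crossVec ψ m u x = (n : ℝ)⁻¹ • ∑ i, u i • coefVec ψ m (x i) := by
  ext j
  simp [crossVec, coefVec]

theorem crossDev_eq (T : H →L[ℝ] H) (u : Fin n → ℝ) (x : Fin n → H) :
    crossDev ψ m T u x = invSqrt (opMatrix ψ m T) *ᵥ crossVec ψ m u x := by
  ext j
  rw [crossVec_eq, Matrix.mulVec_smul, Matrix.mulVec_sum]
  simp [crossDev, inner_whitened, Matrix.mulVec_smul]

theorem dotProduct_crossVec (u : Fin n → ℝ) (x : Fin n → H) (y : Finset.Iic m → ℝ) :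
    y ⬝ᵥ crossVec ψ m u x = (n : ℝ)⁻¹ * ∑ i, u i * ⟪synth ψ m y, x i⟫_ℝ := by
  rw [crossVec_eq, dotProduct_smul, dotProduct_sum, smul_eq_mul]
  simp [inner_synth_left]

/-- Decomposition of the empirical right-hand side around arbitrary coefficients `b`: what remains
is the cross moment of the regressors with the residuals of the approximation `b`. -/
theorem coefVec_gHat (x : Fin n → H) (e : Fin n → ℝ) (β : H) (b : Finset.Iic m → ℝ) :
    coefVec ψ m (gHat (fun i => ⟪β, x i⟫_ℝ + e i) x)
      = opMatrix ψ m (covHat x) *ᵥ b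
        + crossVec ψ m (fun i => ⟪β - synth ψ m b, x i⟫_ℝ + e i) x := by
  ext j
  have h1 : (opMatrix ψ m (covHat x) *ᵥ b) j = ⟪ψ j, covHat x (synth ψ m b)⟫_ℝ := by
    simp [synth, Matrix.mulVec, opMatrix, dotProduct, inner_sum, real_inner_smul_right, mul_comm]
  rw [Pi.add_apply, h1, inner_covHat]
  simp only [coefVec, coef, gHat, crossVec, real_inner_smul_right, inner_sum, ← mul_add,
    ← Finset.sum_add_distrib]
  congr 1
  refine Finset.sum_congr rfl fun i _ => ?_
  rw [inner_sub_left, real_inner_comm (synth ψ m b) (x i)]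
  ring

/-- If the quadratic form `S = n⁻¹ ∑ a_i²` satisfies `S = n⁻¹ ∑ u_i a_i`, then `S ≤ n⁻¹ ∑ u_i²`. -/
theorem average_sq_le_of_eq (u a : Fin n → ℝ)
    (h : (n : ℝ)⁻¹ * ∑ i, a i ^ 2 = (n : ℝ)⁻¹ * ∑ i, u i * a i) :
    (n : ℝ)⁻¹ * ∑ i, a i ^ 2 ≤ (n : ℝ)⁻¹ * ∑ i, u i ^ 2 := by
  have h1 : 0 ≤ (n : ℝ)⁻¹ * ∑ i, (u i - a i) ^ 2 :=
    mul_nonneg (by positivity) (Finset.sum_nonneg fun i _ => sq_nonneg _)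
  have h2 : (n : ℝ)⁻¹ * ∑ i, (u i - a i) ^ 2 = (n : ℝ)⁻¹ * ∑ i, u i ^ 2
      - 2 * ((n : ℝ)⁻¹ * ∑ i, u i * a i) + (n : ℝ)⁻¹ * ∑ i, a i ^ 2 := by
    rw [Finset.mul_sum, Finset.mul_sum, Finset.mul_sum, Finset.mul_sum, Finset.mul_sum,
      ← Finset.sum_sub_distrib, ← Finset.sum_add_distrib]
    exact Finset.sum_congr rfl fun i _ => by ring
  linarith

variable {γ υ h : ℕ+ → ℝ} {d α : ℝ} {T : H →L[ℝ] H} [CompleteSpace H]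

/-- Pathwise bound of the squared error. When the whitened empirical covariance is close to the
identity the threshold is inactive and the estimator is expanded to first order; otherwise the
threshold bounds it by the empirical second moment of the residuals. -/
theorem sq_estimator_sub_le (hw : WeightCondition γ υ) (hT : LinkClass ψ υ d T) (hd : 1 ≤ d)
    (hn : 0 < n) (hα : 0 ≤ α) (hαυ : 2 * d / υ m ≤ α * n) (β : H) (x : Fin n → H) (e u : Fin n → ℝ)
    (hu : ∀ i, u i = ⟪β - synth ψ m (galerkin ψ T m β), x i⟫_ℝ + e i) :
    (estimator ψ h m α (fun i => ⟪β, x i⟫_ℝ + e i) x - linFunctional ψ h β) ^ 2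
      ≤ 4 * ((invSqrt (opMatrix ψ m T) *ᵥ fun j => h j) ⬝ᵥ crossDev ψ m T u x) ^ 2
        + 16 * ((invSqrt (opMatrix ψ m T) *ᵥ fun j => h j)
            ⬝ᵥ (invSqrt (opMatrix ψ m T) *ᵥ fun j => h j))
          * (frobSq (covDev ψ m T x) * (crossDev ψ m T u x ⬝ᵥ crossDev ψ m T u x))
        + 2 * ((fun j : Finset.Iic m => h j) ⬝ᵥ galerkin ψ T m β - linFunctional ψ h β) ^ 2
        + if 1 / 4 < frobSq (covDev ψ m T x) then
            2 * (((invSqrt (opMatrix ψ m T) *ᵥ fun j => h j)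
              ⬝ᵥ (invSqrt (opMatrix ψ m T) *ᵥ fun j => h j))
                * (d * (α * n * ((n : ℝ)⁻¹ * ∑ i, u i ^ 2)))) + linFunctional ψ h β ^ 2
          else 0 := by
  have hA := posDef_opMatrix ψ m hT.symm hT.pos
  set b := galerkin ψ T m β with hb
  set hv : Finset.Iic m → ℝ := fun j => h j with hhv
  have hcov := covDev_eq ψ m hn T x
  have hcross := crossDev_eq ψ m T u x
  set A := opMatrix ψ m T with hAdef
  set R := invSqrt A with hR
  set Ahat := opMatrix ψ m (covHat x) with hAhat
  have hW : Whitening A R Ahat :=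
    ⟨transpose_invSqrt A, invSqrt_mul_mul_invSqrt hA, transpose_opMatrix_covHat ψ m x⟩
  have hlow : ∀ y, υ m / d * (y ⬝ᵥ y) ≤ y ⬝ᵥ (A *ᵥ y) := by
    intro y
    rw [hAdef, ← inner_map_synth]
    have h1 := hT.le_inner ψ hw.υ_summable (by linarith) (synth ψ m y)
    have h2 : υ m * (y ⬝ᵥ y) ≤ weightedNormSq υ (coef ψ (synth ψ m y)) := by
      rw [← norm_synth_sq ψ m, ← real_inner_self_eq_norm_sq,
        ← (hasSum_coef_mul_coef ψ _ _).tsum_eq, ← tsum_mul_left]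
      refine ((hasSum_coef_mul_coef ψ _ _).summable.mul_left _).tsum_le_tsum (fun j => ?_)
        (summable_weighted_of_summable ψ hw.υ_summable _)
      by_cases hj : j ≤ m
      · rw [← sq]
        exact mul_le_mul_of_nonneg_right (hw.υ_anti hj) (sq_nonneg _)
      · rw [coef_synth, dif_neg hj]; simp
    rw [div_mul_eq_mul_div, div_le_iff₀ (by linarith)]
    linarith
  have hup : ∀ y, y ⬝ᵥ (A *ᵥ y) ≤ d * (y ⬝ᵥ y) := by
    intro y
    rw [hAdef, ← inner_map_synth, ← norm_synth_sq ψ m]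
    exact hT.inner_le_norm_sq ψ hw.υ_summable (fun j => (hw.υ_pos j).le) hw.υ_le_one (by linarith) _
  have hυ := hw.υ_pos m
  have hc0 : 0 ≤ (R *ᵥ hv) ⬝ᵥ (R *ᵥ hv) := dotProduct_self_nonneg _
  have hV0 : 0 ≤ (n : ℝ)⁻¹ * ∑ i, u i ^ 2 :=
    mul_nonneg (by positivity) (Finset.sum_nonneg fun i _ => sq_nonneg _)
  have hF0 := frobSq_nonneg (covDev ψ m T x)
  have hWW := dotProduct_self_nonneg (crossDev ψ m T u x)
  -- If the whitened empirical matrix is close to the identity, the threshold is inactive.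
  have hcond : frobSq (covDev ψ m T x) ≤ 1 / 4 →
      IsUnit Ahat ∧ specNorm Ahat⁻¹ ≤ α * n := by
    intro hF
    rw [hcov] at hF
    have hu := hW.isUnit (fun y hy => by simpa using hA.dotProduct_mulVec_pos hy) hF
    refine ⟨hu, (hW.specNorm_inv_le (c := υ m / d) (by positivity) hlow hu hF).trans ?_⟩
    refine le_trans (le_of_eq ?_) hαυ
    field_simp
  by_cases hΩ : IsUnit Ahat ∧ specNorm Ahat⁻¹ ≤ α * n
  · have hdet := (Matrix.isUnit_iff_isUnit_det _).mp hΩ.1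
    set w := crossVec ψ m u x with hw'
    set y := Ahat⁻¹ *ᵥ w with hy
    have hAy : Ahat *ᵥ y = w := by
      rw [hy, Matrix.mulVec_mulVec, Matrix.mul_nonsing_inv _ hdet, Matrix.one_mulVec]
    -- The error is the bias plus the solution of the linear system with right-hand side `w`.
    have hest : estimator ψ h m α (fun i => ⟪β, x i⟫_ℝ + e i) x = hv ⬝ᵥ b + hv ⬝ᵥ y := by
      have hu' : u = fun i => ⟪β - synth ψ m b, x i⟫_ℝ + e i := funext hu
      rw [estimator, if_pos hΩ, coefVec_gHat ψ m x e β b, ← hu', ← hAhat, Matrix.mulVec_add,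
        Matrix.mulVec_mulVec, Matrix.nonsing_inv_mul _ hdet, Matrix.one_mulVec, dotProduct_add]
    have hsplit : (estimator ψ h m α (fun i => ⟪β, x i⟫_ℝ + e i) x - linFunctional ψ h β) ^ 2
        ≤ 2 * (hv ⬝ᵥ y) ^ 2 + 2 * (hv ⬝ᵥ b - linFunctional ψ h β) ^ 2 := by
      rw [hest]
      nlinarith [sq_nonneg (hv ⬝ᵥ y - (hv ⬝ᵥ b - linFunctional ψ h β))]
    split_ifs with hF
    -- Testing the equation for `y` with `y` bounds its empirical energy by that of the residuals.
    · have hS : y ⬝ᵥ (Ahat *ᵥ y) ≤ (n : ℝ)⁻¹ * ∑ i, u i ^ 2 := by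
        rw [hAhat, dotProduct_opMatrix_covHat]
        refine average_sq_le_of_eq u _ ?_
        rw [← dotProduct_opMatrix_covHat, ← hAhat, hAy, hw', dotProduct_crossVec]
      have h1 := hW.sq_dotProduct_le_of_inverse_bound (a := d) (c := α * n) (by linarith)
        (by positivity) hup hΩ.1
        (fun z => by
          rw [hAhat, dotProduct_opMatrix_covHat]
          exact mul_nonneg (by positivity) (Finset.sum_nonneg fun i _ => sq_nonneg _))
        (mulVec_dotProduct_self_le_of_specNorm_le hΩ.2) hv y
      have h2 : (hv ⬝ᵥ y) ^ 2 ≤ ((R *ᵥ hv) ⬝ᵥ (R *ᵥ hv))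
          * (d * (α * n * ((n : ℝ)⁻¹ * ∑ i, u i ^ 2))) := by
        refine h1.trans ?_
        gcongr
      have h3 : 0 ≤ 16 * ((R *ᵥ hv) ⬝ᵥ (R *ᵥ hv))
          * (frobSq (covDev ψ m T x) * (crossDev ψ m T u x ⬝ᵥ crossDev ψ m T u x)) := by positivity
      have h4 := sq_nonneg ((R *ᵥ hv) ⬝ᵥ crossDev ψ m T u x)
      have h5 := sq_nonneg (linFunctional ψ h β)
      linarith
    · push Not at hF
      rw [hcov] at hF
      have h1 := hW.sq_dotProduct_le hF (h := hv) hAy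
      rw [← hcov, ← hcross] at h1
      linarith
  -- The estimator is zero, which by `hcond` forces the deviation to be large.
  · have hF : 1 / 4 < frobSq (covDev ψ m T x) := by
      by_contra hcon
      exact hΩ (hcond (not_lt.mp hcon))
    rw [if_pos hF, estimator, if_neg hΩ, zero_sub, neg_sq]
    have : 0 ≤ ((R *ᵥ hv) ⬝ᵥ (R *ᵥ hv)) * (d * (α * n * ((n : ℝ)⁻¹ * ∑ i, u i ^ 2))) := by
      positivity
    have : 0 ≤ 16 * ((R *ᵥ hv) ⬝ᵥ (R *ᵥ hv))
          * (frobSq (covDev ψ m T x) * (crossDev ψ m T u x ⬝ᵥ crossDev ψ m T u x)) := by positivity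
    have h4 := sq_nonneg ((R *ᵥ hv) ⬝ᵥ crossDev ψ m T u x)
    have h5 := sq_nonneg (hv ⬝ᵥ b - linFunctional ψ h β)
    linarith

end Empirical

/-! ### Moments of products, random matrices and averages over the sample -/

section MomentBounds

variable {Ω : Type*} [MeasurableSpace Ω] {μ : Measure Ω}

theorem pow_le_one_add_pow {s : ℝ} (hs : 0 ≤ s) {a b : ℕ} (hab : a ≤ b) : s ^ a ≤ 1 + s ^ b := by
  rcases le_total s 1 with h | h
  · have := pow_le_one₀ hs h (n := a)
    have := pow_nonneg hs b
    linarith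
  · have := pow_le_pow_right₀ h hab
    linarith

theorem memLp_mul_of_memLp {f g : Ω → ℝ} {q : ℕ} (hq : q ≠ 0)
    (hf : MemLp f ((2 * q : ℕ) : ENNReal) μ) (hg : MemLp g ((2 * q : ℕ) : ENNReal) μ) :
    MemLp (fun ω => f ω * g ω) (q : ENNReal) μ := by
  refine memLp_of_integrable_pow hq (hf.aestronglyMeasurable.mul hg.aestronglyMeasurable) ?_
  have h1 := hf.integrable_norm_pow (by omega)
  have h2 := hg.integrable_norm_pow (by omega)
  refine (h1.add h2).mono' ?_ (.of_forall fun ω => ?_)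
  · have := (hf.aestronglyMeasurable.mul hg.aestronglyMeasurable).norm.pow q
    exact this
  · simp only [Pi.add_apply, Real.norm_eq_abs, abs_pow, abs_abs, abs_mul, mul_pow, pow_mul']
    nlinarith [sq_nonneg (|f ω| ^ q - |g ω| ^ q), sq_nonneg (|f ω| ^ q), sq_nonneg (|g ω| ^ q)]

theorem memLp_mul_of_memLp_four {f g : Ω → ℝ} {k : ℕ} (hk : k ≠ 0)
    (hf : MemLp f ((4 * k : ℕ) : ENNReal) μ) (hg : MemLp g ((4 * k : ℕ) : ENNReal) μ) :
    MemLp (fun ω => f ω * g ω) ((2 * k : ℕ) : ENNReal) μ := by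
  rw [show 4 * k = 2 * (2 * k) by ring] at hf hg
  exact memLp_mul_of_memLp (by omega) hf hg

variable [IsProbabilityMeasure μ] {k : ℕ} {η M : ℝ}

theorem integral_mul_sub_pow_le {Z₁ Z₂ : Ω → ℝ} (hη : 1 ≤ η) (hk : k ≠ 0)
    (h₁ : MemLp Z₁ ((4 * k : ℕ) : ENNReal) μ) (h₂ : MemLp Z₂ ((4 * k : ℕ) : ENNReal) μ)
    (hb₁ : ∫ ω, Z₁ ω ^ (4 * k) ∂μ ≤ η) (hb₂ : ∫ ω, Z₂ ω ^ (4 * k) ∂μ ≤ η) {c : ℝ} (hc : c ^ 2 ≤ 1) :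
    MemLp (fun ω => Z₁ ω * Z₂ ω - c) ((2 * k : ℕ) : ENNReal) μ ∧
      ∫ ω, (Z₁ ω * Z₂ ω - c) ^ (2 * k) ∂μ ≤ 4 ^ k * η := by
  have hL : MemLp (fun ω => Z₁ ω * Z₂ ω - c) ((2 * k : ℕ) : ENNReal) μ :=
    (memLp_mul_of_memLp_four hk h₁ h₂).sub (memLp_const c)
  refine ⟨hL, ?_⟩
  have hi₁ := integrable_pow_of_memLp h₁ le_rfl
  have hi₂ := integrable_pow_of_memLp h₂ le_rfl
  have hc' : c ^ (2 * k) ≤ 1 := by rw [pow_mul]; exact pow_le_one₀ (sq_nonneg c) hc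
  have hpt : ∀ ω, (Z₁ ω * Z₂ ω - c) ^ (2 * k)
      ≤ 2 ^ (2 * k - 1) * ((Z₁ ω ^ (4 * k) + Z₂ ω ^ (4 * k)) / 2 + 1) := by
    intro ω
    have h1 := (even_two_mul k).add_pow_le (a := Z₁ ω * Z₂ ω) (b := -c)
    rw [← sub_eq_add_neg, (even_two_mul k).neg_pow] at h1
    refine h1.trans ?_
    gcongr
    rw [mul_pow, show 4 * k = 2 * k * 2 by ring, pow_mul _ (2 * k), pow_mul _ (2 * k)]
    nlinarith [sq_nonneg (Z₁ ω ^ (2 * k) - Z₂ ω ^ (2 * k))]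
  have hint : Integrable
      (fun ω => 2 ^ (2 * k - 1) * ((Z₁ ω ^ (4 * k) + Z₂ ω ^ (4 * k)) / 2 + 1)) μ :=
    (((hi₁.add hi₂).div_const 2).add (integrable_const 1)).const_mul _
  calc _ ≤ ∫ ω, 2 ^ (2 * k - 1) * ((Z₁ ω ^ (4 * k) + Z₂ ω ^ (4 * k)) / 2 + 1) ∂μ :=
        integral_mono_of_nonneg (.of_forall fun ω => (even_two_mul k).pow_nonneg _) hint
          (.of_forall hpt)
    _ = 2 ^ (2 * k - 1) * ((∫ ω, Z₁ ω ^ (4 * k) ∂μ + ∫ ω, Z₂ ω ^ (4 * k) ∂μ) / 2 + 1) := by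
        rw [integral_const_mul, integral_add, integral_div, integral_add hi₁ hi₂]
        · simp
        · exact (hi₁.add hi₂).div_const 2
        · exact integrable_const 1
    _ ≤ 2 ^ (2 * k - 1) * (2 * η) := by gcongr; linarith
    _ = 4 ^ k * η := by
        rw [← mul_assoc, ← pow_succ, show 2 * k - 1 + 1 = 2 * k by omega, pow_mul]; norm_num

theorem integral_pow_four_le {V : Ω → ℝ} {B : ℝ} (hk : 2 ≤ k)
    (h : MemLp V ((2 * k : ℕ) : ENNReal) μ) (hB : ∫ ω, V ω ^ (2 * k) ∂μ ≤ B) :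
    ∫ ω, V ω ^ 4 ∂μ ≤ 1 + B := by
  have hi := integrable_pow_of_memLp h le_rfl
  calc ∫ ω, V ω ^ 4 ∂μ ≤ ∫ ω, (1 + V ω ^ (2 * k)) ∂μ := by
        refine integral_mono_of_nonneg (.of_forall fun ω => by positivity)
          ((integrable_const 1).add hi) (.of_forall fun ω => ?_)
        have := pow_le_one_add_pow (sq_nonneg (V ω)) hk
        rw [← pow_mul, ← pow_mul] at this
        exact this
    _ = 1 + ∫ ω, V ω ^ (2 * k) ∂μ := by
        rw [integral_add (integrable_const 1) hi]; simp
    _ ≤ _ := by linarith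

/-- Fourth moment of a product, by Young's inequality after dividing `U²` by its scale `M`. -/
theorem integral_mul_pow_four_le {U Z : Ω → ℝ} (hη : 1 ≤ η) (hk : 2 ≤ k) (hM : 0 < M)
    (hU : MemLp U ((4 * k : ℕ) : ENNReal) μ) (hZ : MemLp Z ((4 * k : ℕ) : ENNReal) μ)
    (hbU : ∫ ω, U ω ^ (4 * k) ∂μ ≤ 16 ^ k * η * M ^ (2 * k))
    (hbZ : ∫ ω, Z ω ^ (4 * k) ∂μ ≤ η) :
    ∫ ω, (U ω * Z ω) ^ 4 ∂μ ≤ 2 * 16 ^ k * η * M ^ 2 := by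
  have hi₁ := integrable_pow_of_memLp hU le_rfl
  have hi₂ := integrable_pow_of_memLp hZ le_rfl
  have hpt : ∀ ω, (U ω * Z ω) ^ 4
      ≤ M ^ 2 / 2 * (2 + (U ω ^ (4 * k) / M ^ (2 * k) + Z ω ^ (4 * k))) := by
    intro ω
    have h1 := pow_le_one_add_pow (s := U ω ^ 2 / M) (by positivity) (show 4 ≤ 2 * k by omega)
    have h2 := pow_le_one_add_pow (sq_nonneg (Z ω)) (show 4 ≤ 2 * k by omega)
    rw [div_pow _ _ (2 * k), ← pow_mul, ← mul_assoc, show 2 * 2 * k = 4 * k by ring] at h1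
    rw [← pow_mul _ 2 (2 * k), ← mul_assoc, show 2 * 2 * k = 4 * k by ring] at h2
    have h3 : (U ω * Z ω) ^ 4 = M ^ 2 * ((U ω ^ 2 / M) ^ 2 * (Z ω ^ 2) ^ 2) := by field_simp
    rw [h3, div_mul_eq_mul_div, mul_div_assoc]
    refine mul_le_mul_of_nonneg_left ?_ (by positivity)
    nlinarith [sq_nonneg ((U ω ^ 2 / M) ^ 2 - (Z ω ^ 2) ^ 2)]
  have hint : Integrable (fun ω => M ^ 2 / 2 *
      (2 + (U ω ^ (4 * k) / M ^ (2 * k) + Z ω ^ (4 * k)))) μ :=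
    ((integrable_const 2).add ((hi₁.div_const _).add hi₂)).const_mul _
  have h16 : (1 : ℝ) ≤ 16 ^ k := one_le_pow₀ (by norm_num)
  calc _ ≤ _ := integral_mono_of_nonneg (.of_forall fun ω => by positivity) hint (.of_forall hpt)
    _ = M ^ 2 / 2 * (2 + ((∫ ω, U ω ^ (4 * k) ∂μ) / M ^ (2 * k) + ∫ ω, Z ω ^ (4 * k) ∂μ)) := by
        rw [integral_const_mul, integral_add (integrable_const 2),
          integral_add (hi₁.div_const _) hi₂, integral_div]
        · simp
        · exact (hi₁.div_const _).add hi₂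
    _ ≤ M ^ 2 / 2 * (2 + (16 ^ k * η + η)) := by
        gcongr
        rw [div_le_iff₀ (by positivity)]
        exact hbU
    _ ≤ M ^ 2 / 2 * (4 * 16 ^ k * η) := by
        gcongr
        nlinarith
    _ = _ := by ring

/-- Second moment of a product, by Young's inequality after dividing `U²` and `Z²` by their scales
`M` and `c`, so that the bound is linear in `c`. -/
theorem integral_mul_sq_le {U Z : Ω → ℝ} {c : ℝ} (hη : 1 ≤ η) (hk : 1 ≤ k) (hM : 0 < M) (hc : 0 < c)
    (hU : MemLp U ((4 * k : ℕ) : ENNReal) μ) (hZ : MemLp Z ((4 * k : ℕ) : ENNReal) μ)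
    (hbU : ∫ ω, U ω ^ (4 * k) ∂μ ≤ 16 ^ k * η * M ^ (2 * k))
    (hbZ : ∫ ω, Z ω ^ (4 * k) ∂μ ≤ η * c ^ (2 * k)) :
    ∫ ω, (U ω * Z ω) ^ 2 ∂μ ≤ 2 * 16 ^ k * η * M * c := by
  have hi₁ := integrable_pow_of_memLp hU le_rfl
  have hi₂ := integrable_pow_of_memLp hZ le_rfl
  have hpt : ∀ ω, (U ω * Z ω) ^ 2
      ≤ M * c / 2 * (2 + (U ω ^ (4 * k) / M ^ (2 * k) + Z ω ^ (4 * k) / c ^ (2 * k))) := by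
    intro ω
    have h1 := pow_le_one_add_pow (s := U ω ^ 2 / M) (by positivity) (show 2 ≤ 2 * k by omega)
    have h2 := pow_le_one_add_pow (s := Z ω ^ 2 / c) (by positivity) (show 2 ≤ 2 * k by omega)
    rw [div_pow _ _ (2 * k), ← pow_mul, ← mul_assoc, show 2 * 2 * k = 4 * k by ring] at h1 h2
    have h3 : (U ω * Z ω) ^ 2 = M * c * ((U ω ^ 2 / M) * (Z ω ^ 2 / c)) := by field_simp
    have h4 : (U ω ^ 2 / M) * (Z ω ^ 2 / c)
        ≤ (2 + (U ω ^ (4 * k) / M ^ (2 * k) + Z ω ^ (4 * k) / c ^ (2 * k))) / 2 := by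
      nlinarith [sq_nonneg (U ω ^ 2 / M - Z ω ^ 2 / c)]
    rw [h3]
    refine (mul_le_mul_of_nonneg_left h4 (mul_pos hM hc).le).trans_eq (by ring)
  have hint : Integrable (fun ω => M * c / 2 *
      (2 + (U ω ^ (4 * k) / M ^ (2 * k) + Z ω ^ (4 * k) / c ^ (2 * k)))) μ :=
    ((integrable_const 2).add ((hi₁.div_const _).add (hi₂.div_const _))).const_mul _
  have h16 : (1 : ℝ) ≤ 16 ^ k := one_le_pow₀ (by norm_num)
  calc _ ≤ _ := integral_mono_of_nonneg (.of_forall fun ω => by positivity) hint (.of_forall hpt)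
    _ = M * c / 2 * (2 + ((∫ ω, U ω ^ (4 * k) ∂μ) / M ^ (2 * k)
          + (∫ ω, Z ω ^ (4 * k) ∂μ) / c ^ (2 * k))) := by
        rw [integral_const_mul, integral_add (integrable_const 2),
          integral_add (hi₁.div_const _) (hi₂.div_const _), integral_div, integral_div]
        · simp
        · exact (hi₁.div_const _).add (hi₂.div_const _)
    _ ≤ M * c / 2 * (2 + (16 ^ k * η + η)) := by
        gcongr
        · rw [div_le_iff₀ (by positivity)]
          exact hbU
        · rw [div_le_iff₀ (by positivity)]
          exact hbZ
    _ ≤ M * c / 2 * (4 * 16 ^ k * η) := by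
        gcongr
        nlinarith
    _ = _ := by ring

theorem integral_add_mul_pow_le {Z ε : Ω → ℝ} {τ σ : ℝ} (hη : 0 ≤ η) (hk : k ≠ 0) (hτ : 0 ≤ τ)
    (hZ : MemLp Z ((4 * k : ℕ) : ENNReal) μ) (hε : MemLp ε ((4 * k : ℕ) : ENNReal) μ)
    (hbZ : ∫ ω, Z ω ^ (4 * k) ∂μ ≤ η * τ ^ (2 * k)) (hbε : ∫ ω, ε ω ^ (4 * k) ∂μ ≤ η)
    (hM : τ + σ ^ 2 ≤ M) :
    MemLp (fun ω => Z ω + σ * ε ω) ((4 * k : ℕ) : ENNReal) μ ∧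
      ∫ ω, (Z ω + σ * ε ω) ^ (4 * k) ∂μ ≤ 16 ^ k * η * M ^ (2 * k) := by
  refine ⟨hZ.add (hε.const_mul σ), ?_⟩
  have hi₁ := integrable_pow_of_memLp hZ le_rfl
  have hi₂ := integrable_pow_of_memLp hε le_rfl
  have hev : Even (4 * k) := ⟨2 * k, by ring⟩
  have hint : Integrable (fun ω => 2 ^ (4 * k - 1) *
      (Z ω ^ (4 * k) + (σ ^ 2) ^ (2 * k) * ε ω ^ (4 * k))) μ :=
    (hi₁.add (hi₂.const_mul _)).const_mul _
  have h1 : τ ^ (2 * k) ≤ M ^ (2 * k) := by gcongr; nlinarith [sq_nonneg σ]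
  have h2 : (σ ^ 2) ^ (2 * k) ≤ M ^ (2 * k) := by gcongr; linarith
  calc _ ≤ ∫ ω, 2 ^ (4 * k - 1) * (Z ω ^ (4 * k) + (σ ^ 2) ^ (2 * k) * ε ω ^ (4 * k)) ∂μ := by
        refine integral_mono_of_nonneg (.of_forall fun ω => hev.pow_nonneg _) hint
          (.of_forall fun ω => ?_)
        have := hev.add_pow_le (a := Z ω) (b := σ * ε ω)
        refine this.trans_eq ?_
        simp only [mul_pow, ← pow_mul, ← mul_assoc, Nat.reduceMul]
    _ = 2 ^ (4 * k - 1) * (∫ ω, Z ω ^ (4 * k) ∂μ + (σ ^ 2) ^ (2 * k) * ∫ ω, ε ω ^ (4 * k) ∂μ) := by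
        rw [integral_const_mul, integral_add hi₁ (hi₂.const_mul _), integral_const_mul]
    _ ≤ 2 ^ (4 * k - 1) * (η * M ^ (2 * k) + M ^ (2 * k) * η) := by
        gcongr
        · exact hbZ.trans (by gcongr)
        · exact integral_nonneg fun ω => hev.pow_nonneg _
        · exact (even_two_mul k).pow_nonneg _
    _ = 2 ^ (4 * k - 1) * 2 * η * M ^ (2 * k) := by ring
    _ = _ := by
        rw [← pow_succ, show 4 * k - 1 + 1 = 4 * k by omega, pow_mul]; norm_num

end MomentBounds

section RandomMatrices

variable {Ω : Type*} [MeasurableSpace Ω] {μ : Measure Ω} [IsProbabilityMeasure μ]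
  {ι : Type*} [Fintype ι]

/-- The power mean inequality over the entries of a matrix. -/
theorem frobSq_pow_le (A : Matrix ι ι ℝ) {q : ℕ} (hq : q ≠ 0) :
    frobSq A ^ q ≤ ((Fintype.card ι : ℝ) ^ 2) ^ (q - 1) * ∑ j, ∑ l, A j l ^ (2 * q) := by
  obtain ⟨r, rfl⟩ := Nat.exists_eq_succ_of_ne_zero hq
  have h := pow_sum_le_card_mul_sum_pow (s := (Finset.univ : Finset (ι × ι)))
    (f := fun x => A x.1 x.2 ^ 2) (fun i _ => sq_nonneg _) r
  simp only [Fintype.sum_prod_type, ← pow_mul, Finset.card_univ, Fintype.card_prod] at h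
  unfold frobSq
  refine h.trans_eq ?_
  push_cast
  rw [← sq]

theorem dotProduct_self_sq_le (w : ι → ℝ) : (w ⬝ᵥ w) ^ 2 ≤ Fintype.card ι * ∑ j, w j ^ 4 := by
  have h := pow_sum_le_card_mul_sum_pow (s := (Finset.univ : Finset ι))
    (f := fun x => w x * w x) (fun i _ => mul_self_nonneg _) 1
  simp only [Finset.card_univ, pow_one] at h
  refine h.trans_eq ?_
  congr 1
  exact Finset.sum_congr rfl fun j _ => by ring

theorem integral_frobSq_pow_le {Ξ : Ω → Matrix ι ι ℝ} {q : ℕ} (hq : q ≠ 0) {B : ℝ}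
    (hL : ∀ j l, MemLp (fun ω => Ξ ω j l) ((2 * q : ℕ) : ENNReal) μ)
    (hB : ∀ j l, ∫ ω, Ξ ω j l ^ (2 * q) ∂μ ≤ B) :
    Integrable (fun ω => frobSq (Ξ ω) ^ q) μ ∧
      ∫ ω, frobSq (Ξ ω) ^ q ∂μ ≤ (Fintype.card ι : ℝ) ^ (2 * q) * B := by
  have hi : ∀ j l, Integrable (fun ω => Ξ ω j l ^ (2 * q)) μ :=
    fun j l => integrable_pow_of_memLp (hL j l) le_rfl
  have hi2 : ∀ j, Integrable (fun ω => ∑ l, Ξ ω j l ^ (2 * q)) μ :=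
    fun j => integrable_finsetSum _ fun l _ => hi j l
  have hint : Integrable (fun ω => ((Fintype.card ι : ℝ) ^ 2) ^ (q - 1)
      * ∑ j, ∑ l, Ξ ω j l ^ (2 * q)) μ := (integrable_finsetSum _ fun j _ => hi2 j).const_mul _
  have hpt : ∀ ω, frobSq (Ξ ω) ^ q ≤ ((Fintype.card ι : ℝ) ^ 2) ^ (q - 1)
      * ∑ j, ∑ l, Ξ ω j l ^ (2 * q) := fun ω => frobSq_pow_le _ hq
  have hnn : ∀ ω, 0 ≤ frobSq (Ξ ω) ^ q := fun ω => pow_nonneg (frobSq_nonneg _) _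
  have hmeas : AEStronglyMeasurable (fun ω => frobSq (Ξ ω) ^ q) μ := by
    unfold frobSq
    refine AEStronglyMeasurable.pow (Finset.aestronglyMeasurable_fun_sum _ fun j _ =>
      Finset.aestronglyMeasurable_fun_sum _ fun l _ => ?_) q
    exact (hL j l).aestronglyMeasurable.pow 2
  refine ⟨hint.mono' hmeas (.of_forall fun ω => ?_), ?_⟩
  · rw [Real.norm_eq_abs, abs_of_nonneg (hnn ω)]; exact hpt ω
  · calc _ ≤ _ := integral_mono_of_nonneg (.of_forall hnn) hint (.of_forall hpt)
      _ = ((Fintype.card ι : ℝ) ^ 2) ^ (q - 1) * ∑ j, ∑ l, ∫ ω, Ξ ω j l ^ (2 * q) ∂μ := by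
          rw [integral_const_mul, integral_finsetSum _ fun j _ => hi2 j]
          congr 1
          exact Finset.sum_congr rfl fun j _ => integral_finsetSum _ fun l _ => hi j l
      _ ≤ ((Fintype.card ι : ℝ) ^ 2) ^ (q - 1) * ∑ _j : ι, ∑ _l : ι, B := by
          gcongr with j _ l _
          exact hB j l
      _ = _ := by
          obtain ⟨r, rfl⟩ := Nat.exists_eq_succ_of_ne_zero hq
          simp only [Finset.sum_const, Finset.card_univ, nsmul_eq_mul, Nat.succ_sub_one, pow_mul]
          rw [Nat.succ_eq_add_one, pow_succ]; ring

theorem integral_dotProduct_self_sq_le {W : Ω → ι → ℝ} {B : ℝ}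
    (hL : ∀ j, MemLp (fun ω => W ω j) ((4 : ℕ) : ENNReal) μ)
    (hB : ∀ j, ∫ ω, W ω j ^ 4 ∂μ ≤ B) :
    Integrable (fun ω => (W ω ⬝ᵥ W ω) ^ 2) μ ∧
      ∫ ω, (W ω ⬝ᵥ W ω) ^ 2 ∂μ ≤ (Fintype.card ι : ℝ) ^ 2 * B := by
  have hi : ∀ j, Integrable (fun ω => W ω j ^ 4) μ :=
    fun j => integrable_pow_of_memLp (hL j) le_rfl
  have hint : Integrable (fun ω => (Fintype.card ι : ℝ) * ∑ j, W ω j ^ 4) μ :=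
    (integrable_finsetSum _ fun j _ => hi j).const_mul _
  have hpt : ∀ ω, (W ω ⬝ᵥ W ω) ^ 2 ≤ (Fintype.card ι : ℝ) * ∑ j, W ω j ^ 4 :=
    fun ω => dotProduct_self_sq_le _
  have hmeas : AEStronglyMeasurable (fun ω => (W ω ⬝ᵥ W ω) ^ 2) μ := by
    unfold dotProduct
    refine AEStronglyMeasurable.pow (Finset.aestronglyMeasurable_fun_sum _ fun j _ => ?_) 2
    exact (hL j).aestronglyMeasurable.mul (hL j).aestronglyMeasurable
  refine ⟨hint.mono' hmeas (.of_forall fun ω => ?_), ?_⟩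
  · rw [Real.norm_eq_abs, abs_of_nonneg (sq_nonneg _)]; exact hpt ω
  · calc _ ≤ _ := integral_mono_of_nonneg (.of_forall fun ω => sq_nonneg _) hint (.of_forall hpt)
      _ = (Fintype.card ι : ℝ) * ∑ j, ∫ ω, W ω j ^ 4 ∂μ := by
          rw [integral_const_mul, integral_finsetSum _ fun j _ => hi j]
      _ ≤ (Fintype.card ι : ℝ) * ∑ _j : ι, B := by
          gcongr with j _
          exact hB j
      _ = _ := by simp only [Finset.sum_const, Finset.card_univ, nsmul_eq_mul]; ring

end RandomMatrices

section Sample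

variable {Ω : Type*} [MeasurableSpace Ω] {μ : Measure Ω}
  {H : Type*} [MeasurableSpace H] {X : Ω → H} {ε : Ω → ℝ} {n : ℕ} {Xs : Fin n → Ω → H}
  {εs : Fin n → Ω → ℝ}

theorem IsSample.memLp (hS : IsSample μ X ε Xs εs) {φ : H × ℝ → ℝ} (hφ : Measurable φ) {q : ENNReal}
    (hL : MemLp (fun ω => φ (X ω, ε ω)) q μ) (i : Fin n) :
    MemLp (fun ω => φ (Xs i ω, εs i ω)) q μ :=
  ((hS.ident i).comp hφ).memLp_iff.mpr hL

theorem IsSample.integral_eq (hS : IsSample μ X ε Xs εs) {φ : H × ℝ → ℝ} (hφ : Measurable φ)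
    (i : Fin n) : ∫ ω, φ (Xs i ω, εs i ω) ∂μ = ∫ ω, φ (X ω, ε ω) ∂μ :=
  ((hS.ident i).comp hφ).integral_eq

/-- Even moments of the sample average of a centred function of `(X, ε)`. -/
theorem IsSample.average_moment [IsProbabilityMeasure μ] (hS : IsSample μ X ε Xs εs)
    (hn : 0 < n) {φ : H × ℝ → ℝ} (hφ : Measurable φ) {q : ℕ} (hq : q ≠ 0) {B : ℝ}
    (hL : MemLp (fun ω => φ (X ω, ε ω)) ((2 * q : ℕ) : ENNReal) μ)
    (h0 : ∫ ω, φ (X ω, ε ω) ∂μ = 0) (hB : ∫ ω, φ (X ω, ε ω) ^ (2 * q) ∂μ ≤ B) :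
    MemLp (fun ω => (n : ℝ)⁻¹ * ∑ i, φ (Xs i ω, εs i ω)) ((2 * q : ℕ) : ENNReal) μ ∧
      ∫ ω, ((n : ℝ)⁻¹ * ∑ i, φ (Xs i ω, εs i ω)) ^ (2 * q) ∂μ
        ≤ momentConst (q - 1) * B / n ^ q := by
  refine ⟨(memLp_finsetSum _ fun i _ => hS.memLp hφ hL i).const_mul _, ?_⟩
  obtain ⟨p, rfl⟩ := Nat.exists_eq_succ_of_ne_zero hq
  exact integral_average_pow_le hn (V := fun i ω => φ (Xs i ω, εs i ω))
    (hS.indep.comp (fun _ => φ) fun _ => hφ) p (fun i => hS.memLp hφ hL i)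
    (fun i => (hS.integral_eq hφ i).trans h0)
    (fun i => (hS.integral_eq (φ := fun z => φ z ^ (2 * p + 2)) (hφ.pow_const _) i).trans_le hB)

end Sample

/-! ### Moments of the empirical deviations -/

section SampleMoments

variable {Ω : Type*} [MeasurableSpace Ω] {μ : Measure Ω}
  {H : Type*} [NormedAddCommGroup H] [InnerProductSpace ℝ H]
  [MeasurableSpace H] [BorelSpace H] {ψ : HilbertBasis ℕ+ ℝ H} {X : Ω → H} {ε : Ω → ℝ} {n : ℕ}
  {Xs : Fin n → Ω → H} {εs : Fin n → Ω → ℝ} {k : ℕ} {η d σ M : ℝ} {υ : ℕ+ → ℝ} {f : H} {m : ℕ+}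

theorem measurable_inner_fst (g : H) : Measurable fun z : H × ℝ => ⟪g, z.1⟫_ℝ :=
  (continuous_const.inner continuous_id).measurable.comp measurable_fst

theorem measurable_residual : Measurable fun z : H × ℝ => ⟪f, z.1⟫_ℝ + σ * z.2 :=
  (measurable_inner_fst f).add (measurable_snd.const_mul σ)

theorem card_Iic_pnat (m : ℕ+) : (Fintype.card (Finset.Iic m) : ℝ) = m := by
  have h : Finset.Iic m = Finset.Icc 1 m := by ext j; simp
  rw [Fintype.card_coe, h, PNat.card_Icc]
  simp

variable [CompleteSpace H]

theorem RegressorClass.moment_inner_four (hX : RegressorClass ψ μ (4 * k) η X) (hk : k ≠ 0)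
    (hη : 0 ≤ η) (hT : LinkClass ψ υ d (covOp μ X)) (g : H) :
    MemLp (fun ω => ⟪g, X ω⟫_ℝ) ((4 * k : ℕ) : ENNReal) μ ∧
      ∫ ω, ⟪g, X ω⟫_ℝ ^ (4 * k) ∂μ ≤ η * ⟪covOp μ X g, g⟫_ℝ ^ (2 * k) := by
  have e : 4 * k = 2 * (2 * k) := by ring
  rw [e] at hX ⊢
  exact hX.moment_inner (by omega) hη hT.symm hT.pos g

/-- The whitened coordinates have form value one, so their moments are bounded by `η` alone. -/
theorem RegressorClass.moment_whitened (hX : RegressorClass ψ μ (4 * k) η X) (hk : k ≠ 0)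
    (hη : 0 ≤ η) (hT : LinkClass ψ υ d (covOp μ X)) (j : Finset.Iic m) :
    MemLp (fun ω => ⟪whitened ψ m (covOp μ X) j, X ω⟫_ℝ) ((4 * k : ℕ) : ENNReal) μ ∧
      ∫ ω, ⟪whitened ψ m (covOp μ X) j, X ω⟫_ℝ ^ (4 * k) ∂μ ≤ η := by
  have h := hX.moment_inner_four hk hη hT (whitened ψ m (covOp μ X) j)
  rw [inner_map_whitened ψ m hT.symm hT.pos, Matrix.one_apply_eq, one_pow, mul_one] at h
  exact h

variable [IsProbabilityMeasure μ]

theorem covDev_entry_moment (hX : RegressorClass ψ μ (4 * k) η X) (hk : k ≠ 0) (hη : 1 ≤ η)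
    (hT : LinkClass ψ υ d (covOp μ X)) (j l : Finset.Iic m) :
    MemLp (fun ω => ⟪whitened ψ m (covOp μ X) j, X ω⟫_ℝ * ⟪whitened ψ m (covOp μ X) l, X ω⟫_ℝ
        - (1 : Matrix (Finset.Iic m) (Finset.Iic m) ℝ) j l) ((2 * k : ℕ) : ENNReal) μ ∧
      ∫ ω, (⟪whitened ψ m (covOp μ X) j, X ω⟫_ℝ * ⟪whitened ψ m (covOp μ X) l, X ω⟫_ℝ
        - (1 : Matrix (Finset.Iic m) (Finset.Iic m) ℝ) j l) ^ (2 * k) ∂μ ≤ 4 ^ k * η ∧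
      ∫ ω, (⟪whitened ψ m (covOp μ X) j, X ω⟫_ℝ * ⟪whitened ψ m (covOp μ X) l, X ω⟫_ℝ
        - (1 : Matrix (Finset.Iic m) (Finset.Iic m) ℝ) j l) ∂μ = 0 := by
  have hj := hX.moment_whitened hk (by linarith) hT j
  have hl := hX.moment_whitened hk (by linarith) hT l
  have hc : (1 : Matrix (Finset.Iic m) (Finset.Iic m) ℝ) j l ^ 2 ≤ 1 := by
    rw [Matrix.one_apply]; split_ifs <;> norm_num
  have h := integral_mul_sub_pow_le hη hk hj.1 hl.1 hj.2 hl.2 hc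
  refine ⟨h.1, h.2, ?_⟩
  have hint : Integrable (fun ω => ⟪whitened ψ m (covOp μ X) j, X ω⟫_ℝ
      * ⟪whitened ψ m (covOp μ X) l, X ω⟫_ℝ) μ := by
    have h2 := memLp_mul_of_memLp_four (by omega) hj.1
      hl.1
    exact h2.integrable (by norm_cast; omega)
  rw [integral_sub hint (integrable_const _), ← covOp_inner ψ hX.memLp,
    inner_map_whitened ψ m hT.symm hT.pos]
  simp

/-- The moment of order `m ^ (2 k) / n ^ k` that controls, through Markov's inequality, the event
where the empirical covariance is far from its mean. -/
theorem integral_frobSq_covDev_pow_le (hX : RegressorClass ψ μ (4 * k) η X) (hk : k ≠ 0)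
    (hη : 1 ≤ η) (hT : LinkClass ψ υ d (covOp μ X)) (hS : IsSample μ X ε Xs εs) (hn : 0 < n) :
    Integrable (fun ω => frobSq (covDev ψ m (covOp μ X) fun i => Xs i ω) ^ k) μ ∧
      ∫ ω, frobSq (covDev ψ m (covOp μ X) fun i => Xs i ω) ^ k ∂μ
        ≤ (m : ℝ) ^ (2 * k) * (momentConst (k - 1) * (4 ^ k * η) / n ^ k) := by
  have h := fun j l : Finset.Iic m => hS.average_moment hn
    (φ := fun z => ⟪whitened ψ m (covOp μ X) j, z.1⟫_ℝ * ⟪whitened ψ m (covOp μ X) l, z.1⟫_ℝ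
        - (1 : Matrix (Finset.Iic m) (Finset.Iic m) ℝ) j l)
    (((measurable_inner_fst _).mul (measurable_inner_fst _)).sub_const _) hk
    (covDev_entry_moment hX hk hη hT j l).1 (covDev_entry_moment hX hk hη hT j l).2.2
    (covDev_entry_moment hX hk hη hT j l).2.1
  have := integral_frobSq_pow_le (μ := μ) (Ξ := fun ω => covDev ψ m (covOp μ X) fun i => Xs i ω) hk
    (fun j l => (h j l).1) (fun j l => (h j l).2)
  rwa [card_Iic_pnat] at this

theorem integral_frobSq_covDev_sq_le (hX : RegressorClass ψ μ (4 * k) η X) (hk : 2 ≤ k)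
    (hη : 1 ≤ η) (hT : LinkClass ψ υ d (covOp μ X)) (hS : IsSample μ X ε Xs εs) (hn : 0 < n) :
    Integrable (fun ω => frobSq (covDev ψ m (covOp μ X) fun i => Xs i ω) ^ 2) μ ∧
      ∫ ω, frobSq (covDev ψ m (covOp μ X) fun i => Xs i ω) ^ 2 ∂μ
        ≤ (m : ℝ) ^ 4 * (momentConst 1 * (1 + 4 ^ k * η) / n ^ 2) := by
  have hk0 : k ≠ 0 := by omega
  have h := fun j l : Finset.Iic m => hS.average_moment hn (q := 2)
    (φ := fun z => ⟪whitened ψ m (covOp μ X) j, z.1⟫_ℝ * ⟪whitened ψ m (covOp μ X) l, z.1⟫_ℝ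
        - (1 : Matrix (Finset.Iic m) (Finset.Iic m) ℝ) j l)
    (((measurable_inner_fst _).mul (measurable_inner_fst _)).sub_const _) (by norm_num)
    ((covDev_entry_moment hX hk0 hη hT j l).1.mono_exponent (by norm_cast; omega))
    (covDev_entry_moment hX hk0 hη hT j l).2.2
    (integral_pow_four_le hk (covDev_entry_moment hX hk0 hη hT j l).1
      (covDev_entry_moment hX hk0 hη hT j l).2.1)
  have := integral_frobSq_pow_le (μ := μ) (Ξ := fun ω => covDev ψ m (covOp μ X) fun i => Xs i ω)
    (q := 2) (by norm_num) (fun j l => (h j l).1) (fun j l => (h j l).2)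
  rwa [card_Iic_pnat] at this

theorem residual_moment (hX : RegressorClass ψ μ (4 * k) η X) (hk : k ≠ 0)
    (hη : 1 ≤ η) (hT : LinkClass ψ υ d (covOp μ X)) (hε : ErrorClass μ (4 * k) η ε)
    (hM : ⟪covOp μ X f, f⟫_ℝ + σ ^ 2 ≤ M) :
    MemLp (fun ω => ⟪f, X ω⟫_ℝ + σ * ε ω) ((4 * k : ℕ) : ENNReal) μ ∧
      ∫ ω, (⟪f, X ω⟫_ℝ + σ * ε ω) ^ (4 * k) ∂μ ≤ 16 ^ k * η * M ^ (2 * k) := by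
  have h := hX.moment_inner_four hk (by linarith) hT f
  have hev : Even (4 * k) := ⟨2 * k, by ring⟩
  refine integral_add_mul_pow_le (by linarith) hk (hT.nonneg ψ f) h.1
    (memLp_of_integrable_pow (by omega) hε.memLp.aestronglyMeasurable hε.moment.1) h.2 ?_ hM
  simpa only [hev.pow_abs] using hε.moment.2

/-- If `g` is orthogonal to the approximation error `f` for the form of the covariance operator, the
residual is uncorrelated with `⟨g, X⟩`: the error term is uncorrelated with `X` by assumption. -/
theorem residual_mul_inner_centred (hX : RegressorClass ψ μ (4 * k) η X) (hk : k ≠ 0)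
    (hη : 1 ≤ η) (hT : LinkClass ψ υ d (covOp μ X)) (hε : ErrorClass μ (4 * k) η ε)
    (hεX : ∫ ω, ε ω • X ω ∂μ = 0) {g : H} (hfg : ⟪covOp μ X f, g⟫_ℝ = 0) :
    ∫ ω, (⟪f, X ω⟫_ℝ + σ * ε ω) * ⟪g, X ω⟫_ℝ ∂μ = 0 := by
  have hint : Integrable (fun ω => ⟪f, X ω⟫_ℝ * ⟪g, X ω⟫_ℝ) μ := by
    have h2 := memLp_mul_of_memLp_four (by omega)
      (hX.moment_inner_four hk (by linarith) hT f).1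
      (hX.moment_inner_four hk (by linarith) hT g).1
    exact h2.integrable (by norm_cast; omega)
  have hsm : Integrable (fun ω => ε ω • X ω) μ :=
    memLp_one_iff_integrable.mp (hX.memLp.smul (r := 1) hε.memLp)
  have h2 : Integrable (fun ω => ⟪g, ε ω • X ω⟫_ℝ) μ := hsm.const_inner g
  have h3 : ∀ ω, (⟪f, X ω⟫_ℝ + σ * ε ω) * ⟪g, X ω⟫_ℝ
      = ⟪f, X ω⟫_ℝ * ⟪g, X ω⟫_ℝ + σ * ⟪g, ε ω • X ω⟫_ℝ := by
    intro ω; rw [real_inner_smul_right]; ring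
  simp_rw [h3]
  rw [integral_add hint (h2.const_mul σ), integral_const_mul, ← covOp_inner ψ hX.memLp, hfg,
    integral_inner hsm, hεX]
  simp

theorem integral_crossDev_sq_le (hX : RegressorClass ψ μ (4 * k) η X) (hk : 2 ≤ k)
    (hη : 1 ≤ η) (hT : LinkClass ψ υ d (covOp μ X)) (hε : ErrorClass μ (4 * k) η ε)
    (hεX : ∫ ω, ε ω • X ω ∂μ = 0) (hS : IsSample μ X ε Xs εs) (hn : 0 < n) (hM0 : 0 < M)
    (hM : ⟪covOp μ X f, f⟫_ℝ + σ ^ 2 ≤ M)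
    (hf : ∀ a : Finset.Iic m → ℝ, ⟪covOp μ X f, synth ψ m a⟫_ℝ = 0) :
    Integrable (fun ω => (crossDev ψ m (covOp μ X) (fun i => ⟪f, Xs i ω⟫_ℝ + σ * εs i ω)
        (fun i => Xs i ω) ⬝ᵥ crossDev ψ m (covOp μ X) (fun i => ⟪f, Xs i ω⟫_ℝ + σ * εs i ω)
        (fun i => Xs i ω)) ^ 2) μ ∧
      ∫ ω, (crossDev ψ m (covOp μ X) (fun i => ⟪f, Xs i ω⟫_ℝ + σ * εs i ω)
        (fun i => Xs i ω) ⬝ᵥ crossDev ψ m (covOp μ X) (fun i => ⟪f, Xs i ω⟫_ℝ + σ * εs i ω)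
        (fun i => Xs i ω)) ^ 2 ∂μ
        ≤ (m : ℝ) ^ 2 * (momentConst 1 * (2 * 16 ^ k * η * M ^ 2) / n ^ 2) := by
  have hk0 : k ≠ 0 := by omega
  have hU := residual_moment hX hk0 hη hT hε hM
  have hL : ∀ j : Finset.Iic m, MemLp (fun ω => (⟪f, X ω⟫_ℝ + σ * ε ω)
      * ⟪whitened ψ m (covOp μ X) j, X ω⟫_ℝ) ((2 * 2 : ℕ) : ENNReal) μ := fun j => by
    have := memLp_mul_of_memLp_four (by omega) hU.1
      (hX.moment_whitened hk0 (by linarith) hT j).1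
    exact this.mono_exponent (by norm_cast; omega)
  have h := fun j : Finset.Iic m => hS.average_moment hn (q := 2)
    (φ := fun z => (⟪f, z.1⟫_ℝ + σ * z.2) * ⟪whitened ψ m (covOp μ X) j, z.1⟫_ℝ)
    (measurable_residual.mul (measurable_inner_fst _)) (by norm_num) (hL j)
    (residual_mul_inner_centred hX hk0 hη hT hε hεX (hf _))
    (integral_mul_pow_four_le hη hk hM0 hU.1 (hX.moment_whitened hk0 (by linarith) hT j).1 hU.2
      (hX.moment_whitened hk0 (by linarith) hT j).2)
  have := integral_dotProduct_self_sq_le (μ := μ)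
    (W := fun ω => crossDev ψ m (covOp μ X) (fun i => ⟪f, Xs i ω⟫_ℝ + σ * εs i ω) fun i => Xs i ω)
    (fun j => (h j).1) (fun j => (h j).2)
  rwa [card_Iic_pnat] at this

theorem integral_dotProduct_crossDev_sq_le (hX : RegressorClass ψ μ (4 * k) η X) (hk : 1 ≤ k)
    (hη : 1 ≤ η) (hT : LinkClass ψ υ d (covOp μ X)) (hε : ErrorClass μ (4 * k) η ε)
    (hεX : ∫ ω, ε ω • X ω ∂μ = 0) (hS : IsSample μ X ε Xs εs) (hn : 0 < n) (hM0 : 0 < M)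
    (hM : ⟪covOp μ X f, f⟫_ℝ + σ ^ 2 ≤ M)
    (hf : ∀ a : Finset.Iic m → ℝ, ⟪covOp μ X f, synth ψ m a⟫_ℝ = 0) (v : Finset.Iic m → ℝ) :
    Integrable (fun ω => (v ⬝ᵥ crossDev ψ m (covOp μ X) (fun i => ⟪f, Xs i ω⟫_ℝ + σ * εs i ω)
        (fun i => Xs i ω)) ^ 2) μ ∧
      ∫ ω, (v ⬝ᵥ crossDev ψ m (covOp μ X) (fun i => ⟪f, Xs i ω⟫_ℝ + σ * εs i ω)
        (fun i => Xs i ω)) ^ 2 ∂μ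
        ≤ momentConst 0 * (2 * 16 ^ k * η * M * (v ⬝ᵥ v)) / n := by
  have hk0 : k ≠ 0 := by omega
  rcases (dotProduct_self_nonneg v).eq_or_lt with h0 | hc
  · have hv : v = 0 := dotProduct_self_eq_zero.mp h0.symm
    simp [hv]
  have hA := posDef_opMatrix ψ m hT.symm hT.pos
  set R := invSqrt (opMatrix ψ m (covOp μ X)) with hR
  have hW : Whitening (opMatrix ψ m (covOp μ X)) R (opMatrix ψ m (covOp μ X)) :=
    ⟨transpose_invSqrt _, invSqrt_mul_mul_invSqrt hA, by
      rw [← Matrix.conjTranspose_eq_transpose_of_trivial, hA.isHermitian.eq]⟩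
  set g := synth ψ m (R *ᵥ v) with hg
  have hgg : ⟪covOp μ X g, g⟫_ℝ = v ⬝ᵥ v := by
    rw [hg, inner_map_synth, hW.dotProduct_whiten]
  have hU := residual_moment hX hk0 hη hT hε hM
  have hZ := hX.moment_inner_four hk0 (by linarith) hT g
  rw [hgg] at hZ
  have hL : MemLp (fun ω => (⟪f, X ω⟫_ℝ + σ * ε ω) * ⟪g, X ω⟫_ℝ) ((2 * 1 : ℕ) : ENNReal) μ := by
    have := memLp_mul_of_memLp_four (by omega) hU.1
      hZ.1
    exact this.mono_exponent (by norm_cast; omega)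
  have h := hS.average_moment hn (q := 1)
    (φ := fun z => (⟪f, z.1⟫_ℝ + σ * z.2) * ⟪g, z.1⟫_ℝ)
    (measurable_residual.mul (measurable_inner_fst _)) (by norm_num) hL
    (residual_mul_inner_centred hX hk0 hη hT hε hεX (hf _))
    (integral_mul_sq_le hη hk hM0 hc hU.1 hZ.1 hU.2 hZ.2)
  have e : ∀ ω, v ⬝ᵥ crossDev ψ m (covOp μ X) (fun i => ⟪f, Xs i ω⟫_ℝ + σ * εs i ω)
      (fun i => Xs i ω) = (n : ℝ)⁻¹ * ∑ i, (⟪f, Xs i ω⟫_ℝ + σ * εs i ω) * ⟪g, Xs i ω⟫_ℝ := by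
    intro ω
    rw [crossDev_eq, ← mulVec_dotProduct_of_transpose_eq (transpose_invSqrt _),
      dotProduct_crossVec]
  simp_rw [e]
  refine ⟨integrable_pow_of_memLp h.1 le_rfl, ?_⟩
  have := h.2
  rwa [pow_one] at this

theorem integral_average_sq_pow_le (hX : RegressorClass ψ μ (4 * k) η X) (hk : k ≠ 0)
    (hη : 1 ≤ η) (hT : LinkClass ψ υ d (covOp μ X)) (hε : ErrorClass μ (4 * k) η ε)
    (hS : IsSample μ X ε Xs εs) (hn : 0 < n) (hM : ⟪covOp μ X f, f⟫_ℝ + σ ^ 2 ≤ M) :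
    Integrable (fun ω => ((n : ℝ)⁻¹ * ∑ i, (⟪f, Xs i ω⟫_ℝ + σ * εs i ω) ^ 2) ^ (2 * k)) μ ∧
      ∫ ω, ((n : ℝ)⁻¹ * ∑ i, (⟪f, Xs i ω⟫_ℝ + σ * εs i ω) ^ 2) ^ (2 * k) ∂μ
        ≤ 16 ^ k * η * M ^ (2 * k) := by
  have hn' : (0 : ℝ) < n := by exact_mod_cast hn
  have hU := residual_moment hX hk hη hT hε hM
  have hUs := fun i => hS.memLp (measurable_residual (f := f) (σ := σ)) hU.1 i
  have hi := fun i => integrable_pow_of_memLp (hUs i) le_rfl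
  have hiV : ∀ i, ∫ ω, (⟪f, Xs i ω⟫_ℝ + σ * εs i ω) ^ (4 * k) ∂μ ≤ 16 ^ k * η * M ^ (2 * k) :=
    fun i => (hS.integral_eq (φ := fun z => (⟪f, z.1⟫_ℝ + σ * z.2) ^ (4 * k))
      (measurable_residual.pow_const _) i).trans_le hU.2
  have hint : Integrable (fun ω => (n : ℝ)⁻¹ * ∑ i, (⟪f, Xs i ω⟫_ℝ + σ * εs i ω) ^ (4 * k)) μ :=
    (integrable_finsetSum _ fun i _ => hi i).const_mul _
  have hpt : ∀ ω, ((n : ℝ)⁻¹ * ∑ i, (⟪f, Xs i ω⟫_ℝ + σ * εs i ω) ^ 2) ^ (2 * k)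
      ≤ (n : ℝ)⁻¹ * ∑ i, (⟪f, Xs i ω⟫_ℝ + σ * εs i ω) ^ (4 * k) := by
    intro ω
    have := Real.pow_arith_mean_le_arith_mean_pow Finset.univ (fun _ : Fin n => (n : ℝ)⁻¹)
      (fun i => (⟪f, Xs i ω⟫_ℝ + σ * εs i ω) ^ 2) (fun _ _ => by positivity)
      (by simp [hn'.ne']) (fun _ _ => sq_nonneg _) (2 * k)
    simpa only [← Finset.mul_sum, ← pow_mul, ← mul_assoc, Nat.reduceMul] using this
  have hnn : ∀ ω, 0 ≤ ((n : ℝ)⁻¹ * ∑ i, (⟪f, Xs i ω⟫_ℝ + σ * εs i ω) ^ 2) ^ (2 * k) :=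
    fun ω => (even_two_mul k).pow_nonneg _
  have hmeas : AEStronglyMeasurable
      (fun ω => ((n : ℝ)⁻¹ * ∑ i, (⟪f, Xs i ω⟫_ℝ + σ * εs i ω) ^ 2) ^ (2 * k)) μ := by
    refine AEStronglyMeasurable.pow (AEStronglyMeasurable.const_mul
      (Finset.aestronglyMeasurable_fun_sum _ fun i _ => ?_) _) _
    exact (hUs i).aestronglyMeasurable.pow 2
  refine ⟨hint.mono' hmeas (.of_forall fun ω => ?_), ?_⟩
  · rw [Real.norm_eq_abs, abs_of_nonneg (hnn ω)]; exact hpt ω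
  · calc _ ≤ _ := integral_mono_of_nonneg (.of_forall hnn) hint (.of_forall hpt)
      _ = (n : ℝ)⁻¹ * ∑ i, ∫ ω, (⟪f, Xs i ω⟫_ℝ + σ * εs i ω) ^ (4 * k) ∂μ := by
          rw [integral_const_mul, integral_finsetSum _ fun i _ => hi i]
      _ ≤ (n : ℝ)⁻¹ * ∑ _i : Fin n, 16 ^ k * η * M ^ (2 * k) := by
          gcongr with i _
          exact hiV i
      _ = _ := by
          simp only [Finset.sum_const, Finset.card_univ, Fintype.card_fin, nsmul_eq_mul]
          field_simp

end SampleMoments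

/-! ### Rates under the growth condition on the dimension -/

section Rates

/-- The two consequences of the growth condition that the rate needs. The second one holds because
`(2 k - 5) L ≥ 4 k` for `k ≥ 3`. -/
theorem dimension_pow_le {k m : ℕ} {N : ℝ} (hk : 3 ≤ k) (hm : 1 ≤ m) (h : (m : ℝ) ^ expL k ≤ N) :
    (m : ℝ) ^ 3 ≤ N ∧ (m : ℝ) ^ (4 * k) ≤ N ^ (2 * k - 5) := by
  have hm' : (1 : ℝ) ≤ m := by exact_mod_cast hm
  have hk' : (3 : ℝ) ≤ k := by exact_mod_cast hk
  constructor
  · refine le_trans ?_ h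
    rw [← Real.rpow_natCast]
    exact Real.rpow_le_rpow_of_exponent_le hm' (le_max_right _ _)
  · have h1 : ((m : ℝ) ^ expL k) ^ (2 * k - 5) ≤ N ^ (2 * k - 5) := by gcongr
    refine le_trans ?_ h1
    rw [← Real.rpow_natCast, ← Real.rpow_natCast, ← Real.rpow_mul (by positivity)]
    refine Real.rpow_le_rpow_of_exponent_le hm' ?_
    have h2 : (2 * (k : ℝ) + 6) / (k - 2) ≤ expL k := by
      refine le_trans (le_of_eq ?_) (le_max_left _ _)
      have : (k : ℝ) - 2 ≠ 0 := by linarith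
      have : (k : ℝ) ≠ 0 := by linarith
      field_simp
    have h3 : (((2 * k - 5 : ℕ) : ℕ) : ℝ) = 2 * k - 5 := by
      rw [Nat.cast_sub (by omega)]; push_cast; ring
    rw [h3]
    push_cast
    refine le_trans ?_ (mul_le_mul_of_nonneg_right h2 (by linarith))
    rw [div_mul_eq_mul_div, le_div_iff₀ (by linarith)]
    nlinarith

/-- The truncation level `√n` and the factor `n ^ 2` are absorbed by the moment `m ^ (2 k) / n ^ k`
of the exceptional event. -/
theorem dimension_pow_mul_sqrt_le {k m : ℕ} {n E : ℝ} (hk : 3 ≤ k) (hm : 1 ≤ m) (hn : 1 ≤ n)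
    (hE : 1 ≤ E) (h : (m : ℝ) ^ expL k ≤ E * n) :
    (m : ℝ) ^ (2 * k) * √n * n ^ 2 ≤ E ^ (k - 2) * n ^ k := by
  have h1 := (dimension_pow_le hk hm h).2
  refine abs_le_of_sq_le_sq' ?_ (by positivity) |>.2
  have h2 : ((m : ℝ) ^ (2 * k) * √n * n ^ 2) ^ 2 = (m : ℝ) ^ (4 * k) * n ^ 5 := by
    rw [mul_pow, mul_pow, Real.sq_sqrt (by linarith), ← pow_mul]
    ring
  rw [h2]
  calc (m : ℝ) ^ (4 * k) * n ^ 5 ≤ (E * n) ^ (2 * k - 5) * n ^ 5 := by gcongr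
    _ = E ^ (2 * k - 5) * n ^ (2 * k) := by
      rw [mul_pow, mul_assoc, ← pow_add]; congr 2; omega
    _ ≤ E ^ (2 * k - 4) * n ^ (2 * k) := by gcongr; norm_num
    _ = _ := by
      rw [mul_pow, ← pow_mul, ← pow_mul]
      congr 2 <;> omega

/-- Markov's inequality in pointwise form, on the event `1 / 4 < F`: `x` is either at most `s`, and
then it is charged to the power of `4 F ≥ 1`, or it is dominated by its own high power. -/
theorem le_add_of_one_lt {x F s : ℝ} {k : ℕ} (hx : 0 ≤ x) (hs : 0 < s) (hF : 1 / 4 < F)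
    (hk : k ≠ 0) : x ≤ x ^ (2 * k) / s ^ (2 * k - 1) + s * (4 * F) ^ k := by
  have h1 : 1 ≤ (4 * F) ^ k := one_le_pow₀ (by linarith)
  have h2 : 0 ≤ x ^ (2 * k) / s ^ (2 * k - 1) := by positivity
  rcases le_total x s with h | h
  · nlinarith
  · have h3 : x ≤ x ^ (2 * k) / s ^ (2 * k - 1) := by
      rw [le_div_iff₀ (by positivity)]
      calc x * s ^ (2 * k - 1) ≤ x * x ^ (2 * k - 1) := by gcongr
        _ = x ^ (2 * k) := by rw [← pow_succ']; congr 1; omega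
    have : 0 ≤ s * (4 * F) ^ k := by positivity
    linarith

/-- The constant of the risk bound. -/
noncomputable def riskConst (k : ℕ) : ℝ :=
  8 * 16 ^ k * momentConst 0 + 32 * 16 ^ k * momentConst 1 + 8 + 16 * 16 ^ k
    + 18 * 16 ^ k * momentConst (k - 1)

theorem riskConst_pos (k : ℕ) : 0 < riskConst k := by
  have h0 := momentConst_pos 0
  have h1 := momentConst_pos 1
  have h2 := momentConst_pos (k - 1)
  unfold riskConst
  positivity

set_option maxHeartbeats 1000000 in
/-- Every contribution to the risk is a multiple of `η M d⁵ (Q / κ) δ`. Here `s` stands for `√n`,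
`c` for the squared norm of the whitened representer, `b` for the squared bias, `l` for the squared
value of the functional, `E` for `D / κ` and `Q` for `E ^ (k - 2)`. -/
theorem risk_terms_le {k : ℕ} {n s m η M c d α κ δ Q E ρ b l : ℝ} (hn : 1 ≤ n) (hs : 1 ≤ s)
    (hsn : n ^ 2 ≤ s ^ (2 * k - 1)) (hm : 0 < m) (hη : 1 ≤ η) (hρ : 0 < ρ) (hρM : ρ ≤ M)
    (hc0 : 0 ≤ c) (hc : c ≤ d * n * δ) (hd : 1 ≤ d) (hα0 : 0 ≤ α) (hα : α ≤ 8 * d ^ 3 / κ)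
    (hκ0 : 0 < κ) (hκ1 : κ ≤ 1) (hδ : 0 ≤ δ) (hm3 : m ^ 3 ≤ E * n) (hEQ : E ≤ Q) (hQ : 1 ≤ Q)
    (hmk : m ^ (2 * k) * s * n ^ 2 ≤ Q * n ^ k) (hb : b ≤ 4 * ρ * d ^ 2 * δ)
    (hl : l ≤ 2 * ρ * n * δ) :
    4 * (momentConst 0 * (2 * 16 ^ k * η * M * c) / n)
      + 8 * c * (M / m) * (m ^ 4 * (momentConst 1 * (1 + 4 ^ k * η) / n ^ 2))
      + 8 * c * (m / M) * (m ^ 2 * (momentConst 1 * (2 * 16 ^ k * η * M ^ 2) / n ^ 2))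
      + 2 * c * d * α * n * M / (M ^ (2 * k) * s ^ (2 * k - 1)) * (16 ^ k * η * M ^ (2 * k))
      + (2 * c * d * α * n * M * s * 4 ^ k + l * 4 ^ k)
        * (m ^ (2 * k) * (momentConst (k - 1) * (4 ^ k * η) / n ^ k))
      + 2 * b ≤ riskConst k * (η * M * d ^ 5 * (Q / κ) * δ) := by
  have hK0 := momentConst_pos 0
  have hK1 := momentConst_pos 1
  have hK := momentConst_pos (k - 1)
  unfold riskConst
  generalize momentConst 0 = K₀ at *
  generalize momentConst 1 = K₁ at *
  generalize momentConst (k - 1) = K at *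
  have hM : 0 < M := by linarith
  have hn0 : 0 < n := by linarith
  have hs0 : 0 < s := by linarith
  have hd0 : 0 < d := by linarith
  have hη0 : 0 < η := by linarith
  have hQκ : Q ≤ Q / κ := by rw [le_div_iff₀ hκ0]; nlinarith
  have hQκ1 : 1 ≤ Q / κ := hQ.trans hQκ
  have hQ0 : 0 < Q := by linarith
  have h16 : (1 : ℝ) ≤ 16 ^ k := one_le_pow₀ (by norm_num)
  have h416 : (4 : ℝ) ^ k ≤ 16 ^ k := by gcongr; norm_num
  have h44 : (4 : ℝ) ^ k * 4 ^ k = 16 ^ k := by rw [← mul_pow]; norm_num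
  have hd1 : d ≤ d ^ 5 := le_self_pow₀ hd (by norm_num)
  have hd2 : d ^ 2 ≤ d ^ 5 := pow_le_pow_right₀ hd (by norm_num)
  set Θ := η * M * d ^ 5 * (Q / κ) * δ with hΘ
  have hΘ0 : 0 ≤ Θ := by positivity
  have base1 : η * M * (d * δ) * Q ≤ Θ := by
    calc η * M * (d * δ) * Q = η * M * d * Q * δ := by ring
      _ ≤ η * M * d ^ 5 * (Q / κ) * δ := by gcongr
  have base0 : η * M * (d * δ) ≤ Θ := by
    refine le_trans (le_mul_of_one_le_right (by positivity) hQ) base1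
  have base5 : η * M * (d * δ) * (d * α) * Q ≤ 8 * Θ := by
    calc η * M * (d * δ) * (d * α) * Q ≤ η * M * (d * δ) * (d * (8 * d ^ 3 / κ)) * Q := by gcongr
      _ = 8 * Θ := by rw [hΘ]; ring
  have hcn : c / n ≤ d * δ := by rw [div_le_iff₀ hn0]; linarith
  have hcn0 : 0 ≤ c / n := by positivity
  have T1 : 4 * (K₀ * (2 * 16 ^ k * η * M * c) / n) ≤ 8 * 16 ^ k * K₀ * Θ := by
    calc 4 * (K₀ * (2 * 16 ^ k * η * M * c) / n) = 8 * 16 ^ k * K₀ * (η * M * (c / n)) := by ring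
      _ ≤ 8 * 16 ^ k * K₀ * (η * M * (d * δ)) := by gcongr
      _ ≤ _ := by gcongr
  have hm3n : m ^ 3 / n ≤ Q := by rw [div_le_iff₀ hn0]; nlinarith
  have hmid : η * M * (c / n) * (m ^ 3 / n) ≤ Θ := by
    refine le_trans ?_ base1
    gcongr
  have T2 : 8 * c * (M / m) * (m ^ 4 * (K₁ * (1 + 4 ^ k * η) / n ^ 2)) ≤ 16 * 16 ^ k * K₁ * Θ := by
    have h1 : 1 + 4 ^ k * η ≤ 2 * 16 ^ k * η := by nlinarith
    calc 8 * c * (M / m) * (m ^ 4 * (K₁ * (1 + 4 ^ k * η) / n ^ 2))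
        ≤ 8 * c * (M / m) * (m ^ 4 * (K₁ * (2 * 16 ^ k * η) / n ^ 2)) := by gcongr
      _ = 16 * 16 ^ k * K₁ * (η * M * (c / n) * (m ^ 3 / n)) := by field_simp; ring
      _ ≤ _ := by gcongr
  have T3 : 8 * c * (m / M) * (m ^ 2 * (K₁ * (2 * 16 ^ k * η * M ^ 2) / n ^ 2))
      ≤ 16 * 16 ^ k * K₁ * Θ := by
    calc 8 * c * (m / M) * (m ^ 2 * (K₁ * (2 * 16 ^ k * η * M ^ 2) / n ^ 2))
      _ = 16 * 16 ^ k * K₁ * (η * M * (c / n) * (m ^ 3 / n)) := by field_simp; ring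
      _ ≤ _ := by gcongr
  have T4 : 2 * c * d * α * n * M / (M ^ (2 * k) * s ^ (2 * k - 1)) * (16 ^ k * η * M ^ (2 * k))
      ≤ 16 * 16 ^ k * Θ := by
    calc 2 * c * d * α * n * M / (M ^ (2 * k) * s ^ (2 * k - 1)) * (16 ^ k * η * M ^ (2 * k))
        = 2 * 16 ^ k * (η * M * c * (d * α) * n) / s ^ (2 * k - 1) := by
          field_simp
      _ ≤ 2 * 16 ^ k * (η * M * c * (d * α) * n) / n ^ 2 := by gcongr
      _ = 2 * 16 ^ k * (η * M * (c / n) * (d * α)) := by field_simp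
      _ ≤ 2 * 16 ^ k * (η * M * (d * δ) * (d * α) * Q) := by
          refine mul_le_mul_of_nonneg_left ?_ (by positivity)
          refine le_trans ?_ (le_mul_of_one_le_right (by positivity) hQ)
          gcongr
      _ ≤ 2 * 16 ^ k * (8 * Θ) := by gcongr
      _ = _ := by ring
  have hP1 : m ^ (2 * k) * s / n ^ k ≤ Q / n ^ 2 := by
    rw [div_le_div_iff₀ (by positivity) (by positivity)]; exact hmk
  have hP0 : m ^ (2 * k) / n ^ k ≤ Q / n ^ 2 := by
    refine le_trans ?_ hP1
    gcongr
    exact le_mul_of_one_le_right (by positivity) hs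
  have T5 : (2 * c * d * α * n * M * s * 4 ^ k + l * 4 ^ k)
        * (m ^ (2 * k) * (K * (4 ^ k * η) / n ^ k)) ≤ 18 * 16 ^ k * K * Θ := by
    have h1 : 2 * c * d * α * n * M * s * 4 ^ k * (m ^ (2 * k) * (K * (4 ^ k * η) / n ^ k))
        ≤ 16 * 16 ^ k * K * Θ := by
      calc _ = 2 * 16 ^ k * K * (η * M * c * (d * α) * n * (m ^ (2 * k) * s / n ^ k)) := by
            rw [← h44]; ring
        _ ≤ 2 * 16 ^ k * K * (η * M * c * (d * α) * n * (Q / n ^ 2)) := by gcongr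
        _ = 2 * 16 ^ k * K * (η * M * (c / n) * (d * α) * Q) := by field_simp
        _ ≤ 2 * 16 ^ k * K * (η * M * (d * δ) * (d * α) * Q) := by gcongr
        _ ≤ 2 * 16 ^ k * K * (8 * Θ) := by gcongr
        _ = _ := by ring
    have h2 : l * 4 ^ k * (m ^ (2 * k) * (K * (4 ^ k * η) / n ^ k)) ≤ 2 * 16 ^ k * K * Θ := by
      calc _ = 16 ^ k * K * η * l * (m ^ (2 * k) / n ^ k) := by rw [← h44]; ring
        _ ≤ 16 ^ k * K * η * (2 * ρ * n * δ) * (m ^ (2 * k) / n ^ k) := by gcongr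
        _ ≤ 16 ^ k * K * η * (2 * ρ * n * δ) * (Q / n ^ 2) := by gcongr
        _ = 2 * 16 ^ k * K * (η * ρ * δ * Q) / n := by field_simp
        _ ≤ 2 * 16 ^ k * K * (η * ρ * δ * Q) := by
            exact div_le_self (by positivity) hn
        _ ≤ 2 * 16 ^ k * K * Θ := by
            gcongr
            refine le_trans ?_ base1
            gcongr
            exact le_mul_of_one_le_left hδ hd
    rw [add_mul]
    exact (add_le_add h1 h2).trans_eq (by ring)
  have T0 : 2 * b ≤ 8 * Θ := by
    calc 2 * b ≤ 8 * (1 * ρ * d ^ 2 * 1 * δ) := by linarith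
      _ ≤ 8 * (η * M * d ^ 5 * (Q / κ) * δ) := by gcongr
  calc _ ≤ 8 * 16 ^ k * K₀ * Θ + 16 * 16 ^ k * K₁ * Θ + 16 * 16 ^ k * K₁ * Θ + 16 * 16 ^ k * Θ
        + 18 * 16 ^ k * K * Θ + 8 * Θ := by gcongr
    _ = _ := by ring

end Rates

section Weights

variable {γ υ : ℕ+ → ℝ} {kstar : ℕ+ → ℕ+}

theorem aStar_pos (n : ℕ+) : 0 < aStar γ υ kstar n :=
  lt_max_of_lt_right (by have : (0 : ℝ) < n := by exact_mod_cast n.pos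
                         positivity)

/-- At the balancing dimension `υ_m / γ_m ≥ κ α* ≥ κ / n`. -/
theorem kappa_div_le (hw : WeightCondition γ υ) (hκ : 0 ≤ kappa γ υ kstar) (n : ℕ+) :
    kappa γ υ kstar / n ≤ υ (kstar n) / γ (kstar n) := by
  have ha := aStar_pos (γ := γ) (υ := υ) (kstar := kstar) n
  have hn : (0 : ℝ) < n := by exact_mod_cast n.pos
  have h1 : kappa γ υ kstar
      ≤ (aStar γ υ kstar n)⁻¹ * min (υ (kstar n) / γ (kstar n)) (n : ℝ)⁻¹ := by
    -- The infimum is over positive numbers, hence bounded below.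
    refine ciInf_le ⟨0, ?_⟩ n
    rintro _ ⟨i, rfl⟩
    have := aStar_pos (γ := γ) (υ := υ) (kstar := kstar) i
    have h2 := hw.υ_pos (kstar i)
    have h3 := hw.γ_pos (kstar i)
    positivity
  have h2 : kappa γ υ kstar * aStar γ υ kstar n ≤ υ (kstar n) / γ (kstar n) := by
    refine le_trans (mul_le_mul_of_nonneg_right h1 ha.le) ?_
    rw [mul_comm _ (aStar γ υ kstar n), ← mul_assoc, mul_inv_cancel₀ ha.ne', one_mul]
    exact min_le_left _ _
  refine le_trans ?_ h2
  rw [div_eq_mul_inv]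
  gcongr
  exact le_max_right _ _

end Weights

/-! ### The risk for a fixed slope -/

section Risk

theorem lintegral_ofReal_le_of_le {Ω : Type*} [MeasurableSpace Ω] {μ : Measure Ω}
    {Z G : Ω → ℝ} {B : ℝ} (hG : Integrable G μ) (hZ : ∀ ω, 0 ≤ Z ω) (hZG : ∀ ω, Z ω ≤ G ω)
    (hB : ∫ ω, G ω ∂μ ≤ B) : ∫⁻ ω, ENNReal.ofReal (Z ω) ∂μ ≤ ENNReal.ofReal B := by
  calc _ ≤ ∫⁻ ω, ENNReal.ofReal (G ω) ∂μ := by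
        gcongr with ω; exact hZG ω
    _ = ENNReal.ofReal (∫ ω, G ω ∂μ) :=
        (ofReal_integral_eq_lintegral_ofReal hG
          (.of_forall fun ω => (hZ ω).trans (hZG ω))).symm
    _ ≤ _ := ENNReal.ofReal_le_ofReal hB

variable {Ω : Type*} [MeasurableSpace Ω] {μ : Measure Ω} [IsProbabilityMeasure μ]
  {H : Type*} [NormedAddCommGroup H] [InnerProductSpace ℝ H] [CompleteSpace H]
  [MeasurableSpace H] [BorelSpace H] {ψ : HilbertBasis ℕ+ ℝ H} {X : Ω → H} {ε : Ω → ℝ} {n : ℕ}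
  {Xs : Fin n → Ω → H} {εs : Fin n → Ω → ℝ} {k : ℕ} {η d σ M α : ℝ} {γ υ h : ℕ+ → ℝ} {m : ℕ+}
  {β : H}

/-- The risk of the thresholded estimator in terms of the squared norm `c` of the whitened
representer, the bias and the value of the functional. The free parameters of the two Young
inequalities are `M / m` for the second order term and `√n` for the truncation term. -/
theorem lintegral_sq_error_le (hw : WeightCondition γ υ) (hX : RegressorClass ψ μ (4 * k) η X)
    (hk : 2 ≤ k) (hη : 1 ≤ η) (hT : LinkClass ψ υ d (covOp μ X)) (hd : 1 ≤ d)
    (hε : ErrorClass μ (4 * k) η ε) (hεX : ∫ ω, ε ω • X ω ∂μ = 0) (hS : IsSample μ X ε Xs εs)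
    (hn : 0 < n) (hα : 0 ≤ α) (hαυ : 2 * d / υ m ≤ α * n) (hM0 : 0 < M)
    (hM : ⟪covOp μ X β, β⟫_ℝ + σ ^ 2 ≤ M) {c : ℝ}
    (hc : c = (invSqrt (opMatrix ψ m (covOp μ X)) *ᵥ fun j => h j)
      ⬝ᵥ (invSqrt (opMatrix ψ m (covOp μ X)) *ᵥ fun j => h j)) {s : ℝ} (hs : 0 < s) :
    ∫⁻ ω, ENNReal.ofReal ((estimator ψ h m α (fun i => ⟪β, Xs i ω⟫_ℝ + σ * εs i ω)
        (fun i => Xs i ω) - linFunctional ψ h β) ^ 2) ∂μ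
      ≤ ENNReal.ofReal (4 * (momentConst 0 * (2 * 16 ^ k * η * M * c) / n)
      + 8 * c * (M / m) * (m ^ 4 * (momentConst 1 * (1 + 4 ^ k * η) / n ^ 2))
      + 8 * c * (m / M) * (m ^ 2 * (momentConst 1 * (2 * 16 ^ k * η * M ^ 2) / n ^ 2))
      + 2 * c * d * α * n * M / (M ^ (2 * k) * s ^ (2 * k - 1)) * (16 ^ k * η * M ^ (2 * k))
      + (2 * c * d * α * n * M * s * 4 ^ k + linFunctional ψ h β ^ 2 * 4 ^ k)
        * (m ^ (2 * k) * (momentConst (k - 1) * (4 ^ k * η) / n ^ k))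
      + 2 * ((fun j : Finset.Iic m => h j) ⬝ᵥ galerkin ψ (covOp μ X) m β
          - linFunctional ψ h β) ^ 2) := by
  have hk0 : k ≠ 0 := by omega
  have hm : (0 : ℝ) < m := by exact_mod_cast m.pos
  have hn' : (0 : ℝ) < n := by exact_mod_cast hn
  have hd0 : 0 < d := by linarith
  set T := covOp μ X with hTdef
  set v := invSqrt (opMatrix ψ m T) *ᵥ fun j : Finset.Iic m => h j with hv
  set f := β - synth ψ m (galerkin ψ T m β) with hf
  have hfa : ∀ a : Finset.Iic m → ℝ, ⟪T f, synth ψ m a⟫_ℝ = 0 :=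
    fun a => inner_galerkin_error_synth hT m a
  have hMf : ⟪T f, f⟫_ℝ + σ ^ 2 ≤ M := by
    have := inner_galerkin_error_le (β := β) hT m
    linarith
  set u : Ω → Fin n → ℝ := fun ω i => ⟪f, Xs i ω⟫_ℝ + σ * εs i ω with hu
  set F : Ω → ℝ := fun ω => frobSq (covDev ψ m T fun i => Xs i ω) with hF
  set w : Ω → Finset.Iic m → ℝ := fun ω => crossDev ψ m T (u ω) fun i => Xs i ω with hw'
  set V : Ω → ℝ := fun ω => (n : ℝ)⁻¹ * ∑ i, u ω i ^ 2 with hV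
  set b := (fun j : Finset.Iic m => h j) ⬝ᵥ galerkin ψ T m β - linFunctional ψ h β with hb
  set l := linFunctional ψ h β with hl
  have I1 := integral_dotProduct_crossDev_sq_le hX (by omega) hη hT hε hεX hS hn hM0 hMf hfa v
  have I2 := integral_frobSq_covDev_sq_le (m := m) hX hk hη hT hS hn
  have I3 := integral_crossDev_sq_le hX hk hη hT hε hεX hS hn hM0 hMf hfa
  have I4 := integral_average_sq_pow_le hX hk0 hη hT hε hS hn hMf
  have I5 := integral_frobSq_covDev_pow_le (m := m) hX hk0 hη hT hS hn
  rw [← hc] at I1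
  have hc0 : 0 ≤ c := hc ▸ dotProduct_self_nonneg v
  have hpt : ∀ ω, (estimator ψ h m α (fun i => ⟪β, Xs i ω⟫_ℝ + σ * εs i ω)
        (fun i => Xs i ω) - l) ^ 2
      ≤ 4 * (v ⬝ᵥ w ω) ^ 2 + 8 * c * (M / m) * F ω ^ 2 + 8 * c * (m / M) * (w ω ⬝ᵥ w ω) ^ 2
        + 2 * c * d * α * n * M / (M ^ (2 * k) * s ^ (2 * k - 1)) * V ω ^ (2 * k)
        + (2 * c * d * α * n * M * s * 4 ^ k + l ^ 2 * 4 ^ k) * F ω ^ k + 2 * b ^ 2 := by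
    intro ω
    have h1 := sq_estimator_sub_le ψ m (h := h) hw hT hd hn hα hαυ β (fun i => Xs i ω)
      (fun i => σ * εs i ω) (u ω) (fun i => rfl)
    refine h1.trans ?_
    rw [← hv, ← hc]
    have hF0 : 0 ≤ F ω := frobSq_nonneg _
    have hV0 : 0 ≤ V ω :=
      mul_nonneg (by positivity) (Finset.sum_nonneg fun i _ => sq_nonneg _)
    have h2 : 16 * c * (F ω * (w ω ⬝ᵥ w ω))
        ≤ 8 * c * (M / m) * F ω ^ 2 + 8 * c * (m / M) * (w ω ⬝ᵥ w ω) ^ 2 := by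
      have h3 : 2 * (F ω * (w ω ⬝ᵥ w ω)) ≤ M / m * F ω ^ 2 + m / M * (w ω ⬝ᵥ w ω) ^ 2 := by
        have h4 : M / m * F ω ^ 2 + m / M * (w ω ⬝ᵥ w ω) ^ 2 - 2 * (F ω * (w ω ⬝ᵥ w ω))
            = M / m * (F ω - m / M * (w ω ⬝ᵥ w ω)) ^ 2 := by field_simp; ring
        have h5 : 0 ≤ M / m * (F ω - m / M * (w ω ⬝ᵥ w ω)) ^ 2 := by positivity
        linarith
      have h6 := mul_le_mul_of_nonneg_left h3 (show 0 ≤ 8 * c by positivity)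
      linarith
    have h7 : (if 1 / 4 < F ω then 2 * (c * (d * (α * n * V ω))) + l ^ 2 else 0)
        ≤ 2 * c * d * α * n * M / (M ^ (2 * k) * s ^ (2 * k - 1)) * V ω ^ (2 * k)
        + (2 * c * d * α * n * M * s * 4 ^ k + l ^ 2 * 4 ^ k) * F ω ^ k := by
      split_ifs with hFω
      · have h8 := le_add_of_one_lt (x := V ω / M) (by positivity) hs hFω hk0
        have h9 : l ^ 2 ≤ l ^ 2 * (4 * F ω) ^ k :=
          le_mul_of_one_le_right (sq_nonneg _) (one_le_pow₀ (by linarith))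
        have h10 : 0 ≤ 2 * c * d * α * n * M := by positivity
        have h11 := mul_le_mul_of_nonneg_left h8 h10
        have h12 : 2 * c * d * α * n * M * (V ω / M) = 2 * (c * (d * (α * n * V ω))) := by
          field_simp
        rw [h12] at h11
        refine (add_le_add h11 h9).trans_eq ?_
        rw [mul_pow, div_pow]
        field_simp
        ring
      · positivity
    linarith
  refine lintegral_ofReal_le_of_le
    (G := fun ω => 4 * (v ⬝ᵥ w ω) ^ 2 + 8 * c * (M / m) * F ω ^ 2
        + 8 * c * (m / M) * (w ω ⬝ᵥ w ω) ^ 2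
        + 2 * c * d * α * n * M / (M ^ (2 * k) * s ^ (2 * k - 1)) * V ω ^ (2 * k)
        + (2 * c * d * α * n * M * s * 4 ^ k + l ^ 2 * 4 ^ k) * F ω ^ k + 2 * b ^ 2)
    ?_ (fun ω => sq_nonneg _) hpt ?_
  · exact (((((I1.1.const_mul _).add (I2.1.const_mul _)).add (I3.1.const_mul _)).add
      (I4.1.const_mul _)).add (I5.1.const_mul _)).add (integrable_const _)
  · have J1 : Integrable (fun ω => 4 * (v ⬝ᵥ w ω) ^ 2) μ := I1.1.const_mul _
    have J2 : Integrable (fun ω => 8 * c * (M / m) * F ω ^ 2) μ := I2.1.const_mul _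
    have J3 : Integrable (fun ω => 8 * c * (m / M) * (w ω ⬝ᵥ w ω) ^ 2) μ := I3.1.const_mul _
    have J4 : Integrable (fun ω => 2 * c * d * α * n * M / (M ^ (2 * k) * s ^ (2 * k - 1))
        * V ω ^ (2 * k)) μ := I4.1.const_mul _
    have J5 : Integrable (fun ω => (2 * c * d * α * n * M * s * 4 ^ k + l ^ 2 * 4 ^ k)
        * F ω ^ k) μ := I5.1.const_mul _
    rw [integral_add (by fun_prop) (by fun_prop), integral_add (by fun_prop) (by fun_prop),
      integral_add (by fun_prop) (by fun_prop), integral_add (by fun_prop) (by fun_prop),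
      integral_add (by fun_prop) (by fun_prop), integral_const_mul, integral_const_mul,
      integral_const_mul, integral_const_mul, integral_const_mul, integral_const, probReal_univ,
      one_smul]
    have hα' : 0 ≤ 2 * c * d * α * n * M := by positivity
    exact add_le_add_left (add_le_add (add_le_add (add_le_add (add_le_add
      (mul_le_mul_of_nonneg_left I1.2 (by norm_num))
      (mul_le_mul_of_nonneg_left I2.2 (by positivity)))
      (mul_le_mul_of_nonneg_left I3.2 (by positivity)))
      (mul_le_mul_of_nonneg_left I4.2 (by positivity)))
      (mul_le_mul_of_nonneg_left I5.2 (by positivity))) _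

end Risk

/-! ### The balancing dimension, the threshold and the rate -/

section Rate

variable {γ υ h : ℕ+ → ℝ} {kstar : ℕ+ → ℕ+}

theorem mul_sum_le_deltaStar (hw : WeightCondition γ υ) {x : ℝ} {n : ℕ+}
    (hx : x ≤ aStar γ υ kstar n) :
    x * ∑ j ∈ Finset.Iic (kstar n), h j ^ 2 / υ j ≤ deltaStar γ υ h kstar n :=
  (mul_le_mul_of_nonneg_right hx
    (Finset.sum_nonneg fun j _ => div_nonneg (sq_nonneg _) (hw.υ_pos j).le)).trans
    (le_max_left _ _)

theorem sum_le_mul_deltaStar (hw : WeightCondition γ υ) (n : ℕ+) :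
    ∑ j ∈ Finset.Iic (kstar n), h j ^ 2 / υ j ≤ n * deltaStar γ υ h kstar n := by
  have hn : (0 : ℝ) < n := by exact_mod_cast n.pos
  have h1 := mul_sum_le_deltaStar (h := h) (kstar := kstar) hw (le_max_right _ (n : ℝ)⁻¹)
  rwa [inv_mul_le_iff₀ hn] at h1

theorem deltaStar_nonneg (hw : WeightCondition γ υ) (n : ℕ+) : 0 ≤ deltaStar γ υ h kstar n :=
  le_max_of_le_right (tsum_nonneg fun j => div_nonneg (sq_nonneg _) (hw.γ_pos j).le)

theorem threshold_le (hw : WeightCondition γ υ) {d : ℝ} (hd : 1 ≤ d)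
    (hκ0 : 0 < kappa γ υ kstar) (hκ1 : kappa γ υ kstar ≤ 1) (n : ℕ+) :
    threshold γ υ kstar d n ≤ 8 * d ^ 3 / kappa γ υ kstar := by
  have h1 : (1 : ℝ) ≤ d ^ 3 := one_le_pow₀ hd
  refine max_le ?_ ?_
  · gcongr
    exact le_mul_of_one_le_right hκ0.le (hw.one_le_γ _)
  · rw [le_div_iff₀ hκ0]; linarith

/-- The threshold lies above `2 d / υ_m`, which bounds the norm of the inverse of `[T̂]_m` when the
whitened `[T̂]_m` is close to the identity. -/
theorem two_mul_div_le_threshold_mul (hw : WeightCondition γ υ) {d : ℝ} (hd : 1 ≤ d)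
    (hκ0 : 0 < kappa γ υ kstar) (n : ℕ+) :
    2 * d / υ (kstar n) ≤ threshold γ υ kstar d n * (n : ℕ) := by
  have hn : (0 : ℝ) < (n : ℕ) := by exact_mod_cast n.pos
  have hυ := hw.υ_pos (kstar n)
  have hγ := hw.γ_pos (kstar n)
  have h1 := kappa_div_le (kstar := kstar) hw hκ0.le n
  refine le_trans ?_ (mul_le_mul_of_nonneg_right (le_max_left _ _) hn.le)
  rw [div_le_div_iff₀ hn hγ] at h1
  rw [div_mul_eq_mul_div, div_le_div_iff₀ hυ (by positivity)]
  have h2 : d ≤ d ^ 3 := le_self_pow₀ hd (by norm_num)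
  calc 2 * d * (kappa γ υ kstar * γ (kstar n)) ≤ 8 * d ^ 3 * (υ (kstar n) * (n : ℕ)) := by
        gcongr
        norm_num
    _ = _ := by ring

/-- The condition `υ_m / γ_m * m ^ L ≤ D` at the balancing dimension, where `υ_m / γ_m` is at least
`κ / n`. -/
theorem kstar_rpow_le (hw : WeightCondition γ υ) {L D : ℝ} (hκ0 : 0 < kappa γ υ kstar)
    (hD : ∀ m : ℕ+, υ m / γ m * (m : ℝ) ^ L ≤ D) (n : ℕ+) :
    ((kstar n : ℕ) : ℝ) ^ L ≤ D / kappa γ υ kstar * (n : ℕ) := by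
  have hn : (0 : ℝ) < (n : ℕ) := by exact_mod_cast n.pos
  have h1 := kappa_div_le (kstar := kstar) hw hκ0.le n
  have h2 := mul_le_mul_of_nonneg_right h1
    (Real.rpow_nonneg (Nat.cast_nonneg (kstar n : ℕ) : (0 : ℝ) ≤ _) L)
  have h3 := h2.trans (hD (kstar n))
  rw [div_mul_eq_mul_div, div_le_iff₀ hn] at h3
  rw [div_mul_eq_mul_div, le_div_iff₀ hκ0]
  linarith

theorem sq_le_sqrt_pow {n : ℝ} (hn : 1 ≤ n) {p : ℕ} (hp : 4 ≤ p) : n ^ 2 ≤ √n ^ p := by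
  calc n ^ 2 = √n ^ 4 := by
        rw [show 4 = 2 * 2 from rfl, pow_mul, Real.sq_sqrt (by linarith)]
    _ ≤ _ := pow_le_pow_right₀ (Real.one_le_sqrt.mpr hn) hp

end Rate

section Variance

variable {Ω : Type*} [MeasurableSpace Ω] {μ : Measure Ω}
  {H : Type*} [NormedAddCommGroup H] [InnerProductSpace ℝ H] [CompleteSpace H]
  [MeasurableSpace H] [BorelSpace H] {X : Ω → H}

theorem inner_covOp_self_le (ψ : HilbertBasis ℕ+ ℝ H) (hX : MemLp X 2 μ) (f : H) :
    ⟪covOp μ X f, f⟫_ℝ ≤ ‖f‖ ^ 2 * ∫ ω, ‖X ω‖ ^ 2 ∂μ := by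
  rw [covOp_inner ψ hX, ← integral_const_mul]
  refine integral_mono_of_nonneg (.of_forall fun ω => mul_self_nonneg _)
    ((hX.integrable_norm_pow (by norm_num)).const_mul _) (.of_forall fun ω => ?_)
  beta_reduce
  rw [← mul_pow, ← sq]
  exact sq_le_sq' (by linarith [neg_abs_le ⟪f, X ω⟫_ℝ, abs_real_inner_le_norm f (X ω)])
    (real_inner_le_norm f (X ω))

end Variance

end FunctionalLinearModel

theorem mainTheorem1 (k : ℕ) (hk : 3 ≤ k) :
    ∃ C : ℝ, 0 < C ∧
      ∀ (H : Type*) [NormedAddCommGroup H] [InnerProductSpace ℝ H] [CompleteSpace H]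
        [MeasurableSpace H] [BorelSpace H] (ψ : HilbertBasis ℕ+ ℝ H)
        (Ω : Type*) [MeasurableSpace Ω] (μ : Measure Ω) [IsProbabilityMeasure μ]
        (γ υ h : ℕ+ → ℝ) (kstar : ℕ+ → ℕ+) (σ ρ η d D : ℝ)
        (X : Ω → H) (ε : Ω → ℝ) (n : ℕ+) (Xs : Fin n → Ω → H) (εs : Fin n → Ω → ℝ),
        0 < σ → 0 < ρ → 1 ≤ η → 1 ≤ d → 1 ≤ D →
        -- the weights, the choice of the dimension, and the representer
        WeightCondition γ υ →
        IsDimensionChoice γ υ kstar →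
        0 < kappa γ υ kstar ∧ kappa γ υ kstar ≤ 1 →
        (∀ m : ℕ+, υ m / γ m * (m : ℝ) ^ expL k ≤ D) →
        MemWeighted (fun j => (γ j)⁻¹) h →
        -- the regressor, the error and the sample
        RegressorClass ψ μ (4 * k) η X →
        LinkClass ψ υ d (covOp μ X) →
        ErrorClass μ (4 * k) η ε →
        ∫ ω, ε ω • X ω ∂μ = 0 →
        IsSample μ X ε Xs εs →
        ⨆ β ∈ ellipsoid ψ γ ρ,
          ∫⁻ ω, ENNReal.ofReal
            (|estimator ψ h (kstar n) (threshold γ υ kstar d n)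
                (fun i => ⟪β, Xs i ω⟫_ℝ + σ * εs i ω) (fun i => Xs i ω)
              - linFunctional ψ h β| ^ 2) ∂μ
          ≤ ENNReal.ofReal
            (C * ρ * η * d ^ 14 * D ^ (k - 1) * (kappa γ υ kstar ^ (k + 1))⁻¹
              * (1 + ρ * weightedNormSq (fun j => (γ j)⁻¹) h + (∫ ω, ‖X ω‖ ^ 2 ∂μ) ^ 2)
              * max 1 ((∫ ω, ‖X ω‖ ^ 2 ∂μ) + σ ^ 2 / ρ)
              * deltaStar γ υ h kstar n) := by
  refine ⟨riskConst k, riskConst_pos k, ?_⟩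
  intro H _ _ _ _ _ ψ Ω _ μ _ γ υ h kstar σ ρ η d D X ε n Xs εs hσ hρ hη hd hD hw _ hκ hL hh
    hX hT hε hεX hS
  obtain ⟨hκ0, hκ1⟩ := hκ
  refine iSup₂_le fun β hβ => ?_
  simp only [sq_abs]
  set V := ∫ ω, ‖X ω‖ ^ 2 ∂μ with hV
  have hV0 : 0 ≤ V := integral_nonneg fun ω => sq_nonneg _
  -- `M` bounds the variance of the residuals for every slope in the ellipsoid.
  set M := ρ * max 1 (V + σ ^ 2 / ρ) with hMdef
  have hρM : ρ ≤ M := le_mul_of_one_le_right hρ.le (le_max_left _ _)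
  have hM : ⟪covOp μ X β, β⟫_ℝ + σ ^ 2 ≤ M := by
    calc _ ≤ ρ * V + σ ^ 2 := by
          gcongr
          refine (inner_covOp_self_le ψ hX.memLp β).trans ?_
          gcongr
          exact norm_sq_le_of_mem_ellipsoid hw hβ
      _ = ρ * (V + σ ^ 2 / ρ) := by field_simp
      _ ≤ M := by
          rw [hMdef]
          gcongr
          exact le_max_right _ _
  have hn : (1 : ℝ) ≤ (n : ℕ) := by exact_mod_cast n.pos
  have hm1 : 1 ≤ (kstar n : ℕ) := (kstar n).pos
  have hs : 1 ≤ √((n : ℕ) : ℝ) := Real.one_le_sqrt.mpr hn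
  have hE : 1 ≤ D / kappa γ υ kstar := by
    rw [le_div_iff₀ hκ0]
    linarith
  have hmL := kstar_rpow_le hw hκ0 hL n
  have hδ0 : 0 ≤ deltaStar γ υ h kstar n := deltaStar_nonneg hw n
  have hq := sum_le_mul_deltaStar (h := h) (kstar := kstar) hw n
  have ht : ∑' j : Set.Ioi (kstar n), h j ^ 2 / γ j ≤ deltaStar γ υ h kstar n := le_max_right _ _
  have hα0 : 0 ≤ threshold γ υ kstar d n := zero_le_one.trans (le_max_right _ _)
  have hα := threshold_le (kstar := kstar) hw hd hκ0 hκ1 n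
  have hαυ := two_mul_div_le_threshold_mul (kstar := kstar) hw hd hκ0 n
  have hc := whitened_representer_sq_le (h := h) hw hT hd (kstar n)
  have hb := bias_sq_le hw hT hd hh hβ (kstar n)
  have hl := linFunctional_sq_le hw hh hβ (kstar n)
  -- The truncation level of the second moment of the residuals is `√n`.
  have hrisk := lintegral_sq_error_le (h := h) (α := threshold γ υ kstar d n) (β := β) hw hX
    (by omega) hη hT hd hε hεX hS n.pos hα0 hαυ (hρ.trans_le hρM) hM rfl (zero_lt_one.trans_le hs)
  refine hrisk.trans (ENNReal.ofReal_le_ofReal ?_)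
  refine (risk_terms_le hn hs (sq_le_sqrt_pow hn (by omega)) (by exact_mod_cast hm1) hη hρ hρM
    (dotProduct_self_nonneg _) (δ := deltaStar γ υ h kstar n) ?_ hd hα0 hα hκ0 hκ1 hδ0
    (dimension_pow_le hk hm1 hmL).1 (Q := (D / kappa γ υ kstar) ^ (k - 2)) ?_ (one_le_pow₀ hE)
    (dimension_pow_mul_sqrt_le hk hm1 hn hE hmL) ?_ ?_).trans ?_
  · refine hc.trans ?_
    rw [mul_assoc]
    gcongr
  · exact le_self_pow₀ hE (by omega)
  · refine hb.trans ?_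
    have h1 := mul_sum_le_deltaStar (h := h) (kstar := kstar) (n := n) hw (le_max_left _ _)
    have h2 : (1 : ℝ) ≤ d ^ 2 := one_le_pow₀ hd
    calc _ ≤ 2 * ρ * (d ^ 2 * deltaStar γ υ h kstar n + d ^ 2 * deltaStar γ υ h kstar n) := by
          gcongr
          exact ht.trans (le_mul_of_one_le_left hδ0 h2)
      _ = _ := by ring
  · refine hl.trans ?_
    calc _ ≤ ρ * ((n : ℕ) * deltaStar γ υ h kstar n + (n : ℕ) * deltaStar γ υ h kstar n) := by
          gcongr
          exact ht.trans (le_mul_of_one_le_left hδ0 hn)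
      _ = _ := by ring
  · have hC := riskConst_pos k
    have hW : 0 ≤ weightedNormSq (fun j => (γ j)⁻¹) h :=
      tsum_nonneg fun j => mul_nonneg (inv_nonneg.mpr (hw.γ_pos j).le) (sq_nonneg _)
    have hWV : 1 ≤ 1 + ρ * weightedNormSq (fun j => (γ j)⁻¹) h + V ^ 2 := by
      have : 0 ≤ ρ * weightedNormSq (fun j => (γ j)⁻¹) h := by positivity
      nlinarith [sq_nonneg V]
    -- The left side is `D ^ (k - 2) / κ ^ (k - 1)`, while `D ≥ 1` and `κ ≤ 1`.
    have hQ : (D / kappa γ υ kstar) ^ (k - 2) / kappa γ υ kstar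
        ≤ D ^ (k - 1) * (kappa γ υ kstar ^ (k + 1))⁻¹ := by
      rw [div_pow, div_div, ← pow_succ, div_eq_mul_inv]
      gcongr ?_ * ?_
      · exact pow_le_pow_right₀ hD (by omega)
      · refine inv_anti₀ (by positivity) ?_
        exact pow_le_pow_of_le_one hκ0.le hκ1 (by omega)
    have hmax : 0 ≤ max 1 (V + σ ^ 2 / ρ) := zero_le_one.trans (le_max_left _ _)
    calc _ ≤ riskConst k * (η * M * d ^ 14 * (D ^ (k - 1) * (kappa γ υ kstar ^ (k + 1))⁻¹)
          * deltaStar γ υ h kstar n) := by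
          have hM0 : 0 < M := hρ.trans_le hρM
          gcongr
          norm_num
      _ ≤ riskConst k * (η * M * d ^ 14 * (D ^ (k - 1) * (kappa γ υ kstar ^ (k + 1))⁻¹)
          * deltaStar γ υ h kstar n)
          * (1 + ρ * weightedNormSq (fun j => (γ j)⁻¹) h + V ^ 2) := by
          refine le_mul_of_one_le_right ?_ hWV
          have hM0 : 0 < M := hρ.trans_le hρM
          positivity
      _ = _ := by rw [hMdef]; ring
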